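/- Let $F_n$ be the free group of rank $n$, identified with $\pi_1(R_n)$, where $R_n$ is the rose (graph with one vertex) with $n$ edges. A marked graph of rank $n$ is a pair $(\Gamma,g)$, where $\Gamma$ is a finite connected graph with no separating edges and no vertices of valence less than $3$, all of whose edges have length $1$, and $g\colon R_n\to\Gamma$ is a homotopy equivalence; $(\Gamma,g)$ and $(\Gamma',g')$ are equivalent if $g'$ is homotopic to $h\circ g$ for some isometry $h\colon\Gamma\to\Gamma'$. (Up to homotopy, $g$ is the same thing as an isomorphism $F_n\cong\pi_1(\Gamma,v)$ up to change of base path.) Let $X_n$ be the spine of Outer space: the geometric realization, with the weak topology, of the simplicial complex whose vertices are the equivalence classes of marked graphs of rank $n$, and in which a finite nonempty set of vertices spans a simplex if, of any two of its distinct members, one is obtained from the other by collapsing a forest and composing the marking with the collapsing map. The group $\mathrm{Out}(F_n)$ acts on $X_n$ on the right by $(\Gamma,g)\cdot\varphi=(\Gamma,g\circ\varphi)$. Let $T_n=\ker(\mathrm{Out}(F_n)\to \mathrm{GL}_n(\mathbb Z))$ be the Torelli group and let $Y_n=X_n/T_n$, with the quotient topology. A rose in $Y_n$ is the image of a vertex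 $(\Gamma,g)$ of $X_n$ for which $\Gamma$ has one vertex; its star $\mathrm{St}(\rho)\subset Y_n$ is the image of the union of all closed simplices of $X_n$ that contain $(\Gamma,g)$. The underlying graph of a point of $X_n$ (or of its image in $Y_n$) is the graph $\Gamma$ of the vertex of the open simplex containing it from which all other vertices of that simplex are obtained by collapsing forests. Rank $n$ cactus graphs are defined inductively. A rank $1$ cactus graph is a circle with one vertex and one edge. A rank $n$ cactus graph is obtained by gluing the vertex of a rank $1$ cactus graph to a point (a vertex or an interior point of an edge) of a rank $n-1$ cactus graph; the set of vertices of the new graph is the union of the two sets of vertices. Let $\mathcal C(\rho)\subset \mathrm{St}(\rho)$ be the subspace of points whose underlying graph is a rank $n$ cactus graph. **Theorem.** For every rose $\rho$ in $Y_n$, the star $\mathrm{St}(\rho)$ strong deformation retracts onto $\mathcal C(\rho)$. Hence, if $n\ge 2$, then $\mathrm{St}(\rho)$ is homotopy equivalent to a CW complex of dimension $n-2$. -/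

import Mathlib

open Topology

/-! ### Finite graphs -/

/-- A finite graph: vertices `V`, oriented edges `D`, the initial vertex `src d` and the reversal
`rev d` of an oriented edge `d`.  An (unoriented) edge is a pair `{d, rev d}`; loops and multiple
edges are allowed. -/
structure FinGraph where
  V : Type
  D : Type
  [finite_V : Finite V]
  [finite_D : Finite D]
  src : D → V
  rev : D → D
  rev_rev : ∀ d, rev (rev d) = d
  rev_ne : ∀ d, rev d ≠ d

namespace FinGraph

/-- The terminal vertex of an oriented edge. -/
def tgt (Γ : FinGraph) (d : Γ.D) : Γ.V := Γ.src (Γ.rev d)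

/-- The valence of a vertex (a loop counts twice). -/
noncomputable def valence (Γ : FinGraph) (v : Γ.V) : ℕ := Nat.card {d : Γ.D // Γ.src d = v}

/-- `Γ.IsWalk u v l`: the list `l` of oriented edges is an edge path from `u` to `v`. -/
def IsWalk (Γ : FinGraph) : Γ.V → Γ.V → List Γ.D → Prop
  | u, v, [] => u = v
  | u, v, d :: l => Γ.src d = u ∧ Γ.IsWalk (Γ.tgt d) v l

def IsConnected (Γ : FinGraph) : Prop := ∀ u v, ∃ l, Γ.IsWalk u v l

/-- In a connected graph: removing the edge `{d, rev d}` disconnects the graph. -/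
def IsSeparating (Γ : FinGraph) (d : Γ.D) : Prop :=
  ¬ ∃ l, Γ.IsWalk (Γ.src d) (Γ.tgt d) l ∧ d ∉ l ∧ Γ.rev d ∉ l

/-- A set of edges (a set of oriented edges closed under reversal) is a forest if it carries no
nontrivial closed edge path without backtracking. -/
structure IsForest (Γ : FinGraph) (F : Set Γ.D) : Prop where
  rev_mem : ∀ d ∈ F, Γ.rev d ∈ F
  acyclic : ∀ v l, Γ.IsWalk v v l → (∀ d ∈ l, d ∈ F) →
    l.IsChain (fun a b => b ≠ Γ.rev a) → l = []

/-- The group generated by the oriented edges, with `rev d` the inverse of `d`. -/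
abbrev EdgeGroup (Γ : FinGraph) : Type :=
  PresentedGroup (Set.range fun d : Γ.D => FreeGroup.of d * FreeGroup.of (Γ.rev d))

/-- The generator of the edge group given by an oriented edge. -/
def edge (Γ : FinGraph) (d : Γ.D) : Γ.EdgeGroup := PresentedGroup.of d

lemma edge_rev (Γ : FinGraph) (d : Γ.D) : Γ.edge (Γ.rev d) = (Γ.edge d)⁻¹ := by
  rw [eq_inv_iff_mul_eq_one, mul_eq_one_iff_inv_eq', inv_eq_iff_mul_eq_one]
  exact PresentedGroup.one_of_mem ⟨d, rfl⟩

/-- The homomorphism out of the edge group given by the images of the oriented edges. -/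
def liftEdge (Γ : FinGraph) {G : Type*} [Group G] (f : Γ.D → G)
    (hf : ∀ d, f d * f (Γ.rev d) = 1) : Γ.EdgeGroup →* G :=
  PresentedGroup.toGroup (f := f) (by rintro _ ⟨d, rfl⟩; simpa using hf d)

@[simp] lemma liftEdge_edge (Γ : FinGraph) {G : Type*} [Group G] (f : Γ.D → G)
    (hf : ∀ d, f d * f (Γ.rev d) = 1) (d : Γ.D) : Γ.liftEdge f hf (Γ.edge d) = f d :=
  PresentedGroup.toGroup.of _

/-- The homotopy classes (relative to end points) of edge paths from `u` to `v`.  Two edge paths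
from `u` to `v` are homotopic iff they differ by insertions and deletions of backtrackings
`d, rev d`, that is, iff their products in the edge group agree. -/
def pathClasses (Γ : FinGraph) (u v : Γ.V) : Set Γ.EdgeGroup :=
  {w | ∃ l, Γ.IsWalk u v l ∧ (l.map Γ.edge).prod = w}

lemma IsWalk.append {Γ : FinGraph} {u v w : Γ.V} {l m : List Γ.D} (hl : Γ.IsWalk u v l)
    (hm : Γ.IsWalk v w m) : Γ.IsWalk u w (l ++ m) := by
  induction l generalizing u with
  | nil => obtain rfl : u = v := hl; exact hm
  | cons d l ih => exact ⟨hl.1, ih hl.2⟩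

lemma one_mem_pathClasses (Γ : FinGraph) (u : Γ.V) : 1 ∈ Γ.pathClasses u u := ⟨[], rfl, rfl⟩

lemma mul_mem_pathClasses {Γ : FinGraph} {u v w : Γ.V} {a b : Γ.EdgeGroup}
    (ha : a ∈ Γ.pathClasses u v) (hb : b ∈ Γ.pathClasses v w) : a * b ∈ Γ.pathClasses u w := by
  obtain ⟨l, hl, rfl⟩ := ha
  obtain ⟨m, hm, rfl⟩ := hb
  exact ⟨l ++ m, hl.append hm, by simp⟩

lemma edge_mem_pathClasses (Γ : FinGraph) (d : Γ.D) :
    Γ.edge d ∈ Γ.pathClasses (Γ.src d) (Γ.tgt d) := ⟨[d], ⟨rfl, rfl⟩, by simp⟩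

/-- A property of path classes can be proved edge by edge. -/
lemma pathClasses_induction {Γ : FinGraph} {P : Γ.V → Γ.V → Γ.EdgeGroup → Prop}
    (h1 : ∀ u, P u u 1)
    (hcons : ∀ d v w, w ∈ Γ.pathClasses (Γ.tgt d) v → P (Γ.tgt d) v w →
      P (Γ.src d) v (Γ.edge d * w))
    {u v : Γ.V} {w : Γ.EdgeGroup} (hw : w ∈ Γ.pathClasses u v) : P u v w := by
  obtain ⟨l, hl, rfl⟩ := hw
  induction l generalizing u with
  | nil => obtain rfl : u = v := hl; exact h1 u
  | cons d l ih =>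
    obtain ⟨rfl, hl⟩ := hl
    simpa using hcons d v _ ⟨l, hl, rfl⟩ (ih hl)

lemma inv_mem_pathClasses {Γ : FinGraph} {u v : Γ.V} {a : Γ.EdgeGroup}
    (ha : a ∈ Γ.pathClasses u v) : a⁻¹ ∈ Γ.pathClasses v u := by
  refine pathClasses_induction (P := fun u v a => a⁻¹ ∈ Γ.pathClasses v u) ?_ ?_ ha
  · intro u; simpa using Γ.one_mem_pathClasses u
  · intro d v w _ ih
    rw [mul_inv_rev, ← edge_rev]
    refine mul_mem_pathClasses ih ?_
    have := Γ.edge_mem_pathClasses (Γ.rev d)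
    rwa [tgt, rev_rev] at this

/-- The fundamental group `π₁(Γ, v)`: the homotopy classes of closed edge paths at `v`. -/
def pi1 (Γ : FinGraph) (v : Γ.V) : Subgroup Γ.EdgeGroup where
  carrier := Γ.pathClasses v v
  one_mem' := Γ.one_mem_pathClasses v
  mul_mem' := mul_mem_pathClasses
  inv_mem' := inv_mem_pathClasses

/-- An isomorphism of graphs (edges may be reversed).  For graphs all of whose edges have length
one these are the isometries. -/
structure Iso (Γ Δ : FinGraph) where
  onV : Γ.V ≃ Δ.V
  onD : Γ.D ≃ Δ.D
  src_onD : ∀ d, Δ.src (onD d) = onV (Γ.src d)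
  rev_onD : ∀ d, Δ.rev (onD d) = onD (Γ.rev d)

namespace Iso

def refl (Γ : FinGraph) : Iso Γ Γ := ⟨.refl _, .refl _, fun _ => rfl, fun _ => rfl⟩

def symm {Γ Δ : FinGraph} (h : Iso Γ Δ) : Iso Δ Γ where
  onV := h.onV.symm
  onD := h.onD.symm
  src_onD d := by
    rw [Equiv.eq_symm_apply, ← h.src_onD, Equiv.apply_symm_apply]
  rev_onD d := by
    rw [Equiv.eq_symm_apply, ← h.rev_onD, Equiv.apply_symm_apply]

def trans {Γ Δ Θ : FinGraph} (h : Iso Γ Δ) (k : Iso Δ Θ) : Iso Γ Θ where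
  onV := h.onV.trans k.onV
  onD := h.onD.trans k.onD
  src_onD d := by simp [k.src_onD, h.src_onD]
  rev_onD d := by simp [k.rev_onD, h.rev_onD]

/-- The induced map on (classes of) edge paths. -/
def onEdgeGroup {Γ Δ : FinGraph} (h : Iso Γ Δ) : Γ.EdgeGroup →* Δ.EdgeGroup :=
  Γ.liftEdge (fun d => Δ.edge (h.onD d)) (fun d => by
    rw [← h.rev_onD, edge_rev, mul_inv_cancel])

@[simp] lemma onEdgeGroup_edge {Γ Δ : FinGraph} (h : Iso Γ Δ) (d : Γ.D) :
    h.onEdgeGroup (Γ.edge d) = Δ.edge (h.onD d) := liftEdge_edge ..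

lemma onEdgeGroup_refl (Γ : FinGraph) : (refl Γ).onEdgeGroup = MonoidHom.id _ :=
  PresentedGroup.ext fun d => onEdgeGroup_edge _ d

lemma onEdgeGroup_trans {Γ Δ Θ : FinGraph} (h : Iso Γ Δ) (k : Iso Δ Θ) :
    (h.trans k).onEdgeGroup = k.onEdgeGroup.comp h.onEdgeGroup := by
  refine PresentedGroup.ext fun d => ?_
  have e1 := onEdgeGroup_edge (h.trans k) d
  have e2 := onEdgeGroup_edge h d
  have e3 := onEdgeGroup_edge k (h.onD d)
  rw [MonoidHom.comp_apply]
  exact e1.trans (e3.symm.trans (congrArg _ e2.symm))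

lemma symm_onEdgeGroup_apply {Γ Δ : FinGraph} (h : Iso Γ Δ) (w : Γ.EdgeGroup) :
    h.symm.onEdgeGroup (h.onEdgeGroup w) = w := by
  rw [← MonoidHom.comp_apply, ← onEdgeGroup_trans]
  have : h.trans h.symm = refl Γ := by
    simp [trans, symm, refl]
  rw [this, onEdgeGroup_refl, MonoidHom.id_apply]

lemma map_mem_pathClasses {Γ Δ : FinGraph} (h : Iso Γ Δ) {u v : Γ.V} {w : Γ.EdgeGroup}
    (hw : w ∈ Γ.pathClasses u v) : h.onEdgeGroup w ∈ Δ.pathClasses (h.onV u) (h.onV v) := by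
  refine pathClasses_induction
    (P := fun u v w => h.onEdgeGroup w ∈ Δ.pathClasses (h.onV u) (h.onV v)) ?_ ?_ hw
  · intro u; simpa using Δ.one_mem_pathClasses (h.onV u)
  · intro d v w _ ih
    rw [map_mul, onEdgeGroup_edge]
    refine mul_mem_pathClasses ?_ ih
    have := Δ.edge_mem_pathClasses (h.onD d)
    rwa [tgt, h.rev_onD, h.src_onD, h.src_onD] at this

end Iso

/-- The graph `Γ / F` obtained by collapsing every edge of `F` to a point. -/
def collapse (Γ : FinGraph) (F : Set Γ.D) (hF : Γ.IsForest F) : FinGraph where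
  V := Quot fun u v : Γ.V => ∃ d ∈ F, Γ.src d = u ∧ Γ.tgt d = v
  D := {d : Γ.D // d ∉ F}
  finite_V := by
    have := Γ.finite_V
    infer_instance
  finite_D := by
    have := Γ.finite_D
    infer_instance
  src d := Quot.mk _ (Γ.src d.1)
  rev d := ⟨Γ.rev d.1, fun h => d.2 (by simpa [Γ.rev_rev] using hF.rev_mem _ h)⟩
  rev_rev d := Subtype.ext (Γ.rev_rev d.1)
  rev_ne d h := Γ.rev_ne d.1 (congrArg Subtype.val h)

open Classical in
/-- The collapsing map `Γ → Γ / F` on (classes of) edge paths. -/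
noncomputable def collapseHom (Γ : FinGraph) (F : Set Γ.D) (hF : Γ.IsForest F) :
    Γ.EdgeGroup →* (Γ.collapse F hF).EdgeGroup :=
  Γ.liftEdge (fun d => if h : d ∉ F then (Γ.collapse F hF).edge ⟨d, h⟩ else 1) (fun d => by
    have key : Γ.rev d ∈ F ↔ d ∈ F :=
      ⟨fun h => by simpa [Γ.rev_rev] using hF.rev_mem _ h, hF.rev_mem d⟩
    by_cases h : d ∈ F
    · simp [h, key]
    · have h' : Γ.rev d ∉ F := fun hh => h (key.1 hh)
      simp only [h, h', not_false_eq_true, dite_true]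
      have := (Γ.collapse F hF).edge_rev ⟨d, h⟩
      rw [mul_eq_one_iff_inv_eq, ← this]
      rfl)

/-! ### Cactus graphs -/

/-- The graph obtained from `Γ` by gluing a circle with one vertex to the vertex `p`. -/
def addLoop (Γ : FinGraph) (p : Γ.V) : FinGraph where
  V := Γ.V
  D := Γ.D ⊕ Bool
  finite_V := Γ.finite_V
  finite_D := by
    have := Γ.finite_D
    infer_instance
  src := Sum.elim Γ.src fun _ => p
  rev := Sum.map Γ.rev not
  rev_rev := by rintro (d | b) <;> simp [Γ.rev_rev]
  rev_ne := by rintro (d | b) <;> simp [Γ.rev_ne]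

open Classical in
/-- The graph obtained from `Γ` by declaring an interior point of the edge `{d, rev d}` to be a
new vertex `none`.  The first halves of `d` and of `rev d` keep their names, and
`inr false`, `inr true` are the reversals of these two halves. -/
noncomputable def subdivide (Γ : FinGraph) (d : Γ.D) : FinGraph where
  V := Option Γ.V
  D := Γ.D ⊕ Bool
  finite_V := by
    have := Γ.finite_V
    infer_instance
  finite_D := by
    have := Γ.finite_D
    infer_instance
  src := Sum.elim (fun e => some (Γ.src e)) fun _ => none
  rev := Sum.elim
    (fun e => if e = d then .inr false else if e = Γ.rev d then .inr true else .inl (Γ.rev e))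
    (fun b => bif b then .inl (Γ.rev d) else .inl d)
  rev_rev := by
    have hd := Γ.rev_ne d
    rintro (e | b)
    · by_cases h1 : e = d
      · simp [h1]
      · by_cases h2 : e = Γ.rev d
        · simp [h2, hd]
        · have h3 : Γ.rev e ≠ d := fun h => h2 (by rw [← h, Γ.rev_rev])
          have h4 : Γ.rev e ≠ Γ.rev d := fun h => h1 (by rw [← Γ.rev_rev e, h, Γ.rev_rev])
          simp [h1, h2, h3, h4, Γ.rev_rev]
    · cases b <;> simp [hd]
  rev_ne := by
    rintro (e | b)
    · by_cases h1 : e = d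
      · simp [h1]
      · by_cases h2 : e = Γ.rev d
        · simp [h2, Γ.rev_ne d]
        · simp [h1, h2, Γ.rev_ne]
    · cases b <;> simp

/-- Rank `n` cactus graphs: a rank 1 cactus graph is a circle with one vertex, and a rank `n + 1`
cactus graph is obtained from a rank `n` cactus graph by gluing the vertex of a rank 1 cactus graph
to one of its points, which may be a vertex or an interior point of an edge; in the latter case
this point becomes a vertex. -/
inductive IsCactus : ℕ → FinGraph → Prop
  | circle (Δ : FinGraph) (hV : Nat.card Δ.V = 1) (hD : Nat.card Δ.D = 2) : IsCactus 1 Δ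
  | glueAtVertex (n : ℕ) (Γ Δ : FinGraph) (hΓ : IsCactus n Γ) (p : Γ.V)
      (h : Nonempty (Iso (Γ.addLoop p) Δ)) : IsCactus (n + 1) Δ
  | glueInEdge (n : ℕ) (Γ Δ : FinGraph) (hΓ : IsCactus n Γ) (d : Γ.D)
      (h : Nonempty (Iso ((Γ.subdivide d).addLoop none) Δ)) : IsCactus (n + 1) Δ

end FinGraph

/-! ### Marked graphs -/

/-- The fundamental group `F_n` of the standard rose `R_n`. -/
abbrev Fr (n : ℕ) : Type := FreeGroup (Fin n)

/-- A marked graph of rank `n`: a finite connected graph without separating edges and without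
vertices of valence less than 3, all edges having length 1, together with a marking.  A homotopy
equivalence `g : R_n → Γ` is recorded by an image `base` of the vertex of `R_n` and the induced
isomorphism `F_n = π₁(R_n) ≅ π₁(Γ, base)`. -/
structure MarkedGraph (n : ℕ) where
  graph : FinGraph
  connected : graph.IsConnected
  not_separating : ∀ d, ¬ graph.IsSeparating d
  three_le_valence : ∀ v, 3 ≤ graph.valence v
  base : graph.V
  marking : Fr n ≃* graph.pi1 base

namespace MarkedGraph

variable {n : ℕ}

/-- `(Γ, g)` and `(Γ', g')` are equivalent if there is an isometry `h : Γ → Γ'` such that `h ∘ g`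
is (freely) homotopic to `g'`; `p` is the class of the path traced out by the base point during
the homotopy. -/
def Equivalent (A B : MarkedGraph n) : Prop :=
  ∃ h : FinGraph.Iso A.graph B.graph, ∃ p ∈ B.graph.pathClasses (h.onV A.base) B.base,
    ∀ x, (B.marking x : B.graph.EdgeGroup) = p⁻¹ * h.onEdgeGroup (A.marking x) * p

/-- `B` is obtained from `A` by collapsing a forest, up to equivalence: there are a forest `F` in
`Γ` and an isometry `h : Γ / F → Γ'` such that `g'` is homotopic to `h ∘ c ∘ g`, where
`c : Γ → Γ / F` is the collapsing map. -/
def CollapsesTo (A B : MarkedGraph n) : Prop :=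
  ∃ (F : Set A.graph.D) (hF : A.graph.IsForest F)
    (h : FinGraph.Iso (A.graph.collapse F hF) B.graph),
    ∃ p ∈ B.graph.pathClasses (h.onV (Quot.mk _ A.base)) B.base,
      ∀ x, (B.marking x : B.graph.EdgeGroup) =
        p⁻¹ * h.onEdgeGroup (A.graph.collapseHom F hF (A.marking x)) * p

/-- `(Γ, g) · φ = (Γ, g ∘ φ)`. -/
def precomp (A : MarkedGraph n) (φ : MulAut (Fr n)) : MarkedGraph n :=
  { A with marking := MulEquiv.trans φ A.marking }

lemma Equivalent.refl (A : MarkedGraph n) : Equivalent A A :=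
  ⟨.refl _, 1, A.graph.one_mem_pathClasses _, fun x => by simp [FinGraph.Iso.onEdgeGroup_refl]⟩

lemma Equivalent.symm {A B : MarkedGraph n} (H : Equivalent A B) : Equivalent B A := by
  obtain ⟨h, p, hp, H⟩ := H
  refine ⟨h.symm, h.symm.onEdgeGroup p⁻¹, ?_, fun x => ?_⟩
  · have := h.symm.map_mem_pathClasses (FinGraph.inv_mem_pathClasses hp)
    have e : h.symm.onV (h.onV A.base) = A.base := h.onV.symm_apply_apply _
    rwa [e] at this
  · rw [H, map_mul, map_mul, h.symm_onEdgeGroup_apply, map_inv]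
    group

lemma Equivalent.trans {A B C : MarkedGraph n} (H : Equivalent A B) (K : Equivalent B C) :
    Equivalent A C := by
  obtain ⟨h, p, hp, H⟩ := H
  obtain ⟨k, q, hq, K⟩ := K
  refine ⟨h.trans k, k.onEdgeGroup p * q,
    FinGraph.mul_mem_pathClasses (k.map_mem_pathClasses hp) hq, fun x => ?_⟩
  rw [K, H, FinGraph.Iso.onEdgeGroup_trans, MonoidHom.comp_apply, map_mul, map_mul, map_inv]
  group

instance setoid (n : ℕ) : Setoid (MarkedGraph n) :=
  ⟨Equivalent, Equivalent.refl, Equivalent.symm, Equivalent.trans⟩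

lemma Equivalent.precomp {A B : MarkedGraph n} (H : Equivalent A B) (φ : MulAut (Fr n)) :
    Equivalent (A.precomp φ) (B.precomp φ) := by
  obtain ⟨h, p, hp, H⟩ := H
  exact ⟨h, p, hp, fun x => H (φ x)⟩

lemma CollapsesTo.precomp {A B : MarkedGraph n} (H : CollapsesTo A B) (φ : MulAut (Fr n)) :
    CollapsesTo (A.precomp φ) (B.precomp φ) := by
  obtain ⟨F, hF, h, p, hp, H⟩ := H
  exact ⟨F, hF, h, p, hp, fun x => H (φ x)⟩

/-- Inner automorphisms do not change the equivalence class. -/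
lemma equivalent_precomp_conj (A : MarkedGraph n) (a : Fr n) :
    Equivalent A (A.precomp (MulAut.conj a)) := by
  refine ⟨.refl _, ((A.marking a : A.graph.EdgeGroup))⁻¹,
    FinGraph.inv_mem_pathClasses (A.marking a).2, fun x => ?_⟩
  change ((A.marking (MulAut.conj a x) : A.graph.pi1 A.base) : A.graph.EdgeGroup) = _
  have e : (FinGraph.Iso.refl A.graph).onEdgeGroup (A.marking x) = A.marking x := by
    rw [FinGraph.Iso.onEdgeGroup_refl, MonoidHom.id_apply]
  have key : ∀ u v w : A.graph.EdgeGroup, w = v → u * v * u⁻¹ = u⁻¹⁻¹ * w * u⁻¹ := by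
    rintro u v w rfl
    rw [inv_inv]
  refine Eq.trans ?_ (key _ _ _ e)
  simp [MulAut.conj_apply]

end MarkedGraph

/-! ### `Out(F_n)` and its Torelli subgroup -/

/-- Inner automorphisms. -/
abbrev Inn (n : ℕ) : Subgroup (MulAut (Fr n)) := (MulAut.conj : Fr n →* MulAut (Fr n)).range

instance (n : ℕ) : (Inn n).Normal where
  conj_mem := by
    rintro _ ⟨a, rfl⟩ φ
    refine ⟨φ a, ?_⟩
    ext x
    simp [MulAut.conj_apply]

/-- `Out(F_n)`. -/
abbrev OutF (n : ℕ) : Type := MulAut (Fr n) ⧸ Inn n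

/-- The action of `Aut(F_n)` on the abelianization `ℤⁿ` of `F_n`. -/
def autAb (n : ℕ) : MulAut (Fr n) →* MulAut (Abelianization (Fr n)) where
  toFun φ := MulEquiv.abelianizationCongr φ
  map_one' := by
    ext x
    induction x using QuotientGroup.induction_on
    rfl
  map_mul' φ ψ := by
    ext x
    induction x using QuotientGroup.induction_on
    rfl

/-- The homomorphism from `Out(F_n)` to the automorphism group `GL_n(ℤ)` of the abelianization
`ℤⁿ` of `F_n`. -/
def outAb (n : ℕ) : OutF n →* MulAut (Abelianization (Fr n)) :=
  QuotientGroup.lift (Inn n) (autAb n) (by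
    rintro _ ⟨a, rfl⟩
    ext x
    induction x using QuotientGroup.induction_on with
    | H y =>
      change Abelianization.of (MulAut.conj a y) = Abelianization.of y
      simp [MulAut.conj_apply])

/-- The Torelli group `T_n`: the kernel of `Out(F_n) → GL_n(ℤ)`. -/
def torelli (n : ℕ) : Subgroup (OutF n) := (outAb n).ker

/-! ### Geometric realization of a simplicial complex -/

/-- The geometric realization of an abstract simplicial complex: families of nonnegative
barycentric coordinates which vanish off some simplex and add up to 1. -/
@[ext]
structure Realization {ι : Type*} (K : AbstractSimplicialComplex ι) where
  coord : ι → ℝ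
  nonneg : ∀ i, 0 ≤ coord i
  exists_face : ∃ s ∈ K.faces, (∀ i ∉ s, coord i = 0) ∧ ∑ i ∈ s, coord i = 1

namespace Realization

variable {ι : Type*} {K : AbstractSimplicialComplex ι}

/-- The closed simplex spanned by a set of vertices. -/
def closedSimplex (K : AbstractSimplicialComplex ι) (s : Finset ι) : Set (Realization K) :=
  {x | ∀ i ∉ s, x.coord i = 0}

/-- The weak topology: a set is open iff its intersection with every closed simplex is open in the
Euclidean topology of that simplex. -/
instance : TopologicalSpace (Realization K) :=
  ⨆ s : K.faces, TopologicalSpace.coinduced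
    (Subtype.val : closedSimplex K s.1 → Realization K)
    (TopologicalSpace.induced (fun x => x.1.coord) inferInstance)

/-- The closed star of a vertex: the union of the closed simplices containing it. -/
def star (K : AbstractSimplicialComplex ι) (i : ι) : Set (Realization K) :=
  ⋃ s ∈ {s ∈ K.faces | i ∈ s}, closedSimplex K s

end Realization

/-! ### The spine of Outer space and its quotient by the Torelli group -/

/-- The vertices of the spine: equivalence classes of marked graphs. -/
def SpineVertex (n : ℕ) : Type 1 := Quotient (MarkedGraph.setoid n)

namespace SpineVertex

variable {n : ℕ}

/-- The equivalence class of a marked graph. -/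
def mk (A : MarkedGraph n) : SpineVertex n := Quotient.mk (MarkedGraph.setoid n) A

/-- `τ` is obtained from `σ` by collapsing a forest. -/
def Collapses (σ τ : SpineVertex n) : Prop :=
  ∃ A B : MarkedGraph n, mk A = σ ∧ mk B = τ ∧ A.CollapsesTo B

def IsRose (σ : SpineVertex n) : Prop := ∃ A : MarkedGraph n, mk A = σ ∧ Nat.card A.graph.V = 1

/-- The right action of an automorphism on the vertices. -/
def act (φ : MulAut (Fr n)) : SpineVertex n → SpineVertex n :=
  Quotient.map (fun A => A.precomp φ) fun _ _ H => H.precomp φ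

lemma act_one (σ : SpineVertex n) : act 1 σ = σ := by
  induction σ using Quotient.inductionOn
  rfl

lemma act_mul (φ ψ : MulAut (Fr n)) (σ : SpineVertex n) : act (φ * ψ) σ = act ψ (act φ σ) := by
  induction σ using Quotient.inductionOn
  rfl

lemma act_conj (a : Fr n) (σ : SpineVertex n) : act (MulAut.conj a) σ = σ := by
  induction σ using Quotient.inductionOn with
  | h A => exact Quotient.sound (MarkedGraph.equivalent_precomp_conj A a).symm

/-- The right action of `Out(F_n)` on the vertices, as a homomorphism. -/
def outPerm (n : ℕ) : OutF n →* (Equiv.Perm (SpineVertex n))ᵐᵒᵖ :=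
  QuotientGroup.lift (Inn n)
    { toFun := fun φ => MulOpposite.op
        { toFun := act φ
          invFun := act φ⁻¹
          left_inv := fun σ => by rw [← act_mul, mul_inv_cancel, act_one]
          right_inv := fun σ => by rw [← act_mul, inv_mul_cancel, act_one] }
      map_one' := by
        apply MulOpposite.unop_injective
        ext σ
        exact act_one σ
      map_mul' := fun φ ψ => by
        apply MulOpposite.unop_injective
        ext σ
        exact act_mul φ ψ σ }
    (by
      rintro _ ⟨a, rfl⟩
      apply MulOpposite.unop_injective
      ext σ
      exact act_conj a σ)

/-- The right action `(Γ, g) · φ = (Γ, g ∘ φ)` of `Out(F_n)` on the vertices. -/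
instance : MulAction (OutF n)ᵐᵒᵖ (SpineVertex n) where
  smul φ σ := (outPerm n φ.unop).unop σ
  one_smul σ := by
    change (outPerm n 1).unop σ = σ
    simp
  mul_smul φ ψ σ := by
    change (outPerm n (ψ.unop * φ.unop)).unop σ = _
    rw [map_mul]
    rfl

lemma op_mk_smul (φ : MulAut (Fr n)) (A : MarkedGraph n) :
    MulOpposite.op (φ : OutF n) • mk A = mk (A.precomp φ) := rfl

lemma Collapses.smul {σ τ : SpineVertex n} (H : Collapses σ τ) (φ : (OutF n)ᵐᵒᵖ) :
    Collapses (φ • σ) (φ • τ) := by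
  obtain ⟨A, B, rfl, rfl, H⟩ := H
  induction φ using MulOpposite.rec' with
  | h φ =>
    induction φ using QuotientGroup.induction_on with
    | H φ => exact ⟨A.precomp φ, B.precomp φ, rfl, rfl, H.precomp φ⟩

end SpineVertex

/-- The spine of Outer space as an abstract simplicial complex: a finite nonempty set of vertices
spans a simplex iff, of any two of them, one is obtained from the other by collapsing a forest. -/
def spineComplex (n : ℕ) : AbstractSimplicialComplex (SpineVertex n) where
  faces := {s | s.Nonempty ∧ IsChain SpineVertex.Collapses (s : Set (SpineVertex n))}
  isRelLowerSet_faces := fun _ hs =>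
    ⟨hs.1, fun _ hts ht => ⟨ht, hs.2.mono (Finset.coe_subset.2 hts)⟩⟩
  singleton_mem := fun v => ⟨Finset.singleton_nonempty v, by simp⟩

lemma spineComplex_smul {n : ℕ} (φ : (OutF n)ᵐᵒᵖ) {s : Finset (SpineVertex n)}
    (hs : s ∈ (spineComplex n).faces) :
    s.map (MulAction.toPerm φ).toEmbedding ∈ (spineComplex n).faces := by
  refine ⟨hs.1.map, ?_⟩
  rw [Finset.coe_map]
  rintro _ ⟨σ, hσ, rfl⟩ _ ⟨τ, hτ, rfl⟩ hne
  exact (hs.2 hσ hτ fun h => hne (by rw [h])).imp (fun H => H.smul φ) (fun H => H.smul φ)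

/-- The spine `X_n` of Outer space.  A point with barycentric coordinates `t` stands for the marked
metric graph obtained from the largest graph `Γ` among the vertices with positive coordinate by
giving an edge of `Γ` the sum of the `t σ` over those vertices `σ` in which it is not collapsed as
its length. -/
abbrev Spine (n : ℕ) : Type 1 := Realization (spineComplex n)

/-- The simplicial right action of `Out(F_n)` on `X_n`. -/
instance (n : ℕ) : MulAction (OutF n)ᵐᵒᵖ (Spine n) where
  smul φ x :=
    { coord := fun σ => x.coord (φ⁻¹ • σ)
      nonneg := fun σ => x.nonneg _
      exists_face := by
        obtain ⟨s, hs, h0, h1⟩ := x.exists_face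
        refine ⟨_, spineComplex_smul φ hs, fun σ hσ => h0 _ fun h => hσ ?_, ?_⟩
        · exact Finset.mem_map.2 ⟨_, h, smul_inv_smul φ σ⟩
        · simpa using h1 }
  one_smul x := by
    ext σ
    change x.coord ((1 : (OutF n)ᵐᵒᵖ)⁻¹ • σ) = _
    simp
  mul_smul φ ψ x := by
    ext σ
    change x.coord ((φ * ψ)⁻¹ • σ) = x.coord (ψ⁻¹ • φ⁻¹ • σ)
    rw [mul_inv_rev, mul_smul]

/-- `Y_n = X_n / T_n`, with the quotient topology. -/
abbrev TorelliQuotient (n : ℕ) : Type 1 := MulAction.orbitRel.Quotient (torelli n).op (Spine n)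

namespace TorelliQuotient

variable {n : ℕ}

/-- The projection `X_n → Y_n`. -/
def proj (x : Spine n) : TorelliQuotient n := Quotient.mk _ x

/-- A point `ρ` of `Y_n` is represented by the vertex `σ` of `X_n`. -/
def IsRepresentedBy (ρ : TorelliQuotient n) (σ : SpineVertex n) : Prop :=
  ∃ x : Spine n, x.coord σ = 1 ∧ proj x = ρ

/-- The roses in `Y_n`: the images of the marked roses in `X_n`. -/
def IsRose (ρ : TorelliQuotient n) : Prop := ∃ σ : SpineVertex n, σ.IsRose ∧ ρ.IsRepresentedBy σ

/-- The star of a rose `ρ` in `Y_n`: the image of the star in `X_n` of a marked rose representing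
`ρ`.  (The image is the same for all representatives; the union is over all of them.) -/
def star (ρ : TorelliQuotient n) : Set (TorelliQuotient n) :=
  ⋃ σ ∈ {σ : SpineVertex n | σ.IsRose ∧ ρ.IsRepresentedBy σ},
    proj '' Realization.star (spineComplex n) σ

/-- The underlying graph of a point `x` of `X_n`, i.e. the graph of the vertex `σ` with positive
coordinate from which all vertices with positive coordinate are obtained by collapsing forests, is
a cactus graph. -/
def IsCactusPoint (x : Spine n) : Prop :=
  ∃ A : MarkedGraph n, 0 < x.coord (SpineVertex.mk A) ∧
    (∀ τ, 0 < x.coord τ → (SpineVertex.mk A).Collapses τ) ∧ FinGraph.IsCactus n A.graph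

/-- The space `C(ρ)` of cactus graphs in the star of `ρ`. -/
def cactusSpace (ρ : TorelliQuotient n) : Set (TorelliQuotient n) :=
  {y ∈ star ρ | ∃ x : Spine n, IsCactusPoint x ∧ proj x = y}

end TorelliQuotient

/-! ### Deformation retractions and complexes -/

/-- `S` strong deformation retracts onto its subspace `A`: the identity of `S` is homotopic,
relative to `A`, to a map with values in `A`. -/
def StrongDeformationRetractsOnto {Y : Type*} [TopologicalSpace Y] (S A : Set Y) : Prop :=
  A ⊆ S ∧ ∃ r : C(S, S), (∀ y, (r y : Y) ∈ A) ∧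
    (ContinuousMap.id S).HomotopicRel r {y | (y : Y) ∈ A}

/-- The topological space `Z` has the structure of a (nonempty) CW complex of dimension `d`. -/
def IsCWComplexOfDim (Z : Type*) [TopologicalSpace Z] (d : ℕ) : Prop :=
  ∃ _ : Topology.CWComplex (Set.univ : Set Z),
    Nonempty (Topology.RelCWComplex.cell (Set.univ : Set Z) d) ∧
    ∀ k > d, IsEmpty (Topology.RelCWComplex.cell (Set.univ : Set Z) k)

/-! An oriented edge of a marked graph has a class in Hom(F_n, ℤ), namely the signed number of times
a loop runs through it (`MarkedGraph.cls`). Collapsing a forest keeps the classes of the surviving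
edges (`IsCollapse.cls_lift`). The Torelli group changes no class at all, because a homomorphism to
ℤ factors through the abelianization (`cls_precomp`). Hence all marked roses over `ρ` have the same
set B of 2n classes: a basis of Hom(F_n, ℤ) and its negatives.

Let Γ be a graph in the star. Its edges with class outside B are all collapsed on the way to the
rose, so they form a forest. Collapsing exactly these edges defines a map on the vertices of the
star which is monotone for the collapsing order, sends each vertex to one that it collapses to,
commutes with the Torelli group, and fixes precisely the graphs whose classes all lie in B
(`exists_isRetract`, `IsRetract.mono`, `exists_isMonotoneRetraction`).

These fixed graphs are the cactus graphs (`IsCollapse.isCactus_iff`). In a cactus every edge lies on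
a circle whose edges agree in class up to sign, and a whole circle cannot be collapsed. Conversely,
if all classes lie in B, conservation of flow at a vertex, evaluated on the dual basis, shows that
each class leaves the vertex as often as its negative. So valences are even, hence at least 4, and
an Euler characteristic count yields a class carried by a single edge, which must be a loop.
Removing it, and smoothing its vertex if necessary, undoes the gluing of a circle
(`IsCactusLabel.isCactus`).

A monotone map below the identity of a poset deforms the order complex: the mass at each vertex is
pushed to its image, low ranks first, so that the support always remains a chain
(`slideFace_mem_faces`). This uses only coordinates, ranks and the map, so it descends to the
quotient (`IsRankedQuotient.strongDeformationRetractsOnto`).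

For the dimension, the number of vertices of a graph is a Torelli-invariant rank, injective on each
simplex. So simplices are not folded in Y_n, and orbits of simplices are the cells of a Hausdorff CW
complex. Valence at least 4 bounds the number of vertices of a cactus graph by n - 1, so a simplex
of cactus graphs has at most n - 1 vertices. A necklace, a circle with n - 1 vertices and a loop at
each, gives a simplex with exactly that many (`exists_cactus_chain`). -/

namespace FinGraph

/-! ### Finiteness and reversal of edges. -/

instance (Γ : FinGraph) : Finite Γ.V := Γ.finite_V
instance (Γ : FinGraph) : Finite Γ.D := Γ.finite_D
noncomputable instance (Γ : FinGraph) : Fintype Γ.V := Fintype.ofFinite _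
noncomputable instance (Γ : FinGraph) : Fintype Γ.D := Fintype.ofFinite _

attribute [simp] FinGraph.rev_rev

@[simp] lemma src_rev (Γ : FinGraph) (d : Γ.D) : Γ.src (Γ.rev d) = Γ.tgt d := rfl

@[simp] lemma tgt_rev (Γ : FinGraph) (d : Γ.D) : Γ.tgt (Γ.rev d) = Γ.src d := by simp [tgt]

lemma rev_injective (Γ : FinGraph) : Function.Injective Γ.rev :=
  Function.LeftInverse.injective Γ.rev_rev

lemma rev_eq_iff {Γ : FinGraph} {d e : Γ.D} : Γ.rev d = e ↔ d = Γ.rev e :=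
  ⟨fun h => by rw [← h, Γ.rev_rev], fun h => by rw [h, Γ.rev_rev]⟩

/-! ### Walks -/

lemma isWalk_append {Γ : FinGraph} {u v : Γ.V} {l m : List Γ.D} :
    Γ.IsWalk u v (l ++ m) ↔ ∃ w, Γ.IsWalk u w l ∧ Γ.IsWalk w v m := by
  refine ⟨fun h => ?_, fun ⟨w, hl, hm⟩ => hl.append hm⟩
  induction l generalizing u with
  | nil => exact ⟨u, rfl, h⟩
  | cons d l ih =>
    obtain ⟨w, h1, h2⟩ := ih h.2
    exact ⟨w, ⟨h.1, h1⟩, h2⟩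

/-- The reverse of an edge path. -/
def revWalk (Γ : FinGraph) (l : List Γ.D) : List Γ.D := (l.map Γ.rev).reverse

lemma IsWalk.reverse {Γ : FinGraph} {u v : Γ.V} {l : List Γ.D} (h : Γ.IsWalk u v l) :
    Γ.IsWalk v u (Γ.revWalk l) := by
  induction l generalizing u with
  | nil => exact Eq.symm h
  | cons d l ih =>
    have := ih h.2
    rw [revWalk, List.map_cons, List.reverse_cons]
    exact this.append ⟨rfl, by rw [tgt_rev]; exact h.1⟩

lemma mem_revWalk {Γ : FinGraph} {l : List Γ.D} {d : Γ.D} :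
    d ∈ Γ.revWalk l ↔ Γ.rev d ∈ l := by
  simp [revWalk, rev_eq_iff]

lemma prod_map_edge_revWalk (Γ : FinGraph) (l : List Γ.D) :
    ((Γ.revWalk l).map Γ.edge).prod = ((l.map Γ.edge).prod)⁻¹ := by
  induction l with
  | nil => simp [revWalk]
  | cons d l ih =>
    rw [revWalk] at ih ⊢
    rw [List.map_cons, List.reverse_cons, List.map_append, List.prod_append, ih]
    simp [edge_rev]

/-- An edge path without backtracking. -/
def Reduced (Γ : FinGraph) (l : List Γ.D) : Prop := l.IsChain fun a b => b ≠ Γ.rev a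

/-- Cancelling a backtracking `d, rev d` keeps the end points and the product in the edge group. -/
lemma IsWalk.exists_reduced {Γ : FinGraph} {u v : Γ.V} {l : List Γ.D} (h : Γ.IsWalk u v l) :
    ∃ m, Γ.IsWalk u v m ∧ Γ.Reduced m ∧ m ⊆ l ∧
      (m.map Γ.edge).prod = (l.map Γ.edge).prod := by
  induction l generalizing u with
  | nil => exact ⟨[], h, List.isChain_nil, by simp, rfl⟩
  | cons d l ih =>
    obtain ⟨m, hm, hr, hs, hp⟩ := ih h.2
    by_cases hd : ∃ m', m = Γ.rev d :: m'
    · obtain ⟨m', rfl⟩ := hd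
      refine ⟨m', ?_, hr.tail, fun x hx => List.mem_cons_of_mem _ (hs (by simp [hx])), ?_⟩
      · have := hm.2
        rwa [tgt_rev, h.1] at this
      · rw [List.map_cons, List.prod_cons, ← hp]
        simp [edge_rev]
    · refine ⟨d :: m, ⟨h.1, hm⟩, ?_, ?_, by simp [hp]⟩
      · refine List.isChain_cons.2 ⟨fun b hb => ?_, hr⟩
        rintro rfl
        cases m with
        | nil => simp at hb
        | cons c m =>
          simp only [List.head?_cons, Option.mem_some_iff] at hb
          exact hd ⟨m, by rw [hb]⟩
      · intro x hx
        rcases List.mem_cons.1 hx with rfl | hx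
        · simp
        · exact List.mem_cons_of_mem _ (hs hx)

/-! ### Forests -/

lemma IsForest.empty (Γ : FinGraph) : Γ.IsForest ∅ :=
  ⟨by simp, fun v l _ h _ => List.eq_nil_iff_forall_not_mem.2 fun d hd => h d hd⟩

lemma IsForest.subset {Γ : FinGraph} {F E : Set Γ.D} (hF : Γ.IsForest F) (h : E ⊆ F)
    (hE : ∀ d ∈ E, Γ.rev d ∈ E) : Γ.IsForest E :=
  ⟨hE, fun v l hl hs hr => hF.acyclic v l hl (fun d hd => h (hs d hd)) hr⟩

lemma IsForest.rev_mem_iff {Γ : FinGraph} {F : Set Γ.D} (hF : Γ.IsForest F) {d : Γ.D} :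
    Γ.rev d ∈ F ↔ d ∈ F :=
  ⟨fun h => by simpa using hF.rev_mem _ h, hF.rev_mem d⟩

lemma IsForest.src_ne_tgt {Γ : FinGraph} {F : Set Γ.D} (hF : Γ.IsForest F) {d : Γ.D}
    (hd : d ∈ F) : Γ.src d ≠ Γ.tgt d := fun h => by
  simpa using hF.acyclic (Γ.src d) [d] ⟨rfl, h.symm⟩ (by simpa) (by simp)

lemma IsForest.prod_eq_one {Γ : FinGraph} {F : Set Γ.D} (hF : Γ.IsForest F) {v : Γ.V}
    {l : List Γ.D} (h : Γ.IsWalk v v l) (hl : ∀ d ∈ l, d ∈ F) : (l.map Γ.edge).prod = 1 := by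
  obtain ⟨m, hm, hr, hs, hp⟩ := h.exists_reduced
  obtain rfl := hF.acyclic v m hm (fun d hd => hl d (hs hd)) hr
  simpa using hp.symm

/-- The part of the path from one occurrence of an edge up to the next would be closed, reduced and
nonempty. -/
lemma IsForest.nodup {Γ : FinGraph} {F : Set Γ.D} (hF : Γ.IsForest F) {u v : Γ.V}
    {l : List Γ.D} (h : Γ.IsWalk u v l) (hr : Γ.Reduced l) (hl : ∀ d ∈ l, d ∈ F) : l.Nodup := by
  induction l generalizing u with
  | nil => simp
  | cons d l ih =>
    refine List.nodup_cons.2 ⟨fun hd => ?_, ih h.2 hr.tail fun e he => hl e (by simp [he])⟩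
    obtain ⟨a, b, rfl⟩ := List.append_of_mem hd
    obtain ⟨w, hw, hw'⟩ := isWalk_append.1 h.2
    have hr' : Γ.Reduced (d :: a) := by
      have : Γ.Reduced ((d :: a) ++ d :: b) := hr
      exact (List.isChain_append.1 this).1
    have := hF.acyclic (Γ.src d) (d :: a) ⟨rfl, by rwa [hw'.1]⟩
      (fun e he => hl e (by
        rcases List.mem_cons.1 he with rfl | he
        · simp
        · simp [he])) hr'
    simp at this

/-- A reduced edge path in a forest can be prolonged backwards to a leaf of the forest. -/
lemma IsForest.exists_leaf {Γ : FinGraph} {F : Set Γ.D} (hF : Γ.IsForest F) {d : Γ.D}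
    (hd : d ∈ F) : ∃ a m, Γ.IsWalk (Γ.src a) (Γ.tgt d) (a :: m) ∧ Γ.Reduced (a :: m) ∧
      (∀ e ∈ a :: m, e ∈ F) ∧ ∀ e ∈ F, Γ.src e = Γ.src a → e = a := by
  by_contra! H
  -- Without a leaf the path can be prolonged forever, whereas `nodup` bounds the length of reduced
  -- paths in a forest by the number of oriented edges.
  have key : ∀ k : ℕ, ∃ a m, m.length = k ∧ Γ.IsWalk (Γ.src a) (Γ.tgt d) (a :: m) ∧
      Γ.Reduced (a :: m) ∧ ∀ e ∈ a :: m, e ∈ F := by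
    intro k
    induction k with
    | zero => exact ⟨d, [], rfl, ⟨rfl, rfl⟩, by simp [Reduced], by simpa⟩
    | succ k ih =>
      obtain ⟨a, m, hk, hw, hr, hs⟩ := ih
      obtain ⟨e, he, hea, hne⟩ := H a m hw hr hs
      refine ⟨Γ.rev e, a :: m, by simp [hk], ⟨rfl, ?_⟩, ?_, ?_⟩
      · rw [tgt_rev, hea]; exact hw
      · refine List.isChain_cons_cons.2 ⟨?_, hr⟩
        simpa using hne.symm
      · intro x hx
        rcases List.mem_cons.1 hx with rfl | hx
        · exact hF.rev_mem _ he
        · exact hs x hx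
  obtain ⟨a, m, hk, hw, hr, hs⟩ := key (Fintype.card Γ.D)
  have := (hF.nodup hw hr hs).length_le_card
  simp [hk] at this

/-- A nonempty forest has fewer edges than vertices, doubled because edges are oriented. Removing a
leaf edge costs two oriented edges and at least one vertex. -/
lemma IsForest.ncard_add_two_le {Γ : FinGraph} {F : Set Γ.D} (hF : Γ.IsForest F)
    (hne : F.Nonempty) : F.ncard + 2 ≤ 2 * (Γ.src '' F).ncard := by
  induction hk : F.ncard using Nat.strong_induction_on generalizing F with
  | _ k ih =>
    subst hk
    obtain ⟨d, hd⟩ := hne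
    obtain ⟨a, m, -, -, hs, ha⟩ := hF.exists_leaf hd
    have haF : a ∈ F := hs a (by simp)
    have hraF : Γ.rev a ∈ F := hF.rev_mem _ haF
    set E : Set Γ.D := F \ {a, Γ.rev a}
    have hEF : E ⊆ F := Set.sdiff_subset
    have hE : Γ.IsForest E := hF.subset hEF fun e he => by
      refine ⟨hF.rev_mem _ he.1, fun h => he.2 ?_⟩
      rcases h with h | h
      · right; exact rev_eq_iff.1 h
      · left; exact Γ.rev_injective h
    have hcard : E.ncard + 2 = F.ncard := by
      have h2 : ({a, Γ.rev a} : Set Γ.D).ncard = 2 := Set.ncard_pair (Γ.rev_ne a).symm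
      have := Set.ncard_sdiff_add_ncard_of_subset (s := {a, Γ.rev a}) (t := F)
        (by rintro x (rfl | rfl) <;> assumption) (Set.toFinite _)
      rw [h2] at this
      exact this
    have hsrc : Γ.src '' E ⊆ (Γ.src '' F) \ {Γ.src a} := by
      rintro _ ⟨e, he, rfl⟩
      refine ⟨⟨e, he.1, rfl⟩, fun h => he.2 (Or.inl (ha e he.1 h))⟩
    have hle : (Γ.src '' E).ncard + 1 ≤ (Γ.src '' F).ncard := by
      have h1 := Set.ncard_le_ncard hsrc (Set.toFinite _)
      have h2 := Set.ncard_sdiff_singleton_add_one (s := Γ.src '' F) (a := Γ.src a)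
        ⟨a, haF, rfl⟩ (Set.toFinite _)
      omega
    by_cases hEn : E.Nonempty
    · have := ih E.ncard (by omega) hE hEn rfl
      omega
    · have hE0 : E.ncard = 0 := by
        rw [Set.not_nonempty_iff_eq_empty.1 hEn, Set.ncard_empty]
      have h2 : ({Γ.src a, Γ.tgt a} : Set Γ.V).ncard = 2 :=
        Set.ncard_pair (hF.src_ne_tgt haF)
      have h3 : ({Γ.src a, Γ.tgt a} : Set Γ.V) ⊆ Γ.src '' F := by
        rintro x (rfl | rfl)
        · exact ⟨a, haF, rfl⟩
        · exact ⟨Γ.rev a, hraF, rfl⟩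
      have := Set.ncard_le_ncard h3 (Set.toFinite _)
      omega

/-! ### Flows -/

open Classical in
/-- A flow: a closed cellular 1-chain. -/
structure IsFlow (Γ : FinGraph) (w : Γ.D → ℤ) : Prop where
  rev : ∀ d, w (Γ.rev d) = -w d
  sum_eq_zero : ∀ v, ∑ d, (if Γ.src d = v then w d else 0) = 0

/-- The support of a nonzero flow would be a forest with a leaf, and conservation at the leaf forces
the flow on its only edge to vanish. -/
lemma IsFlow.eq_zero {Γ : FinGraph} {F : Set Γ.D} (hF : Γ.IsForest F) {w : Γ.D → ℤ}
    (hw : Γ.IsFlow w) (h : ∀ d, w d ≠ 0 → d ∈ F) (d : Γ.D) : w d = 0 := by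
  classical
  by_contra hd
  have hS : Γ.IsForest {d | w d ≠ 0} := hF.subset h fun e he => by simpa [hw.rev] using he
  obtain ⟨a, m, -, -, hs, ha⟩ := hS.exists_leaf (d := d) hd
  have h0 := hw.sum_eq_zero (Γ.src a)
  rw [Finset.sum_eq_single a] at h0
  · exact hs a (by simp) (by simpa using h0)
  · intro b _ hb
    rw [ite_eq_right_iff]
    intro hba
    by_contra hne
    exact hb (ha b hne hba)
  · simp

open Classical in
/-- The signed number of times an edge path runs through the oriented edge `e`. -/
noncomputable def count (Γ : FinGraph) (e : Γ.D) : Γ.EdgeGroup →* Multiplicative ℤ :=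
  Γ.liftEdge (fun d => Multiplicative.ofAdd
    ((if d = e then 1 else 0) - (if Γ.rev d = e then 1 else 0))) (fun d => by
      rw [← ofAdd_add]; simp)

open Classical in
lemma count_edge (Γ : FinGraph) (e d : Γ.D) : Γ.count e (Γ.edge d) = Multiplicative.ofAdd
    ((if d = e then (1 : ℤ) else 0) - (if Γ.rev d = e then 1 else 0)) :=
  Γ.liftEdge_edge _ _ d

lemma count_rev (Γ : FinGraph) (e : Γ.D) (x : Γ.EdgeGroup) :
    Γ.count (Γ.rev e) x = (Γ.count e x)⁻¹ := by
  classical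
  have : Γ.count (Γ.rev e) = (Γ.count e)⁻¹ := by
    refine PresentedGroup.ext fun d => ?_
    rw [MonoidHom.inv_apply]
    refine Eq.trans (Γ.count_edge _ d) (Eq.trans ?_ (congrArg _ (Γ.count_edge _ d).symm))
    rw [← ofAdd_neg]
    congr 1
    simp only [Γ.rev_injective.eq_iff, ← rev_eq_iff]
    ring
  rw [this]; rfl

-- The boundary of a path telescopes to its initial minus its terminal vertex. For closed paths this
-- gives the flows used throughout.
open Classical in
lemma sum_count (Γ : FinGraph) {u v : Γ.V} {x : Γ.EdgeGroup} (hx : x ∈ Γ.pathClasses u v)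
    (z : Γ.V) : ∑ d, (if Γ.src d = z then (Γ.count d x).toAdd else 0) =
      (if u = z then 1 else 0) - (if v = z then 1 else 0) := by
  refine pathClasses_induction (P := fun u v x =>
    ∑ d, (if Γ.src d = z then (Γ.count d x).toAdd else 0) =
      (if u = z then 1 else 0) - (if v = z then 1 else 0)) ?_ ?_ hx
  · intro u; simp
  · intro d v x _ ih
    have : ∀ e, (if Γ.src e = z then (Γ.count e (Γ.edge d * x)).toAdd else 0) =
        (if e = d then (if Γ.src d = z then 1 else 0) else 0) -
        (if e = Γ.rev d then (if Γ.tgt d = z then 1 else 0) else 0) +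
        (if Γ.src e = z then (Γ.count e x).toAdd else 0) := by
      intro e
      rw [map_mul, toAdd_mul, count_edge, toAdd_ofAdd]
      by_cases h1 : e = d
      · subst h1
        by_cases h : Γ.src e = z <;> simp [h, Γ.rev_ne, (Γ.rev_ne e).symm]
      · by_cases h2 : e = Γ.rev d
        · subst h2
          by_cases h : Γ.tgt d = z <;> simp [h, Γ.rev_ne, (Γ.rev_ne d).symm]
        · simp [h1, h2, Ne.symm h1, Ne.symm h2]
    simp only [this, Finset.sum_add_distrib, Finset.sum_sub_distrib, ih]
    simp

lemma isFlow_count (Γ : FinGraph) {v : Γ.V} {x : Γ.EdgeGroup} (hx : x ∈ Γ.pi1 v) :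
    Γ.IsFlow fun d => (Γ.count d x).toAdd where
  rev d := by rw [count_rev, toAdd_inv]
  sum_eq_zero z := by
    classical
    have := Γ.sum_count hx z
    simpa using this

end FinGraph

/-! ### Collapsing maps of graphs, a class closed under composition and factorization. -/

namespace FinGraph

/-- A map of graphs which collapses the components of a forest to vertices and is injective on the
remaining edges; `lift e` is the edge mapped onto `e`. -/
structure CollapseMap (Γ Δ : FinGraph) where
  onV : Γ.V → Δ.V
  lift : Δ.D → Γ.D
  onV_surjective : Function.Surjective onV
  lift_injective : Function.Injective lift
  src_lift : ∀ e, onV (Γ.src (lift e)) = Δ.src e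
  rev_lift : ∀ e, Γ.rev (lift e) = lift (Δ.rev e)
  forest : Γ.IsForest (Set.range lift)ᶜ
  onV_eq_iff : ∀ u v, onV u = onV v ↔ ∃ l, Γ.IsWalk u v l ∧ ∀ d ∈ l, d ∈ (Set.range lift)ᶜ

namespace CollapseMap

variable {Γ Δ Θ : FinGraph}

/-- The set of collapsed edges. -/
def kernel (q : CollapseMap Γ Δ) : Set Γ.D := (Set.range q.lift)ᶜ

lemma isForest_kernel (q : CollapseMap Γ Δ) : Γ.IsForest q.kernel := q.forest

lemma lift_notMem_kernel (q : CollapseMap Γ Δ) (e : Δ.D) : q.lift e ∉ q.kernel :=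
  fun h => h ⟨e, rfl⟩

lemma exists_lift (q : CollapseMap Γ Δ) {d : Γ.D} (h : d ∉ q.kernel) : ∃ e, q.lift e = d :=
  not_not.1 h

lemma mem_kernel_or (q : CollapseMap Γ Δ) (d : Γ.D) : d ∈ q.kernel ∨ ∃ e, q.lift e = d :=
  (em (d ∈ q.kernel)).imp_right q.exists_lift

lemma tgt_lift (q : CollapseMap Γ Δ) (e : Δ.D) : q.onV (Γ.tgt (q.lift e)) = Δ.tgt e := by
  rw [tgt, q.rev_lift, q.src_lift, tgt]

lemma onV_src_eq (q : CollapseMap Γ Δ) {d : Γ.D} (h : d ∈ q.kernel) :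
    q.onV (Γ.src d) = q.onV (Γ.tgt d) :=
  (q.onV_eq_iff _ _).2 ⟨[d], ⟨rfl, rfl⟩, fun e he => by rw [List.mem_singleton.1 he]; exact h⟩

open Classical in
/-- The induced map on (classes of) edge paths. -/
noncomputable def hom (q : CollapseMap Γ Δ) : Γ.EdgeGroup →* Δ.EdgeGroup :=
  Γ.liftEdge (fun d => if h : ∃ e, q.lift e = d then Δ.edge h.choose else 1) (fun d => by
    by_cases h : ∃ e, q.lift e = d
    · have h' : ∃ e, q.lift e = Γ.rev d := ⟨Δ.rev h.choose, by
        rw [← q.rev_lift, h.choose_spec]⟩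
      have : h'.choose = Δ.rev h.choose := q.lift_injective (by
        rw [h'.choose_spec, ← q.rev_lift, h.choose_spec])
      rw [dif_pos h, dif_pos h', this, edge_rev, mul_inv_cancel]
    · have h' : ¬ ∃ e, q.lift e = Γ.rev d := fun ⟨e, he⟩ => h ⟨Δ.rev e, by
        rw [← q.rev_lift, he, Γ.rev_rev]⟩
      rw [dif_neg h, dif_neg h', mul_one])

lemma hom_edge_lift (q : CollapseMap Γ Δ) (e : Δ.D) :
    q.hom (Γ.edge (q.lift e)) = Δ.edge e := by
  classical
  have h : ∃ e', q.lift e' = q.lift e := ⟨e, rfl⟩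
  rw [hom, liftEdge_edge, dif_pos h, q.lift_injective h.choose_spec]

lemma hom_edge_kernel (q : CollapseMap Γ Δ) {d : Γ.D} (h : d ∈ q.kernel) :
    q.hom (Γ.edge d) = 1 := by
  classical
  rw [hom, liftEdge_edge, dif_neg]
  exact h

/-- Homomorphisms out of the edge group agree if they agree on collapsed and lifted edges. -/
lemma hom_ext (q : CollapseMap Γ Δ) {G : Type*} [Group G] {f g : Γ.EdgeGroup →* G}
    (h1 : ∀ e, f (Γ.edge (q.lift e)) = g (Γ.edge (q.lift e)))
    (h2 : ∀ d ∈ q.kernel, f (Γ.edge d) = g (Γ.edge d)) : f = g := by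
  refine PresentedGroup.ext fun d => ?_
  rcases q.mem_kernel_or d with h | ⟨e, rfl⟩
  · exact h2 d h
  · exact h1 e

lemma map_mem_pathClasses (q : CollapseMap Γ Δ) {u v : Γ.V} {w : Γ.EdgeGroup}
    (hw : w ∈ Γ.pathClasses u v) : q.hom w ∈ Δ.pathClasses (q.onV u) (q.onV v) := by
  refine pathClasses_induction
    (P := fun u v w => q.hom w ∈ Δ.pathClasses (q.onV u) (q.onV v)) ?_ ?_ hw
  · intro u; simpa using Δ.one_mem_pathClasses (q.onV u)
  · intro d v w _ ih
    rw [map_mul]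
    refine mul_mem_pathClasses ?_ ih
    rcases q.mem_kernel_or d with h | ⟨e, rfl⟩
    · rw [q.hom_edge_kernel h, q.onV_src_eq h]
      exact Δ.one_mem_pathClasses _
    · rw [q.hom_edge_lift, q.src_lift, q.tgt_lift]
      exact Δ.edge_mem_pathClasses e

/-- Forgetting collapsed edges does not affect how often a surviving edge is crossed; this is what
makes the classes of edges stable under collapsing. -/
lemma count_hom (q : CollapseMap Γ Δ) (e : Δ.D) (x : Γ.EdgeGroup) :
    Δ.count e (q.hom x) = Γ.count (q.lift e) x := by
  classical
  have : (Δ.count e).comp q.hom = Γ.count (q.lift e) := by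
    refine q.hom_ext (fun e' => ?_) fun d hd => ?_
    · rw [MonoidHom.comp_apply, hom_edge_lift, count_edge, count_edge, q.rev_lift,
        q.lift_injective.eq_iff, q.lift_injective.eq_iff]
    · rw [MonoidHom.comp_apply, hom_edge_kernel _ hd, map_one, count_edge, if_neg, if_neg]
      · simp
      · rintro h
        exact q.lift_notMem_kernel e (h ▸ q.forest.rev_mem _ hd)
      · rintro rfl
        exact q.lift_notMem_kernel e hd
  rw [← this]; rfl

/-- The image of a reduced edge path is reduced. -/
lemma exists_image_walk (q : CollapseMap Γ Δ) {u v : Γ.V} {l : List Γ.D} (h : Γ.IsWalk u v l)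
    (hr : Γ.Reduced l) : ∃ m, Δ.IsWalk (q.onV u) (q.onV v) m ∧ Δ.Reduced m ∧
      (∀ e ∈ m, q.lift e ∈ l) ∧ (m = [] → ∀ d ∈ l, d ∈ q.kernel) ∧
      (∀ e ∈ m.head?, ∃ a b, l = a ++ q.lift e :: b ∧ ∀ d ∈ a, d ∈ q.kernel) := by
  induction l generalizing u with
  | nil => obtain rfl : u = v := h; exact ⟨[], rfl, List.isChain_nil, by simp⟩
  | cons d l ih =>
    obtain ⟨m, hm, hmr, hs, h0, hh⟩ := ih h.2 hr.tail
    obtain ⟨rfl, hl⟩ := h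
    rcases q.mem_kernel_or d with hd | ⟨e, rfl⟩
    · refine ⟨m, by rwa [q.onV_src_eq hd], hmr, fun e he => List.mem_cons_of_mem _ (hs e he),
        fun h => ?_, fun e he => ?_⟩
      · simpa [hd] using h0 h
      · obtain ⟨a, b, rfl, ha⟩ := hh e he
        exact ⟨d :: a, b, rfl, by simpa [hd] using ha⟩
    · refine ⟨e :: m, ⟨(q.src_lift e).symm, by rwa [q.tgt_lift] at hm⟩, ?_, ?_, by simp, ?_⟩
      · refine List.isChain_cons.2 ⟨fun e' he' => ?_, hmr⟩
        rintro rfl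
        obtain ⟨a, b, rfl, ha⟩ := hh _ he'
        obtain ⟨w, hw, hw'⟩ := isWalk_append.1 hl
        have : w = Γ.tgt (q.lift e) := by rw [← hw'.1, ← q.rev_lift, src_rev]
        subst this
        -- The stretch `a` between an edge and its reverse is a closed reduced path in the kernel,
        -- hence empty, so the original path would already backtrack.
        obtain rfl := q.forest.acyclic _ a hw ha (List.isChain_append.1 hr.tail).1
        exact (List.isChain_cons_cons.1 hr).1 (q.rev_lift e).symm
      · intro x hx
        rcases List.mem_cons.1 hx with rfl | hx
        · simp
        · exact List.mem_cons_of_mem _ (hs x hx)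
      · intro x hx
        simp only [List.head?_cons, Option.mem_some_iff] at hx
        subst hx
        exact ⟨[], l, rfl, by simp⟩

lemma exists_kernel_walk (q : CollapseMap Γ Δ) {u v : Γ.V} (h : q.onV u = q.onV v) :
    ∃ l, Γ.IsWalk u v l ∧ Γ.Reduced l ∧ ∀ d ∈ l, d ∈ q.kernel := by
  obtain ⟨l, hl, hs⟩ := (q.onV_eq_iff u v).1 h
  obtain ⟨m, hm, hr, hms, -⟩ := hl.exists_reduced
  exact ⟨m, hm, hr, fun d hd => hs d (hms hd)⟩

lemma hom_kernel_walk (q : CollapseMap Γ Δ) {l : List Γ.D} (h : ∀ d ∈ l, d ∈ q.kernel) :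
    q.hom (l.map Γ.edge).prod = 1 := by
  induction l with
  | nil => simp
  | cons d l ih =>
    rw [List.map_cons, List.prod_cons, map_mul, q.hom_edge_kernel (h d (by simp)),
      ih fun e he => h e (by simp [he]), mul_one]

/-- Reduced edge paths can be lifted to reduced edge paths with given end points. -/
lemma exists_lift_walk (q : CollapseMap Γ Δ) {x y : Δ.V} {m : List Δ.D} (h : Δ.IsWalk x y m)
    (hr : Δ.Reduced m) {u v : Γ.V} (hu : q.onV u = x) (hv : q.onV v = y) :
    ∃ l, Γ.IsWalk u v l ∧ Γ.Reduced l ∧ (∀ d ∈ l, d ∈ q.kernel ∨ ∃ e ∈ m, d = q.lift e) ∧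
      (∀ e ∈ m, q.lift e ∈ l) ∧ q.hom (l.map Γ.edge).prod = (m.map Δ.edge).prod ∧
      ∀ d ∈ l.head?, d ∈ q.kernel ∨ ∃ e ∈ m.head?, d = q.lift e := by
  induction m generalizing u x with
  | nil =>
    obtain rfl : x = y := h
    obtain ⟨l, hl, hlr, hs⟩ := q.exists_kernel_walk (hu.trans hv.symm)
    exact ⟨l, hl, hlr, fun d hd => Or.inl (hs d hd), by simp, by simp [q.hom_kernel_walk hs],
      fun d hd => Or.inl (hs d (List.mem_of_mem_head? hd))⟩
  | cons e m ih =>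
    obtain ⟨rfl, hm⟩ := h
    obtain ⟨l, hl, hlr, hs, hsub, hp, hh⟩ := ih hm hr.tail (q.tgt_lift e)
    obtain ⟨a, ha, har, has⟩ := q.exists_kernel_walk (u := u) (v := Γ.src (q.lift e))
      (by rw [hu, q.src_lift])
    have hr1 : Γ.Reduced (q.lift e :: l) := by
      refine List.isChain_cons.2 ⟨fun d hd => ?_, hlr⟩
      rcases hh d hd with hk | ⟨e', he', rfl⟩
      · rintro rfl
        exact q.lift_notMem_kernel e (q.forest.rev_mem_iff.1 hk)
      · rw [q.rev_lift, q.lift_injective.ne_iff]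
        exact (List.isChain_cons.1 hr).1 e' he'
    refine ⟨a ++ q.lift e :: l, ha.append ⟨rfl, hl⟩, ?_, ?_, ?_, ?_, ?_⟩
    · refine List.isChain_append.2 ⟨har, hr1, fun d hd d' hd' => ?_⟩
      simp only [List.head?_cons, Option.mem_some_iff] at hd'
      subst hd'
      intro h
      exact q.lift_notMem_kernel e (h ▸ q.forest.rev_mem _ (has d (List.mem_of_getLast? hd)))
    · intro d hd
      rcases List.mem_append.1 hd with hd | hd
      · exact Or.inl (has d hd)
      · rcases List.mem_cons.1 hd with rfl | hd
        · exact Or.inr ⟨e, by simp, rfl⟩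
        · exact (hs d hd).imp_right fun ⟨e', he', h⟩ => ⟨e', by simp [he'], h⟩
    · intro e' he'
      rcases List.mem_cons.1 he' with rfl | he'
      · simp
      · simp [hsub e' he']
    · rw [List.map_append, List.prod_append, map_mul, q.hom_kernel_walk has, List.map_cons,
        List.prod_cons, map_mul, hp, q.hom_edge_lift]
      simp
    · intro d hd
      cases a with
      | nil =>
        simp only [List.nil_append, List.head?_cons, Option.mem_some_iff] at hd
        exact Or.inr ⟨e, by simp, hd.symm⟩
      | cons d' a =>
        simp only [List.cons_append, List.head?_cons, Option.mem_some_iff] at hd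
        exact Or.inl (has d (by simp [hd]))

lemma exists_hom_eq (q : CollapseMap Γ Δ) {u v : Γ.V} {y : Δ.EdgeGroup}
    (hy : y ∈ Δ.pathClasses (q.onV u) (q.onV v)) : ∃ x ∈ Γ.pathClasses u v, q.hom x = y := by
  obtain ⟨m, hm, rfl⟩ := hy
  obtain ⟨m', hm', hr, -, hp⟩ := hm.exists_reduced
  obtain ⟨l, hl, -, -, -, hlp, -⟩ := q.exists_lift_walk hm' hr rfl rfl
  exact ⟨_, ⟨l, hl, rfl⟩, hlp.trans hp⟩

/-- Choose a base point in each collapsed tree and a path `p u` to it inside the tree. Sending `e`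
to its lift, connected to the base points by these paths, defines `back`. It recovers a path from
`u` to `v` up to the factors `p u` and `p v`, because closed paths in a forest are trivial. -/
lemma hom_injOn (q : CollapseMap Γ Δ) (u v : Γ.V) : Set.InjOn q.hom (Γ.pathClasses u v) := by
  have key : ∀ u, ∃ l, Γ.IsWalk u (Function.surjInv q.onV_surjective (q.onV u)) l ∧
      ∀ d ∈ l, d ∈ q.kernel := fun u => by
    obtain ⟨l, hl, -, hs⟩ := q.exists_kernel_walk
      (Function.surjInv_eq q.onV_surjective (q.onV u)).symm
    exact ⟨l, hl, hs⟩
  choose L hL hLs using key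
  set p : Γ.V → Γ.EdgeGroup := fun u => ((L u).map Γ.edge).prod
  have hp : ∀ d ∈ q.kernel, p (Γ.src d) = Γ.edge d * p (Γ.tgt d) := fun d hd => by
    have hw : Γ.IsWalk (Γ.src d) (Γ.src d) ((d :: L (Γ.tgt d)) ++ Γ.revWalk (L (Γ.src d))) := by
      refine IsWalk.append (v := Function.surjInv q.onV_surjective (q.onV (Γ.src d)))
        ⟨rfl, ?_⟩ (hL _).reverse
      rw [q.onV_src_eq hd]
      exact hL _
    have := q.forest.prod_eq_one hw (fun e he => by
      rcases List.mem_append.1 he with he | he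
      · rcases List.mem_cons.1 he with rfl | he
        · exact hd
        · exact hLs _ e he
      · exact q.forest.rev_mem_iff.1 (hLs _ _ (mem_revWalk.1 he)))
    rw [List.map_append, List.prod_append, prod_map_edge_revWalk, mul_inv_eq_one] at this
    exact this.symm
  set back : Δ.EdgeGroup →* Γ.EdgeGroup := Δ.liftEdge
    (fun e => (p (Γ.src (q.lift e)))⁻¹ * Γ.edge (q.lift e) * p (Γ.tgt (q.lift e))) (fun e => by
      rw [← q.rev_lift, edge_rev, src_rev, tgt_rev]; group)
  have hback : ∀ {u v} {x : Γ.EdgeGroup}, x ∈ Γ.pathClasses u v →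
      back (q.hom x) = (p u)⁻¹ * x * p v := fun hx => by
    refine pathClasses_induction (P := fun u v x => back (q.hom x) = (p u)⁻¹ * x * p v)
      ?_ ?_ hx
    · intro u; simp
    · intro d v x _ ih
      rw [map_mul, map_mul, ih]
      rcases q.mem_kernel_or d with h | ⟨e, rfl⟩
      · rw [q.hom_edge_kernel h, hp d h, map_one]; group
      · rw [q.hom_edge_lift]
        have : back (Δ.edge e) = _ := liftEdge_edge ..
        rw [this]; group
  intro x hx y hy hxy
  have := congrArg back hxy
  rw [hback hx, hback hy] at this
  simpa using this

/-- The isomorphism of fundamental groups induced by collapsing a forest. -/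
noncomputable def pi1Equiv (q : CollapseMap Γ Δ) (v : Γ.V) :
    Γ.pi1 v ≃* Δ.pi1 (q.onV v) :=
  MulEquiv.ofBijective
    ((q.hom.comp (Γ.pi1 v).subtype).codRestrict (Δ.pi1 (q.onV v))
      fun x => q.map_mem_pathClasses x.2)
    ⟨fun x y h => Subtype.ext (q.hom_injOn v v x.2 y.2 (congrArg Subtype.val h)),
      fun y => by
        obtain ⟨x, hx, h⟩ := q.exists_hom_eq y.2
        exact ⟨⟨x, hx⟩, Subtype.ext h⟩⟩

@[simp] lemma coe_pi1Equiv (q : CollapseMap Γ Δ) (v : Γ.V) (x : Γ.pi1 v) :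
    (q.pi1Equiv v x : Δ.EdgeGroup) = q.hom x := rfl

lemma mem_range_comp {q : CollapseMap Γ Δ} {r : CollapseMap Δ Θ} {e : Δ.D} :
    q.lift e ∈ Set.range (q.lift ∘ r.lift) ↔ e ∈ Set.range r.lift := by
  constructor
  · rintro ⟨t, ht⟩
    exact ⟨t, q.lift_injective ht⟩
  · rintro ⟨t, rfl⟩
    exact ⟨t, rfl⟩

/-- The composition of two collapsing maps. -/
def comp (r : CollapseMap Δ Θ) (q : CollapseMap Γ Δ) : CollapseMap Γ Θ where
  onV := r.onV ∘ q.onV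
  lift := q.lift ∘ r.lift
  onV_surjective := r.onV_surjective.comp q.onV_surjective
  lift_injective := q.lift_injective.comp r.lift_injective
  src_lift e := by simp [q.src_lift, r.src_lift]
  rev_lift e := by simp [q.rev_lift, r.rev_lift]
  forest := by
    refine ⟨?_, fun v l hl hs hr => ?_⟩
    · rintro d hd ⟨t, ht⟩
      refine hd ⟨Θ.rev t, ?_⟩
      simp only [Function.comp_apply] at ht ⊢
      rw [← r.rev_lift, ← q.rev_lift, ht, Γ.rev_rev]
    -- The image in `Δ` is a closed reduced path in the kernel of `r`, hence empty. So the path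
    -- already lies in the kernel of `q`.
    · obtain ⟨m, hm, hmr, hms, h0, -⟩ := q.exists_image_walk hl hr
      have hm0 := r.forest.acyclic _ m hm (fun e he h =>
        hs _ (hms e he) (mem_range_comp.2 h)) hmr
      exact q.forest.acyclic v l hl (h0 hm0) hr
  onV_eq_iff u v := by
    constructor
    · intro h
      obtain ⟨m, hm, hr, hs⟩ := r.exists_kernel_walk h
      obtain ⟨l, hl, -, hls, -⟩ := q.exists_lift_walk hm hr rfl rfl
      refine ⟨l, hl, fun d hd => ?_⟩
      rcases hls d hd with hk | ⟨e, he, rfl⟩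
      · rintro ⟨t, rfl⟩
        exact q.lift_notMem_kernel _ hk
      · exact fun h => hs e he (mem_range_comp.1 h)
    · rintro ⟨l, hl, hs⟩
      induction l generalizing u with
      | nil => obtain rfl : u = v := hl; rfl
      | cons d l ih =>
        obtain ⟨rfl, hl⟩ := hl
        refine Eq.trans ?_ (ih _ hl fun e he => hs e (by simp [he]))
        rcases q.mem_kernel_or d with hk | ⟨e, rfl⟩
        · simp [q.onV_src_eq hk]
        · have : e ∈ r.kernel := fun h => hs (q.lift e) (by simp) (mem_range_comp.2 h)
          simp [q.src_lift, q.tgt_lift, r.onV_src_eq this]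

lemma comp_hom (r : CollapseMap Δ Θ) (q : CollapseMap Γ Δ) :
    (r.comp q).hom = r.hom.comp q.hom := by
  refine (r.comp q).hom_ext (fun e => ?_) fun d hd => ?_
  · rw [hom_edge_lift, MonoidHom.comp_apply]
    change _ = r.hom (q.hom (Γ.edge (q.lift (r.lift e))))
    rw [hom_edge_lift, hom_edge_lift]
  · rw [hom_edge_kernel _ hd, MonoidHom.comp_apply]
    rcases q.mem_kernel_or d with hk | ⟨e, rfl⟩
    · rw [q.hom_edge_kernel hk, map_one]
    · rw [q.hom_edge_lift, r.hom_edge_kernel fun h => hd (mem_range_comp.2 h)]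

lemma exists_lift_eq {q₁ : CollapseMap Γ Δ} {q₂ : CollapseMap Γ Θ}
    (h : q₁.kernel ⊆ q₂.kernel) (e : Θ.D) : ∃ e', q₁.lift e' = q₂.lift e :=
  q₁.exists_lift fun hk => q₂.lift_notMem_kernel e (h hk)

lemma onV_eq_of_kernel_subset {q₁ : CollapseMap Γ Δ} {q₂ : CollapseMap Γ Θ}
    (h : q₁.kernel ⊆ q₂.kernel) {u v : Γ.V} (huv : q₁.onV u = q₁.onV v) :
    q₂.onV u = q₂.onV v := by
  obtain ⟨l, hl, hs⟩ := (q₁.onV_eq_iff u v).1 huv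
  exact (q₂.onV_eq_iff u v).2 ⟨l, hl, fun d hd => h (hs d hd)⟩

/-- A collapsing map factors through every collapsing map with a smaller kernel. -/
noncomputable def factor (q₁ : CollapseMap Γ Δ) (q₂ : CollapseMap Γ Θ)
    (h : q₁.kernel ⊆ q₂.kernel) : CollapseMap Δ Θ :=
  have hV : ∀ u, q₂.onV (Function.surjInv q₁.onV_surjective (q₁.onV u)) = q₂.onV u := fun u =>
    onV_eq_of_kernel_subset h (Function.surjInv_eq q₁.onV_surjective (q₁.onV u))
  have hD : ∀ e, q₁.lift (exists_lift_eq h e).choose = q₂.lift e := fun e =>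
    (exists_lift_eq h e).choose_spec
  have hker : ∀ e : Δ.D, e ∈ (Set.range fun e : Θ.D => (exists_lift_eq h e).choose)ᶜ ↔
      q₁.lift e ∈ q₂.kernel := fun e => by
    refine not_congr ⟨?_, ?_⟩
    · rintro ⟨t, rfl⟩
      exact ⟨t, (hD t).symm⟩
    · rintro ⟨t, ht⟩
      exact ⟨t, q₁.lift_injective ((hD t).trans ht)⟩
  { onV := fun x => q₂.onV (Function.surjInv q₁.onV_surjective x)
    lift := fun e => (exists_lift_eq h e).choose
    onV_surjective := fun y => by
      obtain ⟨u, rfl⟩ := q₂.onV_surjective y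
      exact ⟨q₁.onV u, hV u⟩
    lift_injective := fun e e' he => q₂.lift_injective
      ((hD e).symm.trans ((congrArg q₁.lift he).trans (hD e')))
    src_lift := fun e => by
      rw [← q₁.src_lift, hV, hD, q₂.src_lift]
    rev_lift := fun e => q₁.lift_injective (by
      rw [← q₁.rev_lift, hD, hD, q₂.rev_lift])
    forest := by
      refine ⟨fun d hd => ?_, fun v m hm hs hr => ?_⟩
      · rw [hker] at hd ⊢
        rw [← q₁.rev_lift]
        exact q₂.forest.rev_mem _ hd
      · obtain ⟨u, rfl⟩ := q₁.onV_surjective v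
        -- A closed reduced path lifts to a closed reduced path that contains the lifts of all its
        -- edges; the lift lies in the kernel of `q₂`, so both are empty.
        obtain ⟨l, hl, hlr, hls, hsub, -⟩ := q₁.exists_lift_walk hm hr rfl rfl
        have := q₂.forest.acyclic u l hl (fun d hd => by
          rcases hls d hd with hk | ⟨e, he, rfl⟩
          · exact h hk
          · exact (hker e).1 (hs e he)) hlr
        subst this
        exact List.eq_nil_iff_forall_not_mem.2 fun e he => by simpa using hsub e he
    onV_eq_iff := fun x y => by
      obtain ⟨u, rfl⟩ := q₁.onV_surjective x
      obtain ⟨v, rfl⟩ := q₁.onV_surjective y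
      rw [hV, hV]
      constructor
      · intro huv
        obtain ⟨l, hl, hr, hs⟩ := q₂.exists_kernel_walk huv
        obtain ⟨m, hm, -, hms, -⟩ := q₁.exists_image_walk hl hr
        exact ⟨m, hm, fun e he => (hker e).2 (hs _ (hms e he))⟩
      · rintro ⟨m, hm, hs⟩
        obtain ⟨m', hm', hr, hsub, -⟩ := hm.exists_reduced
        obtain ⟨l, hl, -, hls, -⟩ := q₁.exists_lift_walk hm' hr rfl rfl
        refine (q₂.onV_eq_iff u v).2 ⟨l, hl, fun d hd => ?_⟩
        rcases hls d hd with hk | ⟨e, he, rfl⟩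
        · exact h hk
        · exact (hker e).1 (hs e (hsub he)) }

lemma factor_onV (q₁ : CollapseMap Γ Δ) (q₂ : CollapseMap Γ Θ) (h : q₁.kernel ⊆ q₂.kernel)
    (u : Γ.V) : (factor q₁ q₂ h).onV (q₁.onV u) = q₂.onV u :=
  onV_eq_of_kernel_subset h (Function.surjInv_eq q₁.onV_surjective (q₁.onV u))

lemma lift_factor_lift (q₁ : CollapseMap Γ Δ) (q₂ : CollapseMap Γ Θ)
    (h : q₁.kernel ⊆ q₂.kernel) (e : Θ.D) : q₁.lift ((factor q₁ q₂ h).lift e) = q₂.lift e :=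
  (exists_lift_eq h e).choose_spec

lemma mem_kernel_factor (q₁ : CollapseMap Γ Δ) (q₂ : CollapseMap Γ Θ)
    (h : q₁.kernel ⊆ q₂.kernel) (e : Δ.D) :
    e ∈ (factor q₁ q₂ h).kernel ↔ q₁.lift e ∈ q₂.kernel := by
  refine not_congr ⟨?_, ?_⟩
  · rintro ⟨t, rfl⟩
    exact ⟨t, (lift_factor_lift q₁ q₂ h t).symm⟩
  · rintro ⟨t, ht⟩
    exact ⟨t, q₁.lift_injective ((lift_factor_lift q₁ q₂ h t).trans ht)⟩

lemma factor_hom (q₁ : CollapseMap Γ Δ) (q₂ : CollapseMap Γ Θ) (h : q₁.kernel ⊆ q₂.kernel) :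
    (factor q₁ q₂ h).hom.comp q₁.hom = q₂.hom := by
  refine q₁.hom_ext (fun e => ?_) fun d hd => ?_
  · rw [MonoidHom.comp_apply, hom_edge_lift]
    rcases (factor q₁ q₂ h).mem_kernel_or e with hk | ⟨e', rfl⟩
    · rw [hom_edge_kernel _ hk, hom_edge_kernel _ ((mem_kernel_factor q₁ q₂ h e).1 hk)]
    · rw [hom_edge_lift, lift_factor_lift, hom_edge_lift]
  · rw [MonoidHom.comp_apply, hom_edge_kernel _ hd, map_one, hom_edge_kernel _ (h hd)]

/-- An isomorphism as a collapsing map. -/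
def ofIso (h : Iso Γ Δ) : CollapseMap Γ Δ where
  onV := h.onV
  lift := h.onD.symm
  onV_surjective := h.onV.surjective
  lift_injective := h.onD.symm.injective
  src_lift e := by rw [← h.src_onD, Equiv.apply_symm_apply]
  rev_lift e := by rw [Equiv.eq_symm_apply, ← h.rev_onD, Equiv.apply_symm_apply]
  forest := by simpa using IsForest.empty Γ
  onV_eq_iff u v := by
    rw [h.onV.injective.eq_iff]
    constructor
    · rintro rfl
      exact ⟨[], rfl, by simp⟩
    · rintro ⟨l, hl, hs⟩
      cases l with
      | nil => exact hl
      | cons d l => exact absurd ⟨h.onD d, by simp⟩ (hs d (by simp))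

lemma kernel_ofIso (h : Iso Γ Δ) : (ofIso h).kernel = ∅ := by
  simp [kernel, ofIso]

lemma ofIso_hom (h : Iso Γ Δ) : (ofIso h).hom = h.onEdgeGroup := by
  refine (ofIso h).hom_ext (fun e => ?_) fun d hd => ?_
  · rw [hom_edge_lift, Iso.onEdgeGroup_edge]
    change _ = Δ.edge (h.onD (h.onD.symm e))
    rw [Equiv.apply_symm_apply]
  · rw [kernel_ofIso] at hd
    exact hd.elim

lemma onV_injective (q : CollapseMap Γ Δ) (h : q.kernel = ∅) : Function.Injective q.onV := by
  intro u v huv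
  obtain ⟨l, hl, hs⟩ := (q.onV_eq_iff u v).1 huv
  cases l with
  | nil => exact hl
  | cons d l =>
    have : d ∈ q.kernel := hs d (by simp)
    rw [h] at this
    exact this.elim

/-- A collapsing map with empty kernel is an isomorphism. -/
noncomputable def toIso (q : CollapseMap Γ Δ) (h : q.kernel = ∅) : Iso Γ Δ where
  onV := Equiv.ofBijective q.onV ⟨q.onV_injective h, q.onV_surjective⟩
  onD := (Equiv.ofBijective q.lift ⟨q.lift_injective, fun d => q.exists_lift (by simp [h])⟩).symm
  src_onD d := by
    have : q.lift ((Equiv.ofBijective q.lift ⟨q.lift_injective,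
        fun d => q.exists_lift (by simp [h])⟩).symm d) = d :=
      (Equiv.ofBijective q.lift _).apply_symm_apply d
    rw [← q.src_lift, this]; rfl
  rev_onD d := by
    have : ∀ d, q.lift ((Equiv.ofBijective q.lift ⟨q.lift_injective,
        fun d => q.exists_lift (by simp [h])⟩).symm d) = d := fun d =>
      (Equiv.ofBijective q.lift _).apply_symm_apply d
    apply q.lift_injective
    rw [← q.rev_lift, this, this]

lemma ofIso_toIso (q : CollapseMap Γ Δ) (h : q.kernel = ∅) : (q.toIso h).onEdgeGroup = q.hom := by
  refine q.hom_ext (fun e => ?_) fun d hd => ?_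
  · rw [hom_edge_lift, Iso.onEdgeGroup_edge]
    exact congrArg Δ.edge ((Equiv.ofBijective q.lift _).symm_apply_apply e)
  · rw [h] at hd
    exact hd.elim

/-- The map `Γ → Γ / F`. -/
def ofCollapse (Γ : FinGraph) (F : Set Γ.D) (hF : Γ.IsForest F) :
    CollapseMap Γ (Γ.collapse F hF) where
  onV := Quot.mk _
  lift := Subtype.val
  onV_surjective := Quot.mk_surjective
  lift_injective := Subtype.val_injective
  src_lift _ := rfl
  rev_lift _ := rfl
  forest := by
    have hr : (Set.range (Subtype.val : {d : Γ.D // d ∉ F} → Γ.D))ᶜ = F := by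
      rw [Subtype.range_coe_subtype]; ext d; simp
    exact hr.symm ▸ hF
  onV_eq_iff u v := by
    have hr : ∀ d, d ∈ (Set.range (Subtype.val : {d : Γ.D // d ∉ F} → Γ.D))ᶜ ↔ d ∈ F := by
      intro d; rw [Subtype.range_coe_subtype]; simp
    refine Iff.trans ?_ (exists_congr fun l => and_congr_right fun _ =>
      forall₂_congr fun d _ => (hr d).symm)
    change (Quot.mk _ u = Quot.mk _ v) ↔ _
    constructor
    · intro h
      rw [Quot.eq] at h
      induction h with
      | rel u v h =>
        obtain ⟨d, hd, rfl, rfl⟩ := h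
        exact ⟨[d], ⟨rfl, rfl⟩, by simpa⟩
      | refl u => exact ⟨[], rfl, by simp⟩
      | symm u v _ ih =>
        obtain ⟨l, hl, hs⟩ := ih
        exact ⟨_, hl.reverse, fun d hd => hF.rev_mem_iff.1 (hs _ (mem_revWalk.1 hd))⟩
      | trans u v w _ _ ih1 ih2 =>
        obtain ⟨l, hl, hs⟩ := ih1
        obtain ⟨m, hm, hs'⟩ := ih2
        exact ⟨l ++ m, hl.append hm, fun d hd => (List.mem_append.1 hd).elim (hs d) (hs' d)⟩
    · rintro ⟨l, hl, hs⟩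
      induction l generalizing u with
      | nil => obtain rfl : u = v := hl; rfl
      | cons d l ih =>
        obtain ⟨rfl, hl⟩ := hl
        exact (Quot.sound ⟨d, hs d (by simp), rfl, rfl⟩).trans
          (ih _ hl fun e he => hs e (by simp [he]))

lemma kernel_ofCollapse (Γ : FinGraph) (F : Set Γ.D) (hF : Γ.IsForest F) :
    (ofCollapse Γ F hF).kernel = F := by
  ext d
  change ¬ (d ∈ Set.range (Subtype.val : {d : Γ.D // d ∉ F} → Γ.D)) ↔ _
  simp

lemma ofCollapse_hom (Γ : FinGraph) (F : Set Γ.D) (hF : Γ.IsForest F) :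
    (ofCollapse Γ F hF).hom = Γ.collapseHom F hF := by
  classical
  refine (ofCollapse Γ F hF).hom_ext (fun e => ?_) fun d hd => ?_
  · rw [hom_edge_lift, collapseHom, liftEdge_edge]
    exact (dif_pos e.2 : dite (e.1 ∉ F)
      (fun h => (Γ.collapse F hF).edge ⟨e.1, h⟩) (fun _ => 1) = _).symm
  · rw [hom_edge_kernel _ hd, collapseHom, liftEdge_edge, dif_neg]
    rw [kernel_ofCollapse] at hd
    simpa

/-! ### Inherited properties -/

lemma isConnected (q : CollapseMap Γ Δ) (h : Γ.IsConnected) : Δ.IsConnected := by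
  intro x y
  obtain ⟨u, rfl⟩ := q.onV_surjective x
  obtain ⟨v, rfl⟩ := q.onV_surjective y
  obtain ⟨l, hl⟩ := h u v
  obtain ⟨m, hm, hr, -⟩ := hl.exists_reduced
  obtain ⟨l', hl', -⟩ := q.exists_image_walk hm hr
  exact ⟨l', hl'⟩

lemma not_isSeparating (q : CollapseMap Γ Δ) (h : ∀ d, ¬ Γ.IsSeparating d) (e : Δ.D) :
    ¬ Δ.IsSeparating e := by
  obtain ⟨l, hl, h1, h2⟩ := not_not.1 (h (q.lift e))
  obtain ⟨m, hm, hr, hs, -⟩ := hl.exists_reduced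
  obtain ⟨l', hl', -, hs', -⟩ := q.exists_image_walk hm hr
  rw [q.src_lift, q.tgt_lift] at hl'
  refine not_not.2 ⟨l', hl', fun h => h1 (hs (hs' _ h)), fun h => h2 (hs ?_)⟩
  rw [q.rev_lift]
  exact hs' _ h

lemma card_V_le (q : CollapseMap Γ Δ) : Nat.card Δ.V ≤ Nat.card Γ.V :=
  Nat.card_le_card_of_surjective _ q.onV_surjective

lemma card_V_lt (q : CollapseMap Γ Δ) (h : q.kernel.Nonempty) :
    Nat.card Δ.V < Nat.card Γ.V := by
  obtain ⟨d, hd⟩ := h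
  refine lt_of_le_of_ne q.card_V_le fun he => ?_
  have hb := (Nat.bijective_iff_surjective_and_card q.onV).2 ⟨q.onV_surjective, he.symm⟩
  exact q.forest.src_ne_tgt hd (hb.1 (q.onV_src_eq hd))

lemma valence_eq (Γ : FinGraph) (v : Γ.V) : Γ.valence v = {d : Γ.D | Γ.src d = v}.ncard := by
  exact Nat.card_coe_set_eq {d : Γ.D | Γ.src d = v}

/-- If a nontrivial tree is collapsed to `x`, it has two leaves, each of which carries at least two
surviving edges. Otherwise all edges at a preimage of `x` survive. -/
lemma valence_ge (q : CollapseMap Γ Δ) (h : ∀ v, 3 ≤ Γ.valence v) (x : Δ.V) :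
    3 ≤ Δ.valence x := by
  have himg : q.lift '' {e : Δ.D | Δ.src e = x} =
      {d : Γ.D | q.onV (Γ.src d) = x ∧ d ∉ q.kernel} := by
    ext d
    constructor
    · rintro ⟨e, rfl, rfl⟩
      exact ⟨q.src_lift e, q.lift_notMem_kernel e⟩
    · rintro ⟨h1, h2⟩
      obtain ⟨e, rfl⟩ := q.exists_lift h2
      exact ⟨e, (q.src_lift e).symm.trans h1, rfl⟩
  rw [valence_eq, ← Set.ncard_image_of_injective _ q.lift_injective, himg]
  by_cases hk : ∃ d ∈ q.kernel, q.onV (Γ.src d) = x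
  · obtain ⟨d, hd, rfl⟩ := hk
    have hF : Γ.IsForest q.kernel := q.forest
    have leaf : ∀ a ∈ q.kernel, (∀ e ∈ q.kernel, Γ.src e = Γ.src a → e = a) →
        2 ≤ {d | Γ.src d = Γ.src a ∧ d ∉ q.kernel}.ncard := fun a ha hl => by
      have h1 := h (Γ.src a)
      rw [valence_eq] at h1
      have h2 : {d | Γ.src d = Γ.src a} ⊆ insert a {d | Γ.src d = Γ.src a ∧ d ∉ q.kernel} := by
        intro e he
        by_cases hek : e ∈ q.kernel
        · exact Or.inl (hl e hek he)
        · exact Or.inr ⟨he, hek⟩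
      have h3 := Set.ncard_le_ncard h2 (Set.toFinite _)
      have h4 := Set.ncard_insert_le a {d | Γ.src d = Γ.src a ∧ d ∉ q.kernel}
      omega
    have hwalk : ∀ {u v} {l : List Γ.D}, Γ.IsWalk u v l → (∀ d ∈ l, d ∈ q.kernel) →
        q.onV u = q.onV v := fun hl hs => (q.onV_eq_iff _ _).2 ⟨_, hl, hs⟩
    obtain ⟨a, m, hw, hr, hs, hla⟩ := hF.exists_leaf (hF.rev_mem _ hd)
    rw [tgt_rev] at hw
    have ha : a ∈ q.kernel := hs a (by simp)
    -- Prolonging from the leaf `a` gives a second leaf, at another vertex because the reduced path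
    -- between them cannot close up.
    obtain ⟨b, m', hw', hr', hs', hlb⟩ := hF.exists_leaf (hF.rev_mem _ ha)
    rw [tgt_rev] at hw'
    have hb : b ∈ q.kernel := hs' b (by simp)
    have hax := hwalk hw hs
    have hbx := (hwalk hw' hs').trans hax
    have hab : Γ.src a ≠ Γ.src b := fun hab => by
      rw [hab] at hw'
      simpa using hF.acyclic _ _ hw' hs' hr'
    have hdisj : Disjoint {d | Γ.src d = Γ.src a ∧ d ∉ q.kernel}
        {d | Γ.src d = Γ.src b ∧ d ∉ q.kernel} :=
      Set.disjoint_left.2 fun d h1 h2 => hab (h1.1.symm.trans h2.1)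
    have hu := Set.ncard_union_eq hdisj (Set.toFinite _) (Set.toFinite _)
    have hsub : {d | Γ.src d = Γ.src a ∧ d ∉ q.kernel} ∪
        {d | Γ.src d = Γ.src b ∧ d ∉ q.kernel} ⊆
        {e : Γ.D | q.onV (Γ.src e) = q.onV (Γ.src d) ∧ e ∉ q.kernel} := by
      rintro e (⟨he, hk⟩ | ⟨he, hk⟩)
      · exact ⟨by rw [he, hax], hk⟩
      · exact ⟨by rw [he, hbx], hk⟩
    have h5 := Set.ncard_le_ncard hsub (Set.toFinite _)
    have h6 := leaf a ha hla
    have h7 := leaf b hb hlb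
    omega
  · push Not at hk
    obtain ⟨v, rfl⟩ := q.onV_surjective x
    have h1 := h v
    rw [valence_eq] at h1
    refine h1.trans (Set.ncard_le_ncard ?_ (Set.toFinite _))
    rintro d rfl
    exact ⟨rfl, fun hd => hk d hd rfl⟩

end CollapseMap

end FinGraph

/-! ### Collapsing marked graphs -/

namespace MarkedGraph

variable {n : ℕ}

open FinGraph (CollapseMap)

/-- The collapsing map `q` is compatible with the markings. -/
def IsCollapse (A B : MarkedGraph n) (q : CollapseMap A.graph B.graph) : Prop :=
  ∃ p ∈ B.graph.pathClasses (q.onV A.base) B.base,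
    ∀ x, (B.marking x : B.graph.EdgeGroup) = p⁻¹ * q.hom (A.marking x) * p

lemma IsCollapse.precomp {A B : MarkedGraph n} {q : CollapseMap A.graph B.graph}
    (h : IsCollapse A B q) (φ : MulAut (Fr n)) :
    IsCollapse (A.precomp φ) (B.precomp φ) q := by
  obtain ⟨p, hp, h⟩ := h
  exact ⟨p, hp, fun x => h (φ x)⟩

lemma IsCollapse.comp {A B C : MarkedGraph n} {q : CollapseMap A.graph B.graph}
    {r : CollapseMap B.graph C.graph} (hr : IsCollapse B C r) (hq : IsCollapse A B q) :
    IsCollapse A C (r.comp q) := by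
  obtain ⟨p, hp, hq⟩ := hq
  obtain ⟨p', hp', hr⟩ := hr
  refine ⟨r.hom p * p', FinGraph.mul_mem_pathClasses (r.map_mem_pathClasses hp) hp',
    fun x => ?_⟩
  rw [hr, hq, FinGraph.CollapseMap.comp_hom, MonoidHom.comp_apply, map_mul, map_mul, map_inv]
  group

lemma IsCollapse.factor {A B C : MarkedGraph n} {q : CollapseMap A.graph B.graph}
    {r : CollapseMap A.graph C.graph} (hq : IsCollapse A B q) (hr : IsCollapse A C r)
    (h : q.kernel ⊆ r.kernel) : IsCollapse B C (q.factor r h) := by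
  obtain ⟨p, hp, hq⟩ := hq
  obtain ⟨p', hp', hr⟩ := hr
  have e := FinGraph.CollapseMap.factor_hom q r h
  refine ⟨((q.factor r h).hom p)⁻¹ * p', FinGraph.mul_mem_pathClasses
    (FinGraph.inv_mem_pathClasses ?_) hp', fun x => ?_⟩
  · have := (q.factor r h).map_mem_pathClasses hp
    rwa [FinGraph.CollapseMap.factor_onV] at this
  · have : (q.factor r h).hom (q.hom (A.marking x)) = r.hom (A.marking x) := by
      rw [← e]; rfl
    rw [hr, hq, map_mul, map_mul, map_inv, this]
    group

/-- A collapsing map factors through the quotient by its kernel, and the second factor has empty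
kernel, so it is an isomorphism. -/
lemma collapsesTo_iff {A B : MarkedGraph n} :
    A.CollapsesTo B ↔ ∃ q, IsCollapse A B q := by
  constructor
  · rintro ⟨F, hF, h, p, hp, H⟩
    refine ⟨(FinGraph.CollapseMap.ofIso h).comp (FinGraph.CollapseMap.ofCollapse _ F hF),
      p, hp, fun x => ?_⟩
    rw [H, FinGraph.CollapseMap.comp_hom, FinGraph.CollapseMap.ofIso_hom,
      FinGraph.CollapseMap.ofCollapse_hom]
    rfl
  · rintro ⟨q, p, hp, H⟩
    set c := FinGraph.CollapseMap.ofCollapse A.graph q.kernel q.isForest_kernel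
    have hc : c.kernel = q.kernel := FinGraph.CollapseMap.kernel_ofCollapse _ _ _
    have hk : (c.factor q hc.le).kernel = ∅ := by
      refine Set.eq_empty_of_forall_notMem fun e he => ?_
      rw [FinGraph.CollapseMap.mem_kernel_factor] at he
      exact c.lift_notMem_kernel e (hc.symm ▸ he)
    refine ⟨q.kernel, q.isForest_kernel, (c.factor q hc.le).toIso hk, p, ?_, fun x => ?_⟩
    · have : (c.factor q hc.le).onV (c.onV A.base) = q.onV A.base :=
        FinGraph.CollapseMap.factor_onV c q hc.le A.base
      rw [← this] at hp
      exact hp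
    · rw [H, FinGraph.CollapseMap.ofIso_toIso, ← FinGraph.CollapseMap.ofCollapse_hom,
        ← FinGraph.CollapseMap.factor_hom c q hc.le]
      rfl

lemma equivalent_iff {A B : MarkedGraph n} :
    Equivalent A B ↔ ∃ q, q.kernel = ∅ ∧ IsCollapse A B q := by
  constructor
  · rintro ⟨h, p, hp, H⟩
    exact ⟨FinGraph.CollapseMap.ofIso h, FinGraph.CollapseMap.kernel_ofIso h, p, hp,
      fun x => by rw [H, FinGraph.CollapseMap.ofIso_hom]⟩
  · rintro ⟨q, hq, p, hp, H⟩
    exact ⟨q.toIso hq, p, hp, fun x => by rw [H, FinGraph.CollapseMap.ofIso_toIso]⟩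

lemma IsCollapse.equivalent {A B : MarkedGraph n} {q : CollapseMap A.graph B.graph}
    (h : IsCollapse A B q) (hq : q.kernel = ∅) : Equivalent A B :=
  equivalent_iff.2 ⟨q, hq, h⟩

/-- The marked graph obtained by composing a marking with a collapsing map. -/
noncomputable def push (A : MarkedGraph n) {Δ : FinGraph} (q : CollapseMap A.graph Δ) :
    MarkedGraph n where
  graph := Δ
  connected := q.isConnected A.connected
  not_separating := q.not_isSeparating A.not_separating
  three_le_valence := q.valence_ge A.three_le_valence
  base := q.onV A.base
  marking := A.marking.trans (q.pi1Equiv A.base)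

lemma isCollapse_push (A : MarkedGraph n) {Δ : FinGraph} (q : CollapseMap A.graph Δ) :
    IsCollapse A (A.push q) q :=
  ⟨1, Δ.one_mem_pathClasses _, fun x => by
    rw [inv_one, one_mul, mul_one]
    exact q.coe_pi1Equiv A.base (A.marking x)⟩

/-- The marked graph obtained by lifting a marking along a collapsing map. -/
noncomputable def pull (B : MarkedGraph n) {Γ : FinGraph} (q : CollapseMap Γ B.graph)
    (h1 : Γ.IsConnected) (h2 : ∀ d, ¬ Γ.IsSeparating d) (h3 : ∀ v, 3 ≤ Γ.valence v) :
    MarkedGraph n where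
  graph := Γ
  connected := h1
  not_separating := h2
  three_le_valence := h3
  base := Function.surjInv q.onV_surjective B.base
  marking := B.marking.trans ((MulEquiv.subgroupCongr (by
    rw [Function.surjInv_eq q.onV_surjective B.base])).trans
      (q.pi1Equiv (Function.surjInv q.onV_surjective B.base)).symm)

lemma isCollapse_pull (B : MarkedGraph n) {Γ : FinGraph} (q : CollapseMap Γ B.graph)
    (h1 : Γ.IsConnected) (h2 : ∀ d, ¬ Γ.IsSeparating d) (h3 : ∀ v, 3 ≤ Γ.valence v) :
    IsCollapse (B.pull q h1 h2 h3) B q := by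
  refine ⟨1, ?_, fun x => ?_⟩
  · change 1 ∈ B.graph.pathClasses (q.onV (Function.surjInv q.onV_surjective B.base)) B.base
    rw [Function.surjInv_eq q.onV_surjective B.base]
    exact B.graph.one_mem_pathClasses _
  · rw [inv_one, one_mul, mul_one]
    symm
    refine (q.coe_pi1Equiv _ _).symm.trans ?_
    refine congrArg Subtype.val (MulEquiv.apply_symm_apply (q.pi1Equiv _) _) |>.trans ?_
    rfl

/-! ### The cohomology classes of the edges -/

/-- The class of an oriented edge in `Hom(F_n, ℤ)`. -/
noncomputable def cls (A : MarkedGraph n) (d : A.graph.D) : Fr n →* Multiplicative ℤ :=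
  (A.graph.count d).comp ((A.graph.pi1 A.base).subtype.comp A.marking.toMonoidHom)

lemma cls_apply (A : MarkedGraph n) (d : A.graph.D) (x : Fr n) :
    A.cls d x = A.graph.count d (A.marking x) := rfl

lemma cls_rev (A : MarkedGraph n) (d : A.graph.D) :
    A.cls (A.graph.rev d) = (A.cls d)⁻¹ := by
  ext1 x
  exact A.graph.count_rev d _

lemma isFlow_cls (A : MarkedGraph n) (x : Fr n) :
    A.graph.IsFlow fun d => (A.cls d x).toAdd :=
  A.graph.isFlow_count (A.marking x).2

/-- The path `p` comparing base points cancels because ℤ is commutative. -/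
lemma IsCollapse.cls_lift {A B : MarkedGraph n} {q : CollapseMap A.graph B.graph}
    (h : IsCollapse A B q) (e : B.graph.D) : A.cls (q.lift e) = B.cls e := by
  obtain ⟨p, -, h⟩ := h
  ext1 x
  rw [cls_apply, cls_apply, h, ← q.count_hom, map_mul, map_mul, map_inv, mul_right_comm,
    inv_mul_cancel, one_mul]

/-- A homomorphism to ℤ factors through the abelianization, where `φ` acts trivially. This is the
only property of the Torelli group that the argument uses. -/
lemma cls_precomp (A : MarkedGraph n) {φ : MulAut (Fr n)} (hφ : autAb n φ = 1)
    (d : A.graph.D) : (A.precomp φ).cls d = A.cls d := by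
  refine MonoidHom.ext fun x => ?_
  have h1 : Abelianization.of (φ x) = Abelianization.of x :=
    DFunLike.congr_fun hφ (Abelianization.of x)
  have h2 : ∀ y, A.cls d y = Abelianization.lift (A.cls d) (Abelianization.of y) := fun y => by
    rw [Abelianization.lift_apply_of]
  change A.cls d (φ x) = A.cls d x
  rw [h2, h1, ← h2]

end MarkedGraph

/-! ### The order on the vertices of the spine, their rank and their edge classes. -/

namespace SpineVertex

variable {n : ℕ}

open MarkedGraph
open FinGraph (CollapseMap)

lemma mk_eq_mk {A B : MarkedGraph n} : mk A = mk B ↔ Equivalent A B := Quotient.eq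

lemma exists_rep (v : SpineVertex n) : ∃ A, mk A = v := Quotient.exists_rep v

lemma collapses_mk {A B : MarkedGraph n} :
    (mk A).Collapses (mk B) ↔ ∃ q, IsCollapse A B q := by
  constructor
  · rintro ⟨A', B', hA, hB, h⟩
    obtain ⟨q, hq⟩ := collapsesTo_iff.1 h
    obtain ⟨r, -, hr⟩ := equivalent_iff.1 (mk_eq_mk.1 hA).symm
    obtain ⟨s, -, hs⟩ := equivalent_iff.1 (mk_eq_mk.1 hB)
    exact ⟨_, hs.comp (hq.comp hr)⟩
  · rintro h
    exact ⟨A, B, rfl, rfl, collapsesTo_iff.2 h⟩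

lemma Collapses.refl (v : SpineVertex n) : v.Collapses v := by
  obtain ⟨A, rfl⟩ := exists_rep v
  obtain ⟨q, -, hq⟩ := equivalent_iff.1 (Equivalent.refl A)
  exact collapses_mk.2 ⟨q, hq⟩

lemma Collapses.trans {u v w : SpineVertex n} (h : u.Collapses v) (h' : v.Collapses w) :
    u.Collapses w := by
  obtain ⟨A, rfl⟩ := exists_rep u
  obtain ⟨B, rfl⟩ := exists_rep v
  obtain ⟨C, rfl⟩ := exists_rep w
  obtain ⟨q, hq⟩ := collapses_mk.1 h
  obtain ⟨r, hr⟩ := collapses_mk.1 h'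
  exact collapses_mk.2 ⟨_, hr.comp hq⟩

/-- The number of vertices of the graph. -/
noncomputable def rank (v : SpineVertex n) : ℕ :=
  Quotient.liftOn v (fun A : MarkedGraph n => Nat.card A.graph.V)
    (fun _ _ ⟨h, _⟩ => Nat.card_congr h.onV)

lemma Collapses.rank_le {u v : SpineVertex n} (h : u.Collapses v) : v.rank ≤ u.rank := by
  obtain ⟨A, rfl⟩ := exists_rep u
  obtain ⟨B, rfl⟩ := exists_rep v
  obtain ⟨q, -⟩ := collapses_mk.1 h
  exact q.card_V_le

/-- A collapsed edge joins two different vertices and merges them, so a collapse that keeps the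
number of vertices has empty kernel. -/
lemma Collapses.eq_of_rank_le {u v : SpineVertex n} (h : u.Collapses v)
    (hr : u.rank ≤ v.rank) : u = v := by
  obtain ⟨A, rfl⟩ := exists_rep u
  obtain ⟨B, rfl⟩ := exists_rep v
  obtain ⟨q, hq⟩ := collapses_mk.1 h
  refine mk_eq_mk.2 (hq.equivalent (Set.not_nonempty_iff_eq_empty.1 fun hk => ?_))
  exact absurd hr (not_le.2 (q.card_V_lt hk))

lemma Collapses.antisymm {u v : SpineVertex n} (h : u.Collapses v) (h' : v.Collapses u) :
    u = v := h.eq_of_rank_le h'.rank_le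

lemma exists_aut_smul (g : (OutF n)ᵐᵒᵖ) : ∃ φ : MulAut (Fr n), MulOpposite.op (φ : OutF n) = g := by
  induction g using MulOpposite.rec' with
  | h g =>
    obtain ⟨φ, rfl⟩ := QuotientGroup.mk_surjective g
    exact ⟨φ, rfl⟩

lemma rank_smul (g : (OutF n)ᵐᵒᵖ) (v : SpineVertex n) : (g • v).rank = v.rank := by
  obtain ⟨φ, rfl⟩ := exists_aut_smul g
  obtain ⟨A, rfl⟩ := exists_rep v
  rw [op_mk_smul]
  rfl

lemma exists_torelli_smul (g : (torelli n).op) :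
    ∃ φ : MulAut (Fr n), autAb n φ = 1 ∧ MulOpposite.op (φ : OutF n) = g.1 := by
  obtain ⟨φ, hφ⟩ := exists_aut_smul g.1
  refine ⟨φ, ?_, hφ⟩
  have h1 : (φ : OutF n) ∈ torelli n := by
    have := g.2
    rw [← hφ] at this
    exact this
  exact h1

lemma torelli_smul_def (g : (torelli n).op) (v : SpineVertex n) : g • v = g.1 • v := rfl

/-- The set of classes of the edges. -/
def classes (v : SpineVertex n) : Set (Fr n →* Multiplicative ℤ) :=
  {c | ∃ A d, mk A = v ∧ A.cls d = c}

lemma classes_subset {u v : SpineVertex n} (h : u.Collapses v) : v.classes ⊆ u.classes := by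
  rintro _ ⟨B, e, rfl, rfl⟩
  obtain ⟨A, rfl⟩ := exists_rep u
  obtain ⟨q, hq⟩ := collapses_mk.1 h
  exact ⟨A, q.lift e, rfl, hq.cls_lift e⟩

lemma classes_mk (A : MarkedGraph n) : (mk A).classes = Set.range A.cls := by
  refine Set.Subset.antisymm ?_ ?_
  · rintro _ ⟨B, e, hB, rfl⟩
    obtain ⟨q, -, hq⟩ := equivalent_iff.1 (mk_eq_mk.1 hB).symm
    exact ⟨q.lift e, hq.cls_lift e⟩
  · rintro _ ⟨d, rfl⟩
    exact ⟨A, d, rfl, rfl⟩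

lemma classes_smul (g : (torelli n).op) (v : SpineVertex n) : (g • v).classes = v.classes := by
  obtain ⟨φ, h1, h2⟩ := exists_torelli_smul g
  obtain ⟨A, rfl⟩ := exists_rep v
  rw [torelli_smul_def, ← h2, op_mk_smul, classes_mk, classes_mk]
  exact congrArg Set.range (funext fun d => A.cls_precomp h1 d)

/-! ### Collapsing all edges with classes outside of a given set -/

/-- `w` is obtained from `v` by collapsing all edges whose class does not belong to `B`. -/
def IsRetract (B : Set (Fr n →* Multiplicative ℤ)) (v w : SpineVertex n) : Prop :=
  ∃ (A A' : MarkedGraph n) (q : CollapseMap A.graph A'.graph), mk A = v ∧ mk A' = w ∧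
    IsCollapse A A' q ∧ q.kernel = {d | A.cls d ∉ B}

variable {B : Set (Fr n →* Multiplicative ℤ)}

lemma IsRetract.collapses {v w : SpineVertex n} (h : IsRetract B v w) : v.Collapses w := by
  obtain ⟨A, A', q, rfl, rfl, hq, -⟩ := h
  exact collapses_mk.2 ⟨q, hq⟩

/-- An edge with class outside `B` is either collapsed by `s` or survives with the same class and is
then collapsed by `r`. -/
lemma IsRetract.mono {v w v' w' : SpineVertex n} (h : IsRetract B v w) (h' : IsRetract B v' w')
    (hv : v.Collapses v') : w.Collapses w' := by
  obtain ⟨A, A', q, rfl, rfl, hq, hqk⟩ := h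
  obtain ⟨C, C', r, rfl, rfl, hr, hrk⟩ := h'
  obtain ⟨s, hs⟩ := collapses_mk.1 hv
  refine collapses_mk.2 ⟨_, hq.factor (hr.comp hs) fun d hd => ?_⟩
  rcases s.mem_kernel_or d with hk | ⟨e, rfl⟩
  · rintro ⟨t, rfl⟩
    exact s.lift_notMem_kernel _ hk
  · have he : e ∈ r.kernel := by
      rw [hrk]
      rw [hqk] at hd
      intro h
      refine hd ?_
      rwa [hs.cls_lift]
    exact fun h => he (FinGraph.CollapseMap.mem_range_comp.1 h)

/-- Uniqueness turns `IsRetract` into a map, and makes that map equivariant. -/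
lemma IsRetract.unique {v w w' : SpineVertex n} (h : IsRetract B v w) (h' : IsRetract B v w') :
    w = w' :=
  (h.mono h' (.refl v)).antisymm (h'.mono h (.refl v))

lemma IsRetract.classes_subset {v w : SpineVertex n} (h : IsRetract B v w) : w.classes ⊆ B := by
  obtain ⟨A, A', q, rfl, rfl, hq, hqk⟩ := h
  rw [classes_mk]
  rintro _ ⟨e, rfl⟩
  have := q.lift_notMem_kernel e
  rw [hqk] at this
  rw [← hq.cls_lift]
  exact not_not.1 this

lemma isRetract_self {v : SpineVertex n} (h : v.classes ⊆ B) : IsRetract B v v := by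
  obtain ⟨A, rfl⟩ := exists_rep v
  obtain ⟨q, hk, hq⟩ := equivalent_iff.1 (Equivalent.refl A)
  refine ⟨A, A, q, rfl, rfl, hq, ?_⟩
  rw [hk]
  refine (Set.eq_empty_of_forall_notMem fun d (hd : A.cls d ∉ B) => hd (h ?_)).symm
  rw [classes_mk]
  exact ⟨d, rfl⟩

lemma IsRetract.smul {v w : SpineVertex n} (h : IsRetract B v w) (g : (torelli n).op) :
    IsRetract B (g • v) (g • w) := by
  obtain ⟨φ, h1, h2⟩ := exists_torelli_smul g
  obtain ⟨A, A', q, rfl, rfl, hq, hqk⟩ := h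
  rw [torelli_smul_def, torelli_smul_def, ← h2, op_mk_smul, op_mk_smul]
  refine ⟨A.precomp φ, A'.precomp φ, q, rfl, rfl, hq.precomp φ, ?_⟩
  refine hqk.trans ?_
  ext d
  exact not_congr (by rw [A.cls_precomp h1])

/-- Every edge surviving in `σ` has its class in `B`, so the edges to be collapsed lie in the forest
collapsed by `q`. -/
lemma exists_isRetract {v σ : SpineVertex n} (h : v.Collapses σ) (hσ : σ.classes = B) :
    ∃ w, IsRetract B v w ∧ w.Collapses σ := by
  obtain ⟨A, rfl⟩ := exists_rep v
  obtain ⟨R, rfl⟩ := exists_rep σ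
  obtain ⟨q, hq⟩ := collapses_mk.1 h
  rw [classes_mk] at hσ
  have hsub : {d | A.cls d ∉ B} ⊆ q.kernel := by
    intro d hd
    by_contra hk
    obtain ⟨e, rfl⟩ := q.exists_lift hk
    refine hd ?_
    rw [hq.cls_lift, ← hσ]
    exact ⟨e, rfl⟩
  have hinv : ∀ c ∈ B, c⁻¹ ∈ B := by
    rw [← hσ]
    rintro _ ⟨e, rfl⟩
    exact ⟨R.graph.rev e, R.cls_rev e⟩
  have hF : A.graph.IsForest {d | A.cls d ∉ B} := by
    refine FinGraph.IsForest.subset q.forest hsub fun d hd hmem => hd ?_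
    have := hinv _ hmem
    rwa [A.cls_rev, inv_inv] at this
  have hk := FinGraph.CollapseMap.kernel_ofCollapse A.graph _ hF
  have hp := A.isCollapse_push (FinGraph.CollapseMap.ofCollapse A.graph _ hF)
  exact ⟨mk (A.push (FinGraph.CollapseMap.ofCollapse A.graph _ hF)),
    ⟨A, _, _, rfl, rfl, hp, hk⟩, collapses_mk.2 ⟨_, hp.factor hq (hk.le.trans hsub)⟩⟩

end SpineVertex

/-! ### Surgeries inverse to gluing a circle: removing a loop and smoothing a bivalent vertex. -/

namespace FinGraph

lemma IsConnected.of_adj {Γ : FinGraph} {X : Type*} (h : Γ.IsConnected) {r : X → X → Prop}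
    (hr : Equivalence r) (f : Γ.V → X) (hf : ∀ d, r (f (Γ.src d)) (f (Γ.tgt d))) (u v : Γ.V) :
    r (f u) (f v) := by
  obtain ⟨l, hl⟩ := h u v
  induction l generalizing u with
  | nil => obtain rfl : u = v := hl; exact hr.refl _
  | cons d l ih =>
    obtain ⟨rfl, hl⟩ := hl
    exact hr.trans (hf d) (ih _ hl)

/-- Being joined by an edge path is an equivalence relation. -/
lemma equivalence_joined (Γ : FinGraph) : Equivalence fun u v => ∃ l, Γ.IsWalk u v l :=
  ⟨fun _ => ⟨[], rfl⟩, fun ⟨_, h⟩ => ⟨_, h.reverse⟩, fun ⟨_, h⟩ ⟨_, h'⟩ => ⟨_, h.append h'⟩⟩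

/-- Two isomorphic graphs remain isomorphic after gluing circles to corresponding vertices. -/
def Iso.addLoop {Γ Δ : FinGraph} (h : Iso Γ Δ) (p : Γ.V) :
    Iso (Γ.addLoop p) (Δ.addLoop (h.onV p)) where
  onV := h.onV
  onD := Equiv.sumCongr h.onD (Equiv.refl _)
  src_onD := by
    rintro (d | b)
    · exact h.src_onD d
    · rfl
  rev_onD := by
    rintro (d | b)
    · exact congrArg Sum.inl (h.rev_onD d)
    · rfl

lemma subdivide_rev_inl_self (Γ : FinGraph) (d : Γ.D) :
    (Γ.subdivide d).rev (Sum.inl d) = Sum.inr false := if_pos rfl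

lemma subdivide_rev_inl_rev (Γ : FinGraph) (d : Γ.D) :
    (Γ.subdivide d).rev (Sum.inl (Γ.rev d)) = Sum.inr true :=
  (if_neg (Γ.rev_ne d)).trans (if_pos rfl)

lemma subdivide_rev_inl (Γ : FinGraph) {d e : Γ.D} (h1 : e ≠ d) (h2 : e ≠ Γ.rev d) :
    (Γ.subdivide d).rev (Sum.inl e) = Sum.inl (Γ.rev e) :=
  (if_neg h1).trans (if_neg h2)

/-- The graph without the edge `{d, rev d}`. -/
abbrev removeEdge (Γ : FinGraph) (d : Γ.D) : FinGraph where
  V := Γ.V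
  D := {e : Γ.D // e ≠ d ∧ e ≠ Γ.rev d}
  src e := Γ.src e.1
  rev e := ⟨Γ.rev e.1, fun h => e.2.2 (rev_eq_iff.1 h), fun h => e.2.1 (Γ.rev_injective h)⟩
  rev_rev e := Subtype.ext (Γ.rev_rev e.1)
  rev_ne e h := Γ.rev_ne e.1 (congrArg Subtype.val h)

open Classical in
/-- Gluing a removed loop back in. -/
noncomputable def removeEdgeIso (Γ : FinGraph) (d : Γ.D) (h : Γ.tgt d = Γ.src d) :
    Iso ((Γ.removeEdge d).addLoop (Γ.src d)) Γ where
  onV := Equiv.refl _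
  onD := Equiv.ofBijective
    (Sum.elim Subtype.val (fun b => if b then Γ.rev d else d)) (by
      constructor
      · rintro (e | b) (e' | b') hh
        · exact congrArg Sum.inl (Subtype.ext hh)
        · cases b'
          · exact (e.2.1 hh).elim
          · exact (e.2.2 hh).elim
        · cases b
          · exact (e'.2.1 hh.symm).elim
          · exact (e'.2.2 hh.symm).elim
        · cases b <;> cases b'
          · rfl
          · exact (Γ.rev_ne d (Eq.symm hh)).elim
          · exact (Γ.rev_ne d hh).elim
          · rfl
      · intro e
        by_cases h1 : e = d
        · exact ⟨Sum.inr false, h1.symm⟩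
        · by_cases h2 : e = Γ.rev d
          · exact ⟨Sum.inr true, h2.symm⟩
          · exact ⟨Sum.inl ⟨e, h1, h2⟩, rfl⟩)
  src_onD := by
    rintro (e | b)
    · rfl
    · cases b
      · rfl
      · exact h
  rev_onD := by
    rintro (e | b)
    · rfl
    · cases b
      · rfl
      · exact Γ.rev_rev d

/-- The edges `a`, `b` are the two edges at the vertex `v`, and they are not the two orientations
of one edge. -/
structure IsBivalent (Γ : FinGraph) (v : Γ.V) (a b : Γ.D) : Prop where
  ne : a ≠ b
  src_eq_iff : ∀ e, Γ.src e = v ↔ e = a ∨ e = b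
  rev_ne : Γ.rev a ≠ b

namespace IsBivalent

variable {Γ : FinGraph} {v : Γ.V} {a b : Γ.D} (h : Γ.IsBivalent v a b)

include h

lemma symm : Γ.IsBivalent v b a :=
  ⟨h.ne.symm, fun e => (h.src_eq_iff e).trans or_comm, fun h' => h.rev_ne (rev_eq_iff.2 h'.symm)⟩

lemma tgt_ne : Γ.src (Γ.rev a) ≠ v := fun h' => by
  rcases (h.src_eq_iff _).1 h' with h1 | h1
  · exact Γ.rev_ne a h1
  · exact h.rev_ne h1

end IsBivalent

open Classical in
/-- The graph obtained by declaring a bivalent vertex to be an interior point of an edge. -/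
noncomputable abbrev smooth (Γ : FinGraph) {v : Γ.V} {a b : Γ.D} (h : Γ.IsBivalent v a b) :
    FinGraph where
  V := {u : Γ.V // u ≠ v}
  D := {e : Γ.D // Γ.src e ≠ v}
  src e := ⟨Γ.src e.1, e.2⟩
  -- An edge arriving at `v` along `rev a` continues along `b`, so seen from the other end it is
  -- `rev b`, and conversely.
  rev e := if h1 : Γ.rev e.1 = a then ⟨Γ.rev b, h.symm.tgt_ne⟩ else
    if h2 : Γ.rev e.1 = b then ⟨Γ.rev a, h.tgt_ne⟩ else
      ⟨Γ.rev e.1, fun h' => ((h.src_eq_iff _).1 h').elim h1 h2⟩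
  rev_rev e := by
    by_cases h1 : Γ.rev e.1 = a
    · have h3 : Γ.rev a = e.1 := by rw [← h1, Γ.rev_rev]
      simp [h1, h.ne.symm, h3]
    · by_cases h2 : Γ.rev e.1 = b
      · have h3 : Γ.rev b = e.1 := by rw [← h2, Γ.rev_rev]
        simp [h2, h.ne.symm, h3]
      · have h3 : e.1 ≠ a := fun h' => e.2 ((h.src_eq_iff _).2 (Or.inl h'))
        have h4 : e.1 ≠ b := fun h' => e.2 ((h.src_eq_iff _).2 (Or.inr h'))
        simp [h1, h2, h3, h4]
  rev_ne e := by
    by_cases h1 : Γ.rev e.1 = a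
    · simp only [h1, dif_pos]
      intro h'
      have := congrArg Subtype.val h'
      simp only at this
      rw [← this, Γ.rev_rev] at h1
      exact h.ne h1.symm
    · by_cases h2 : Γ.rev e.1 = b
      · rw [dif_neg h1, dif_pos h2]
        intro h'
        have := congrArg Subtype.val h'
        simp only at this
        rw [← this, Γ.rev_rev] at h1
        exact h1 rfl
      · rw [dif_neg h1, dif_neg h2]
        exact fun h' => Γ.rev_ne e.1 (congrArg Subtype.val h')

section

variable {Γ : FinGraph} {v : Γ.V} {a b : Γ.D} (h : Γ.IsBivalent v a b)

lemma smooth_rev_of_eq_left (e : (Γ.smooth h).D) (he : Γ.rev e.1 = a) :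
    (Γ.smooth h).rev e = ⟨Γ.rev b, h.symm.tgt_ne⟩ := dif_pos he

lemma smooth_rev_of_eq_right (e : (Γ.smooth h).D) (he : Γ.rev e.1 = b) :
    (Γ.smooth h).rev e = ⟨Γ.rev a, h.tgt_ne⟩ :=
  (dif_neg fun h' => h.ne (h'.symm.trans he)).trans (dif_pos he)

lemma smooth_rev_of_ne (e : (Γ.smooth h).D) (h1 : Γ.rev e.1 ≠ a) (h2 : Γ.rev e.1 ≠ b) :
    ((Γ.smooth h).rev e).1 = Γ.rev e.1 :=
  congrArg Subtype.val (a₂ := ⟨Γ.rev e.1, fun h' => ((h.src_eq_iff _).1 h').elim h1 h2⟩)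
    ((dif_neg h1).trans (dif_neg h2))

/-- The edge of `Γ` corresponding to an edge of the subdivision of `Γ.smooth h`. -/
def smoothFun : ((Γ.smooth h).subdivide ⟨Γ.rev a, h.tgt_ne⟩).D → Γ.D :=
  Sum.elim Subtype.val (fun c => if c then b else a)

open Classical in
/-- Subdividing the new edge of `Γ.smooth h` gives `Γ` back. -/
noncomputable def smoothIso :
    Iso ((Γ.smooth h).subdivide ⟨Γ.rev a, h.tgt_ne⟩) Γ where
  onV := Equiv.ofBijective (fun x : Option {u : Γ.V // u ≠ v} => x.elim v Subtype.val) (by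
    constructor
    · rintro (_ | x) (_ | y) hxy
      · rfl
      · exact (y.2 hxy.symm).elim
      · exact (x.2 hxy).elim
      · exact congrArg some (Subtype.ext hxy)
    · intro u
      by_cases hu : u = v
      · exact ⟨none, hu.symm⟩
      · exact ⟨some ⟨u, hu⟩, rfl⟩)
  onD := Equiv.ofBijective (smoothFun h) (by
      have ha : Γ.src a = v := (h.src_eq_iff a).2 (Or.inl rfl)
      have hb : Γ.src b = v := (h.src_eq_iff b).2 (Or.inr rfl)
      constructor
      · rintro (e | c) (e' | c') hh
        · exact congrArg Sum.inl (Subtype.ext hh)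
        · have hh : e.1 = if c' then b else a := hh
          refine (e.2 ?_).elim
          rw [hh]; split_ifs <;> assumption
        · have hh : (if c then b else a) = e'.1 := hh
          refine (e'.2 ?_).elim
          rw [← hh]; split_ifs <;> assumption
        · cases c <;> cases c'
          · rfl
          · exact (h.ne hh).elim
          · exact (h.ne (Eq.symm hh)).elim
          · rfl
      · intro e
        by_cases he : Γ.src e = v
        · rcases (h.src_eq_iff e).1 he with rfl | rfl
          · exact ⟨Sum.inr false, rfl⟩
          · exact ⟨Sum.inr true, rfl⟩
        · exact ⟨Sum.inl ⟨e, he⟩, rfl⟩)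
  src_onD := by
    rintro (e | c)
    · rfl
    · cases c
      · exact (h.src_eq_iff a).2 (Or.inl rfl)
      · exact (h.src_eq_iff b).2 (Or.inr rfl)
  rev_onD := by
    have hra : (Γ.smooth h).rev ⟨Γ.rev a, h.tgt_ne⟩ = ⟨Γ.rev b, h.symm.tgt_ne⟩ :=
      smooth_rev_of_eq_left h _ (Γ.rev_rev a)
    rintro (e | c)
    · by_cases h1 : e = ⟨Γ.rev a, h.tgt_ne⟩
      · subst h1
        exact (Γ.rev_rev a).trans (congrArg (smoothFun h) (subdivide_rev_inl_self ..)).symm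
      · by_cases h2 : e = (Γ.smooth h).rev ⟨Γ.rev a, h.tgt_ne⟩
        · subst h2
          refine Eq.trans ?_ (congrArg (smoothFun h) (subdivide_rev_inl_rev ..)).symm
          exact (congrArg (fun x => Γ.rev x.1) hra).trans (Γ.rev_rev b)
        · refine Eq.trans ?_ (congrArg (smoothFun h) (subdivide_rev_inl _ h1 h2)).symm
          rw [hra] at h2
          refine (smooth_rev_of_ne h e (fun h' => h1 ?_) fun h' => h2 ?_).symm
          · exact Subtype.ext (rev_eq_iff.1 h')
          · exact Subtype.ext (rev_eq_iff.1 h')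
    · cases c
      · rfl
      · exact (congrArg Subtype.val hra).symm

end

/-! ### Recognizing cactus graphs -/

/-- A labelling of the oriented edges by `2n` labels such that at every vertex each label occurs as
often as the opposite label, on a graph of rank at most `n`. -/
structure IsCactusLabel (Γ : FinGraph) {X : Type*} (ν : X → X) (n : ℕ) (ℓ : Γ.D → X) : Prop where
  rev : ∀ d, ℓ (Γ.rev d) = ν (ℓ d)
  ne : ∀ d, ν (ℓ d) ≠ ℓ d
  ncard_range : (Set.range ℓ).ncard = 2 * n
  balanced : ∀ v x, {d | Γ.src d = v ∧ ℓ d = x}.ncard = {d | Γ.src d = v ∧ ℓ d = ν x}.ncard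
  card_le : Nat.card Γ.D + 2 ≤ 2 * Nat.card Γ.V + 2 * n
  connected : Γ.IsConnected

namespace IsCactusLabel

variable {Γ : FinGraph} {X : Type*} {ν : X → X} {n : ℕ} {ℓ : Γ.D → X}

/-- Modulo 2, the contributions of a label and of its opposite cancel, and no label is its own
opposite. -/
lemma even_valence (h : Γ.IsCactusLabel ν n ℓ) (hν : Function.Involutive ν) (v : Γ.V) :
    Even (Γ.valence v) := by
  classical
  rw [← ZMod.natCast_eq_zero_iff_even, CollapseMap.valence_eq,
    Set.ncard_eq_toFinset_card' {d | Γ.src d = v}]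
  have hs := Finset.card_eq_sum_card_image ℓ ({d | Γ.src d = v} : Set Γ.D).toFinset
  have hf : ∀ x, ((({d | Γ.src d = v} : Set Γ.D).toFinset).filter fun d => ℓ d = x).card =
      {d | Γ.src d = v ∧ ℓ d = x}.ncard := fun x => by
    rw [Set.ncard_eq_toFinset_card']
    congr 1
    ext d
    simp
  rw [hs, Nat.cast_sum]
  refine Finset.sum_involution (fun x _ => ν x) ?_ ?_ ?_ ?_
  · intro x _
    rw [hf, hf, ← h.balanced]
    exact CharTwo.add_self_eq_zero _
  · intro x hx _
    obtain ⟨d, -, rfl⟩ := Finset.mem_image.1 hx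
    exact h.ne d
  · intro x hx
    obtain ⟨d, hd, rfl⟩ := Finset.mem_image.1 hx
    have h1 : {e | Γ.src e = v ∧ ℓ e = ℓ d}.Nonempty := ⟨d, by simpa using hd, rfl⟩
    rw [← Set.ncard_pos, h.balanced, Set.ncard_pos] at h1
    obtain ⟨e, he, he'⟩ := h1
    exact Finset.mem_image.2 ⟨e, by simpa using he, he'⟩
  · intro x _
    exact hν x

lemma four_le_valence (h : Γ.IsCactusLabel ν n ℓ) (hν : Function.Involutive ν)
    (h3 : ∀ v, 3 ≤ Γ.valence v) (v : Γ.V) : 4 ≤ Γ.valence v := by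
  obtain ⟨k, hk⟩ := h.even_valence hν v
  have := h3 v
  omega

lemma four_mul_card_le (h : Γ.IsCactusLabel ν n ℓ) (hν : Function.Involutive ν)
    (h3 : ∀ v, 3 ≤ Γ.valence v) : 4 * Nat.card Γ.V ≤ Nat.card Γ.D := by
  classical
  have hs := Finset.card_eq_sum_card_fiberwise (f := Γ.src) (s := Finset.univ)
    (t := Finset.univ) fun _ _ => Finset.mem_coe.2 (Finset.mem_univ _)
  rw [Nat.card_eq_fintype_card, Nat.card_eq_fintype_card, ← Finset.card_univ (α := Γ.D), hs,
    mul_comm, ← Finset.card_univ, ← smul_eq_mul]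
  refine Finset.card_nsmul_le_sum _ _ _ fun v _ => (h.four_le_valence hν h3 v).trans_eq ?_
  rw [CollapseMap.valence_eq, Set.ncard_eq_toFinset_card']
  congr 1
  ext d
  simp

/-- Combining 4|V| ≤ |D| with |D| + 2 ≤ 2|V| + 2n gives |V| ≤ n - 1. This is the source of the
dimension n - 2. -/
lemma card_V_lt (h : Γ.IsCactusLabel ν n ℓ) (hν : Function.Involutive ν)
    (h3 : ∀ v, 3 ≤ Γ.valence v) : Nat.card Γ.V < n := by
  have := h.four_mul_card_le hν h3
  have := h.card_le
  omega

/-- If each of the 2n labels occurred twice, then 4n ≤ |D|, and with 4|V| ≤ |D| this contradicts |D|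
+ 2 ≤ 2|V| + 2n. So some label is carried by one oriented edge `d` only. By balance an edge with the
opposite label leaves the source of `d`; its reversal has the label of `d`, so it is `d`, which
therefore is a loop. -/
lemma exists_loop (h : Γ.IsCactusLabel ν n ℓ) (hν : Function.Involutive ν)
    (h3 : ∀ v, 3 ≤ Γ.valence v) :
    ∃ d, (∀ e, ℓ e = ℓ d → e = d) ∧ Γ.tgt d = Γ.src d := by
  classical
  obtain ⟨d, hd⟩ : ∃ d, ∀ e, ℓ e = ℓ d → e = d := by
    by_contra! H
    have h4 := h.four_mul_card_le hν h3
    have hc := h.card_le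
    have hs := Finset.card_eq_sum_card_image ℓ (Finset.univ : Finset Γ.D)
    have h2 : (Finset.univ.image ℓ).card • 2 ≤ (Finset.univ : Finset Γ.D).card := by
      rw [hs]
      refine Finset.card_nsmul_le_sum _ _ _ fun x hx => ?_
      obtain ⟨d, -, rfl⟩ := Finset.mem_image.1 hx
      obtain ⟨e, he, hne⟩ := H d
      exact Finset.one_lt_card.2 ⟨e, by simpa using he, d, by simp, hne⟩
    have h5 : (Finset.univ.image ℓ).card = 2 * n := by
      rw [← h.ncard_range, ← Set.ncard_coe_finset]
      simp
    rw [h5, Finset.card_univ, ← Nat.card_eq_fintype_card, smul_eq_mul] at h2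
    omega
  refine ⟨d, hd, ?_⟩
  have h1 : {e | Γ.src e = Γ.src d ∧ ℓ e = ℓ d}.Nonempty := ⟨d, rfl, rfl⟩
  rw [← Set.ncard_pos, h.balanced, Set.ncard_pos] at h1
  obtain ⟨e, he, he'⟩ := h1
  have h2 : Γ.rev e = d := hd _ (by rw [h.rev, he', hν])
  rw [← h2, tgt_rev, he, h2]

lemma removeEdge (h : Γ.IsCactusLabel ν (n + 1) ℓ) (hν : Function.Involutive ν) {d : Γ.D}
    (hd : ∀ e, ℓ e = ℓ d → e = d) (hl : Γ.tgt d = Γ.src d) :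
    (Γ.removeEdge d).IsCactusLabel ν n fun e => ℓ e.1 where
  rev e := h.rev e.1
  ne e := h.ne e.1
  ncard_range := by
    have hd' : ∀ e, ℓ e = ν (ℓ d) → e = Γ.rev d := fun e he => by
      rw [← rev_eq_iff]; exact hd _ (by rw [h.rev, he, hν])
    have h1 : Set.range (fun e : (Γ.removeEdge d).D => ℓ e.1) =
        Set.range ℓ \ {ℓ d, ν (ℓ d)} := by
      ext x
      constructor
      · rintro ⟨e, rfl⟩
        refine ⟨⟨e.1, rfl⟩, ?_⟩
        rintro (h1 | h1)
        · exact e.2.1 (hd _ h1)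
        · exact e.2.2 (hd' _ h1)
      · rintro ⟨⟨e, rfl⟩, he⟩
        refine ⟨⟨e, fun h1 => he (Or.inl (by rw [h1])), fun h1 => he (Or.inr ?_)⟩, rfl⟩
        rw [h1, h.rev]; rfl
    have h2 := Set.ncard_sdiff_add_ncard_of_subset (s := {ℓ d, ν (ℓ d)}) (t := Set.range ℓ)
      (by rintro x (rfl | rfl); exacts [⟨d, rfl⟩, ⟨Γ.rev d, h.rev d⟩]) (Set.finite_range _)
    rw [Set.ncard_pair (h.ne d).symm, h.ncard_range] at h2
    rw [h1]
    omega
  balanced v x := by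
    classical
    have hd' : ∀ e, ℓ e = ν (ℓ d) → e = Γ.rev d := fun e he => by
      rw [← rev_eq_iff]; exact hd _ (by rw [h.rev, he, hν])
    have key : ∀ x, {e : (Γ.removeEdge d).D | (Γ.removeEdge d).src e = v ∧ ℓ e.1 = x}.ncard =
        if x = ℓ d ∨ x = ν (ℓ d) then 0 else {e | Γ.src e = v ∧ ℓ e = x}.ncard := fun x => by
      split_ifs with hx
      · rw [Set.ncard_eq_zero (Set.toFinite _)]
        refine Set.eq_empty_of_forall_notMem fun e he => ?_
        rcases hx with rfl | rfl
        · exact e.2.1 (hd _ he.2)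
        · exact e.2.2 (hd' _ he.2)
      · rw [← Set.ncard_image_of_injective _
          (Subtype.val_injective : Function.Injective (Subtype.val : (Γ.removeEdge d).D → Γ.D))]
        congr 1
        ext e
        constructor
        · rintro ⟨e, he, rfl⟩
          exact he
        · rintro ⟨h1, h2⟩
          refine ⟨⟨e, ?_, ?_⟩, ⟨h1, h2⟩, rfl⟩
          · rintro rfl
            exact hx (Or.inl h2.symm)
          · rintro rfl
            exact hx (Or.inr (by rw [← h2, h.rev]))
    rw [key, key, h.balanced]
    have : (ν x = ℓ d ∨ ν x = ν (ℓ d)) ↔ (x = ℓ d ∨ x = ν (ℓ d)) := by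
      rw [hν.injective.eq_iff, or_comm, hν.eq_iff]
    simp only [this]
  card_le := by
    have h1 : (Set.univ : Set Γ.D).ncard = ({d, Γ.rev d} : Set Γ.D)ᶜ.ncard + 2 := by
      rw [← Set.ncard_pair (Γ.rev_ne d).symm, Set.compl_eq_univ_sdiff,
        Set.ncard_sdiff_add_ncard_of_subset (Set.subset_univ _) (Set.toFinite _)]
    have h2 : Nat.card (Γ.removeEdge d).D = ({d, Γ.rev d} : Set Γ.D)ᶜ.ncard := by
      rw [← Nat.card_coe_set_eq]
      refine Nat.card_congr (Equiv.subtypeEquivRight fun e => ?_)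
      simp
    have h3 := h.card_le
    rw [Set.ncard_univ] at h1
    have h4 : Nat.card (Γ.removeEdge d).V = Nat.card Γ.V := rfl
    omega
  connected := by
    refine h.connected.of_adj (Γ.removeEdge d).equivalence_joined id fun e => ?_
    by_cases h1 : e = d
    · subst h1; rw [hl]; exact ⟨[], rfl⟩
    · by_cases h2 : e = Γ.rev d
      · subst h2; rw [tgt_rev, src_rev, hl]; exact ⟨[], rfl⟩
      · exact ⟨[⟨e, h1, h2⟩], rfl, rfl⟩

/-- Balance at the bivalent vertex makes the labels of `a` and `b` opposite, so the two edges merge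
into one consistently labelled edge. One edge and one vertex disappear, which preserves the Euler
characteristic. -/
lemma smooth (h : Γ.IsCactusLabel ν n ℓ) (hν : Function.Involutive ν) {v : Γ.V} {a b : Γ.D}
    (hv : Γ.IsBivalent v a b) : (Γ.smooth hv).IsCactusLabel ν n fun e => ℓ e.1 := by
  have hab : ℓ b = ν (ℓ a) := by
    have h1 : {e | Γ.src e = v ∧ ℓ e = ℓ a}.Nonempty :=
      ⟨a, (hv.src_eq_iff a).2 (Or.inl rfl), rfl⟩
    rw [← Set.ncard_pos, h.balanced, Set.ncard_pos] at h1
    obtain ⟨e, he, he'⟩ := h1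
    rcases (hv.src_eq_iff e).1 he with rfl | rfl
    · exact (h.ne _ he'.symm).elim
    · exact he'
  have hab' : ℓ a = ν (ℓ b) := by rw [hab, hν]
  refine ⟨fun e => ?_, fun e => h.ne e.1, ?_, ?_, ?_, fun x y => ?_⟩
  · by_cases h1 : Γ.rev e.1 = a
    · rw [smooth_rev_of_eq_left hv e h1, ← h.rev, h1, h.rev, hab']
    · by_cases h2 : Γ.rev e.1 = b
      · rw [smooth_rev_of_eq_right hv e h2, ← h.rev, h2, h.rev, hab]
      · rw [smooth_rev_of_ne hv e h1 h2, h.rev]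
  · rw [← h.ncard_range]
    congr 1
    ext x
    constructor
    · rintro ⟨e, rfl⟩
      exact ⟨e.1, rfl⟩
    · rintro ⟨e, rfl⟩
      by_cases he : Γ.src e = v
      · rcases (hv.src_eq_iff e).1 he with rfl | rfl
        · exact ⟨⟨Γ.rev b, hv.symm.tgt_ne⟩, by simp only [h.rev, hab']⟩
        · exact ⟨⟨Γ.rev a, hv.tgt_ne⟩, by simp only [h.rev, hab]⟩
      · exact ⟨⟨e, he⟩, rfl⟩
  · intro u x
    have key : ∀ x, {e : (Γ.smooth hv).D | (Γ.smooth hv).src e = u ∧ ℓ e.1 = x}.ncard =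
        {e | Γ.src e = u.1 ∧ ℓ e = x}.ncard := fun x => by
      rw [← Set.ncard_image_of_injective _
        (Subtype.val_injective : Function.Injective (Subtype.val : (Γ.smooth hv).D → Γ.D))]
      congr 1
      ext e
      constructor
      · rintro ⟨e, he, rfl⟩
        exact ⟨congrArg Subtype.val he.1, he.2⟩
      · rintro ⟨h1, h2⟩
        exact ⟨⟨e, h1 ▸ u.2⟩, ⟨Subtype.ext h1, h2⟩, rfl⟩
    rw [key, key, h.balanced]
  · have h1 : Nat.card (Γ.smooth hv).D + 2 = Nat.card Γ.D := by
      have e : Nat.card (Γ.smooth hv).D = ({a, b} : Set Γ.D)ᶜ.ncard := by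
        rw [← Nat.card_coe_set_eq]
        refine Nat.card_congr (Equiv.subtypeEquivRight fun e => ?_)
        rw [Ne, hv.src_eq_iff]
        simp
      rw [e, ← Set.ncard_pair hv.ne, Set.compl_eq_univ_sdiff,
        Set.ncard_sdiff_add_ncard_of_subset (Set.subset_univ _) (Set.toFinite _),
        Set.ncard_univ]
    have h2 : Nat.card (Γ.smooth hv).V + 1 = Nat.card Γ.V := by
      have e : Nat.card (Γ.smooth hv).V = ({v} : Set Γ.V)ᶜ.ncard := by
        rw [← Nat.card_coe_set_eq]
        exact Nat.card_congr (Equiv.subtypeEquivRight fun e => by simp)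
      rw [e, ← Set.ncard_singleton v, Set.compl_eq_univ_sdiff,
        Set.ncard_sdiff_add_ncard_of_subset (Set.subset_univ _) (Set.toFinite _),
        Set.ncard_univ]
    have := h.card_le
    omega
  · classical
    -- The erased vertex is slid along `a` to its other end.
    set f : Γ.V → (Γ.smooth hv).V := fun u =>
      if hu : u = v then ⟨Γ.src (Γ.rev a), hv.tgt_ne⟩ else ⟨u, hu⟩
    have hf : ∀ u : (Γ.smooth hv).V, f u.1 = u := fun u => dif_neg u.2
    have key : ∀ d, Γ.src d ≠ v → ∃ l, (Γ.smooth hv).IsWalk (f (Γ.src d)) (f (Γ.tgt d)) l := by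
      intro d hd
      have h0 : f (Γ.src d) = ⟨Γ.src d, hd⟩ := dif_neg hd
      by_cases hd' : Γ.tgt d = v
      · have h1 : f (Γ.tgt d) = ⟨Γ.src (Γ.rev a), hv.tgt_ne⟩ := dif_pos hd'
        rcases (hv.src_eq_iff (Γ.rev d)).1 hd' with h2 | h2
        · have h3 : d = Γ.rev a := rev_eq_iff.1 h2
          subst h3
          rw [h0, h1]
          exact ⟨[], rfl⟩
        · have h3 : d = Γ.rev b := rev_eq_iff.1 h2
          subst h3
          rw [h0, h1]
          refine ⟨[⟨Γ.rev b, hd⟩], rfl, ?_⟩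
          change (Γ.smooth hv).src ((Γ.smooth hv).rev ⟨Γ.rev b, hd⟩) = _
          rw [smooth_rev_of_eq_right hv _ h2]
      · have h1 : f (Γ.tgt d) = ⟨Γ.tgt d, hd'⟩ := dif_neg hd'
        rw [h0, h1]
        refine ⟨[⟨d, hd⟩], rfl, Subtype.ext ?_⟩
        change Γ.src ((Γ.smooth hv).rev ⟨d, hd⟩).1 = _
        rw [smooth_rev_of_ne hv]
        · rfl
        · exact fun h' => hd' ((hv.src_eq_iff _).2 (Or.inl h'))
        · exact fun h' => hd' ((hv.src_eq_iff _).2 (Or.inr h'))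
    have := h.connected.of_adj (Γ.smooth hv).equivalence_joined f (fun d => by
      by_cases hd : Γ.src d = v
      · by_cases hd' : Γ.tgt d = v
        · rw [hd, hd']; exact ⟨[], rfl⟩
        · have := key (Γ.rev d) hd'
          rw [src_rev, tgt_rev] at this
          exact (Γ.smooth hv).equivalence_joined.symm this
      · exact key d hd) x.1 y.1
    rwa [hf, hf] at this

end IsCactusLabel

/-- Induction on the rank, undoing one gluing at a time. The bare circle is listed separately
because its vertex has valence 2, yet it can be what remains after a loop has been removed. -/
theorem IsCactusLabel.isCactus {X : Type*} {ν : X → X} (hν : Function.Involutive ν) {n : ℕ} :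
    ∀ {Γ : FinGraph} {ℓ : Γ.D → X}, Γ.IsCactusLabel ν n ℓ →
      ((∀ v, 3 ≤ Γ.valence v) ∨ (Nat.card Γ.V = 1 ∧ Nat.card Γ.D = 2)) → IsCactus n Γ := by
  induction n with
  | zero =>
    -- Without labels there are no edges, while the bound on |D| requires a vertex; neither
    -- alternative allows this.
    intro Γ ℓ h h3
    have hD : Nat.card Γ.D = 0 := by
      have := h.ncard_range
      rw [mul_zero, Set.ncard_eq_zero (Set.finite_range _), Set.range_eq_empty_iff] at this
      exact Nat.card_of_isEmpty
    rcases h3 with h3 | h3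
    · have := h.four_mul_card_le hν h3
      have := h.card_le
      omega
    · omega
  | succ n ih =>
    intro Γ ℓ h h3
    by_cases hc : Nat.card Γ.V = 1 ∧ Nat.card Γ.D = 2
    · have h1 := h.ncard_range
      have h2 : (Set.range ℓ).ncard ≤ Nat.card Γ.D := by
        rw [← Set.image_univ, ← Set.ncard_univ]
        exact Set.ncard_image_le
      obtain rfl : n = 0 := by omega
      exact .circle Γ hc.1 hc.2
    replace h3 := h3.resolve_right hc
    have h4 := h.four_le_valence hν h3
    obtain ⟨d, hd, hl⟩ := h.exists_loop hν h3
    have h' := h.removeEdge hν hd hl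
    have hval : ∀ u, u ≠ Γ.src d → (Γ.removeEdge d).valence u = Γ.valence u := fun u hu => by
      rw [CollapseMap.valence_eq, CollapseMap.valence_eq, ← Set.ncard_image_of_injective _
        (Subtype.val_injective : Function.Injective (Subtype.val : (Γ.removeEdge d).D → Γ.D))]
      congr 1
      ext e
      constructor
      · rintro ⟨e, he, rfl⟩
        exact he
      · intro he
        refine ⟨⟨e, ?_, ?_⟩, he, rfl⟩
        · rintro rfl
          exact hu he.symm
        · rintro rfl
          exact hu (he.symm.trans hl)
    have hvalv : (Γ.removeEdge d).valence (Γ.src d) + 2 = Γ.valence (Γ.src d) := by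
      rw [CollapseMap.valence_eq, CollapseMap.valence_eq, ← Set.ncard_image_of_injective _
        (Subtype.val_injective : Function.Injective (Subtype.val : (Γ.removeEdge d).D → Γ.D)),
        ← Set.ncard_pair (Γ.rev_ne d).symm, ← Set.ncard_sdiff_add_ncard_of_subset
          (s := {d, Γ.rev d}) (t := {e | Γ.src e = Γ.src d}) (by
            rintro e (rfl | rfl)
            · rfl
            · exact hl) (Set.toFinite _)]
      congr 2
      ext e
      constructor
      · rintro ⟨e, he, rfl⟩
        exact ⟨he, fun h' => h'.elim e.2.1 e.2.2⟩
      · rintro ⟨he, he'⟩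
        exact ⟨⟨e, fun h => he' (Or.inl h), fun h => he' (Or.inr h)⟩, he, rfl⟩
    by_cases h5 : 3 ≤ (Γ.removeEdge d).valence (Γ.src d)
    · refine .glueAtVertex n (Γ.removeEdge d) Γ (ih h' (Or.inl fun u => ?_)) (Γ.src d)
        ⟨Γ.removeEdgeIso d hl⟩
      by_cases hu : u = Γ.src d
      · rw [hu]; exact h5
      · rw [hval u hu]; exact h3 u
    -- The valence was at least 4 and has dropped by 2.
    · have h6 : (Γ.removeEdge d).valence (Γ.src d) = 2 := by
        have := h4 (Γ.src d)
        omega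
      rw [CollapseMap.valence_eq, Set.ncard_eq_two] at h6
      obtain ⟨a, b, hab, hs⟩ := h6
      have hs' : ∀ e, (Γ.removeEdge d).src e = Γ.src d ↔ e = a ∨ e = b := fun e => by
        change e ∈ {e | (Γ.removeEdge d).src e = Γ.src d} ↔ _
        rw [hs]; rfl
      by_cases hr : (Γ.removeEdge d).rev a = b
      -- The two remaining edges are the orientations of one loop, so no edge leads away from the
      -- vertex, and by connectedness the rest is a bare circle.
      · have hV : ∀ u v : (Γ.removeEdge d).V, (u = Γ.src d) = (v = Γ.src d) := by
          refine h'.connected.of_adj (r := fun p q : Prop => p = q) eq_equivalence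
            (fun u => u = Γ.src d) fun e => ?_
          have key : ∀ e, (Γ.removeEdge d).src e = Γ.src d →
              (Γ.removeEdge d).tgt e = Γ.src d := fun e he => by
            refine (hs' _).2 ?_
            rcases (hs' e).1 he with rfl | rfl
            · exact Or.inr hr
            · exact Or.inl (by rw [← hr, rev_rev])
          refine propext ⟨key e, fun h => ?_⟩
          have := key ((Γ.removeEdge d).rev e) h
          rwa [tgt_rev] at this
        have hV' : ∀ u : (Γ.removeEdge d).V, u = Γ.src d := fun u =>
          (hV (Γ.src d) u).mp rfl
        refine .glueAtVertex n (Γ.removeEdge d) Γ (ih h' (Or.inr ⟨?_, ?_⟩)) (Γ.src d)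
          ⟨Γ.removeEdgeIso d hl⟩
        · rw [Nat.card_eq_one_iff_unique]
          exact ⟨⟨fun u v => (hV' u).trans (hV' v).symm⟩, ⟨Γ.src d⟩⟩
        · rw [← Set.ncard_univ, ← Set.ncard_pair hab, ← hs]
          congr 1
          ext e
          simp only [Set.mem_univ, true_iff]
          exact hV' _
      -- Here the loop was glued to an interior point of an edge, which smoothing recovers.
      · have hb : (Γ.removeEdge d).IsBivalent (Γ.src d) a b := ⟨hab, hs', hr⟩
        refine .glueInEdge n ((Γ.removeEdge d).smooth hb) Γ
          (ih (h'.smooth hν hb) (Or.inl fun u => ?_)) ⟨(Γ.removeEdge d).rev a, hb.tgt_ne⟩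
          ⟨((smoothIso hb).addLoop none).trans (Γ.removeEdgeIso d hl)⟩
        have : ((Γ.removeEdge d).smooth hb).valence u = (Γ.removeEdge d).valence u.1 := by
          rw [CollapseMap.valence_eq, CollapseMap.valence_eq, ← Set.ncard_image_of_injective _
            (Subtype.val_injective : Function.Injective
              (Subtype.val : ((Γ.removeEdge d).smooth hb).D → (Γ.removeEdge d).D))]
          congr 1
          ext e
          constructor
          · rintro ⟨e, he, rfl⟩
            exact congrArg Subtype.val he
          · intro he
            exact ⟨⟨e, he.symm ▸ u.2⟩, Subtype.ext he, rfl⟩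
        rw [this, hval u.1 u.2]
        exact h3 _

end FinGraph

namespace FinGraph

/-! ### Flows on cactus graphs -/

open Classical in
lemma isFlow_comp_onD {Γ Δ : FinGraph} (h : Iso Γ Δ) {w : Δ.D → ℤ} (hw : Δ.IsFlow w) :
    Γ.IsFlow (w ∘ h.onD) where
  rev d := by simp [← h.rev_onD, hw.rev]
  sum_eq_zero v := by
    refine Eq.trans ?_ (hw.sum_eq_zero (h.onV v))
    rw [← Equiv.sum_comp h.onD]
    refine Finset.sum_congr rfl fun d _ => ?_
    simp only [h.src_onD, h.onV.injective.eq_iff, Function.comp_apply]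

lemma sum_addLoop (Γ : FinGraph) (p : Γ.V) (f : (Γ.addLoop p).D → ℤ) :
    ∑ d, f d = ∑ d : Γ.D, f (Sum.inl d) + (f (Sum.inr true) + f (Sum.inr false)) := by
  rw [← Fintype.sum_bool (fun b => f (Sum.inr b))]
  exact (@Fintype.sum_equiv (Γ.addLoop p).D (Γ.D ⊕ Bool) ℤ _ _ _ (Equiv.refl _) f f
    fun _ => rfl).trans (Fintype.sum_sum_type (fun d : Γ.D ⊕ Bool => f d))

lemma sum_subdivide (Γ : FinGraph) (d : Γ.D) (f : (Γ.subdivide d).D → ℤ) :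
    ∑ e, f e = ∑ e : Γ.D, f (Sum.inl e) + (f (Sum.inr true) + f (Sum.inr false)) := by
  rw [← Fintype.sum_bool (fun b => f (Sum.inr b))]
  exact (@Fintype.sum_equiv (Γ.subdivide d).D (Γ.D ⊕ Bool) ℤ _ _ _ (Equiv.refl _) f f
    fun _ => rfl).trans (Fintype.sum_sum_type (fun d : Γ.D ⊕ Bool => f d))

/-- A loop imposes no condition at its vertex, since its two orientations cancel there. -/
lemma isFlow_addLoop (Γ : FinGraph) (p : Γ.V) (w : (Γ.addLoop p).D → ℤ) :
    (Γ.addLoop p).IsFlow w ↔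
      Γ.IsFlow (fun d => w (Sum.inl d)) ∧ w (Sum.inr true) = -w (Sum.inr false) := by
  classical
  have hsum : ∀ v : Γ.V, ∑ e, (if (Γ.addLoop p).src e = v then w e else 0) =
      ∑ e, (if Γ.src e = v then w (Sum.inl e) else 0) +
        (if p = v then w (Sum.inr true) + w (Sum.inr false) else 0) := fun v => by
    refine (sum_addLoop Γ p _).trans (congrArg _ ?_)
    change (if p = v then w (Sum.inr true) else 0) + (if p = v then w (Sum.inr false) else 0) = _
    by_cases hp : p = v
    · simp only [hp, if_true]
    · simp only [hp, if_false, add_zero]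
  constructor
  · intro h
    have h1 : w (Sum.inr true) = -w (Sum.inr false) := h.rev (Sum.inr false)
    refine ⟨⟨fun d => h.rev (Sum.inl d), fun v => ?_⟩, h1⟩
    have := (hsum v).symm.trans (h.sum_eq_zero v)
    rwa [h1, neg_add_cancel, ite_self, add_zero] at this
  · rintro ⟨h, h1⟩
    refine ⟨?_, fun v => ?_⟩
    · rintro (d | b)
      · exact h.rev d
      · cases b
        · exact h1
        · exact eq_neg_iff_add_eq_zero.2 (by rw [h1]; exact add_neg_cancel _)
    · refine (hsum v).trans ?_
      rw [h1, neg_add_cancel, ite_self, add_zero]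
      exact h.sum_eq_zero v

/-- Conservation at the new vertex forces both halves of the edge to carry the same flow. -/
lemma isFlow_subdivide (Γ : FinGraph) (d : Γ.D) (w : (Γ.subdivide d).D → ℤ) :
    (Γ.subdivide d).IsFlow w ↔ Γ.IsFlow (fun d => w (Sum.inl d)) ∧
      w (Sum.inr false) = -w (Sum.inl d) ∧ w (Sum.inr true) = w (Sum.inl d) := by
  classical
  have hsum : ∀ v : Γ.V, ∑ e, (if (Γ.subdivide d).src e = some v then w e else 0) =
      ∑ e, (if Γ.src e = v then w (Sum.inl e) else 0) := fun v => by
    rw [sum_subdivide]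
    simp [subdivide]
  have hsum' : ∑ e, (if (Γ.subdivide d).src e = none then w e else 0) =
      w (Sum.inr true) + w (Sum.inr false) := by
    rw [sum_subdivide]
    simp [subdivide]
  constructor
  · intro h
    have h1 : w (Sum.inr false) = -w (Sum.inl d) :=
      (congrArg w (subdivide_rev_inl_self Γ d)).symm.trans (h.rev (Sum.inl d))
    have h2 : w (Sum.inr true) = -w (Sum.inl (Γ.rev d)) :=
      (congrArg w (subdivide_rev_inl_rev Γ d)).symm.trans (h.rev (Sum.inl (Γ.rev d)))
    have h3 : w (Sum.inr true) + w (Sum.inr false) = 0 := by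
      rw [← hsum']; exact h.sum_eq_zero none
    have h4 : w (Sum.inl (Γ.rev d)) = -w (Sum.inl d) := by omega
    refine ⟨⟨fun e => ?_, fun v => ?_⟩, h1, by omega⟩
    · by_cases he : e = d
      · subst he; exact h4
      · by_cases he' : e = Γ.rev d
        · subst he'; simp only [Γ.rev_rev]; omega
        · exact (congrArg w (subdivide_rev_inl Γ he he')).symm.trans (h.rev (Sum.inl e))
    · rw [← hsum]; exact h.sum_eq_zero (some v)
  · rintro ⟨h, h1, h2⟩
    have h4 : w (Sum.inl (Γ.rev d)) = -w (Sum.inl d) := h.rev d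
    refine ⟨?_, ?_⟩
    · rintro (e | b)
      · by_cases he : e = d
        · subst he; rw [subdivide_rev_inl_self]; exact h1
        · by_cases he' : e = Γ.rev d
          · subst he'; rw [subdivide_rev_inl_rev]; omega
          · rw [subdivide_rev_inl _ he he']; exact h.rev e
      · cases b
        · change w (Sum.inl d) = _; omega
        · change w (Sum.inl (Γ.rev d)) = _; omega
    · rintro (_ | v)
      · refine hsum'.trans ?_; omega
      · exact (hsum v).trans (h.sum_eq_zero v)

/-- All flows agree up to a fixed sign on the edges `d` and `e`. -/
def Homologous (Γ : FinGraph) (d e : Γ.D) : Prop :=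
  (∀ w, Γ.IsFlow w → w e = w d) ∨ (∀ w, Γ.IsFlow w → w e = -w d)

lemma Homologous.rev_right {Γ : FinGraph} {d e : Γ.D} (h : Γ.Homologous d e) :
    Γ.Homologous d (Γ.rev e) :=
  h.symm.imp (fun h w hw => by rw [hw.rev, h w hw, neg_neg]) fun h w hw => by
    rw [hw.rev, h w hw]

lemma Homologous.rev_left {Γ : FinGraph} {d e : Γ.D} (h : Γ.Homologous d e) :
    Γ.Homologous (Γ.rev d) e :=
  h.symm.imp (fun h w hw => by rw [hw.rev, h w hw]) fun h w hw => by
    rw [hw.rev, h w hw, neg_neg]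

/-- Every edge lies on a flow whose edges are all homologous. -/
def HasCycles (Γ : FinGraph) : Prop :=
  ∀ d, ∃ z, Γ.IsFlow z ∧ z d ≠ 0 ∧ ∀ e, z e ≠ 0 → Γ.Homologous d e

lemma HasCycles.iso {Γ Δ : FinGraph} (h : Γ.HasCycles) (i : Iso Γ Δ) : Δ.HasCycles := by
  intro d
  obtain ⟨z, hz, hd, H⟩ := h (i.onD.symm d)
  refine ⟨z ∘ i.onD.symm, isFlow_comp_onD i.symm hz, hd, fun e he => ?_⟩
  refine (H _ he).imp (fun h w hw => ?_) fun h w hw => ?_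
  · simpa using h _ (isFlow_comp_onD i hw)
  · simpa using h _ (isFlow_comp_onD i hw)

lemma HasCycles.addLoop {Γ : FinGraph} (h : Γ.HasCycles) (p : Γ.V) :
    (Γ.addLoop p).HasCycles := by
  have key : ∀ {w}, (Γ.addLoop p).IsFlow w → _ := fun hw => ((Γ.isFlow_addLoop p _).1 hw)
  rintro (d | b)
  · obtain ⟨z, hz, hd, H⟩ := h d
    refine ⟨Sum.elim z 0, (Γ.isFlow_addLoop p _).2 ⟨hz, rfl⟩, hd, ?_⟩
    rintro (e | b) he
    · exact (H e he).imp (fun h w hw => h _ (key hw).1) fun h w hw => h _ (key hw).1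
    · exact (he rfl).elim
  · refine ⟨Sum.elim 0 (fun b => if b then -1 else 1), (Γ.isFlow_addLoop p _).2
      ⟨⟨fun _ => rfl, fun v => by simp⟩, rfl⟩, by cases b <;> simp, ?_⟩
    rintro (e | c) he
    · exact (he rfl).elim
    · have hb : ∀ b, (Γ.addLoop p).Homologous (Sum.inr b) (Sum.inr b) :=
        fun b => Or.inl fun _ _ => rfl
      cases b <;> cases c
      · exact hb _
      · exact (hb false).rev_right
      · exact (hb true).rev_right
      · exact hb _

lemma HasCycles.subdivide {Γ : FinGraph} (h : Γ.HasCycles) (d : Γ.D) :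
    (Γ.subdivide d).HasCycles := by
  have key : ∀ {w}, (Γ.subdivide d).IsFlow w → _ := fun hw => ((Γ.isFlow_subdivide d _).1 hw)
  have hinl : ∀ e : Γ.D, ∃ z, (Γ.subdivide d).IsFlow z ∧ z (Sum.inl e) ≠ 0 ∧
      ∀ e', z e' ≠ 0 → (Γ.subdivide d).Homologous (Sum.inl e) e' := fun e => by
    obtain ⟨z, hz, hd, H⟩ := h e
    have hH : ∀ e', z e' ≠ 0 → (Γ.subdivide d).Homologous (Sum.inl e) (Sum.inl e') :=
      fun e' he' => (H e' he').imp (fun h w hw => h _ (key hw).1) fun h w hw => h _ (key hw).1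
    refine ⟨Sum.elim z (fun b => if b then z d else -z d),
      (Γ.isFlow_subdivide d _).2 ⟨hz, rfl, rfl⟩, hd, ?_⟩
    rintro (e' | b) he'
    · exact hH e' he'
    · have hzd : z d ≠ 0 := by cases b <;> simpa using he'
      cases b
      · rw [← subdivide_rev_inl_self]
        exact (hH d hzd).rev_right
      · rw [← subdivide_rev_inl_rev]
        exact (hH _ (by simpa [hz.rev] using hzd)).rev_right
  rintro (e | b)
  · exact hinl e
  · have : ∃ e, Sum.inr b = (Γ.subdivide d).rev (Sum.inl e) := by
      cases b
      · exact ⟨d, (subdivide_rev_inl_self ..).symm⟩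
      · exact ⟨Γ.rev d, (subdivide_rev_inl_rev ..).symm⟩
    obtain ⟨e, he⟩ := this
    obtain ⟨z, hz, h1, h2⟩ := hinl e
    rw [he]
    exact ⟨z, hz, (hz.rev (Sum.inl e)).trans_ne (neg_ne_zero.2 h1), fun e' he' => (h2 e' he').rev_left⟩

/-- The flow in question runs once around the circle of the cactus that contains the edge; gluing
another circle extends it by zero, and subdividing an edge keeps it. -/
lemma IsCactus.hasCycles {n : ℕ} {Γ : FinGraph} (h : IsCactus n Γ) : Γ.HasCycles := by
  classical
  induction h with
  | circle Δ hV hD =>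
    intro d
    have : Subsingleton Δ.V := (Nat.card_eq_one_iff_unique.1 hV).1
    have hall : ∀ e, e = d ∨ e = Δ.rev d := fun e => by
      have h1 : ({d, Δ.rev d} : Set Δ.D) = Set.univ := by
        refine Set.eq_of_subset_of_ncard_le (Set.subset_univ _) ?_ (Set.toFinite _)
        rw [Set.ncard_univ, hD, Set.ncard_pair (Δ.rev_ne d).symm]
      have : e ∈ ({d, Δ.rev d} : Set Δ.D) := h1 ▸ Set.mem_univ e
      exact this
    refine ⟨fun e => (if e = d then 1 else 0) - (if e = Δ.rev d then 1 else 0),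
      ⟨fun e => ?_, fun v => ?_⟩, by simp [(Δ.rev_ne d).symm], fun e _ => ?_⟩
    · simp only [Δ.rev_injective.eq_iff, rev_eq_iff]; ring
    · have : ∀ e, Δ.src e = v := fun e => Subsingleton.elim _ _
      simp [this]
    · have hd : Δ.Homologous d d := Or.inl fun _ _ => rfl
      rcases hall e with rfl | rfl
      · exact hd
      · exact hd.rev_right
  | glueAtVertex n Γ Δ _ p h ih => exact (ih.addLoop p).iso h.some
  | glueInEdge n Γ Δ _ d h ih => exact ((ih.subdivide d).addLoop none).iso h.some

/-! ### Roses -/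

/-- A graph can be oriented. -/
lemma exists_orientation (Γ : FinGraph) : ∃ O : Set Γ.D, (∀ d, Γ.rev d ∈ O ↔ d ∉ O) ∧
    2 * O.ncard = Nat.card Γ.D := by
  let i := (Finite.equivFin Γ.D)
  set O : Set Γ.D := {d | i d < i (Γ.rev d)}
  have hO : ∀ d, Γ.rev d ∈ O ↔ d ∉ O := fun d => by
    simp only [O, Set.mem_ofPred_eq, Γ.rev_rev, not_lt]
    exact ⟨le_of_lt, fun h => lt_of_le_of_ne h fun h' => Γ.rev_ne d (i.injective h')⟩
  have h1 : Γ.rev '' O = Oᶜ := by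
    ext d
    constructor
    · rintro ⟨e, he, rfl⟩
      rw [Set.mem_compl_iff, hO, not_not]; exact he
    · intro hd
      exact ⟨Γ.rev d, (hO d).2 hd, Γ.rev_rev d⟩
  have h2 : Oᶜ.ncard = O.ncard := by
    rw [← h1, Set.ncard_image_of_injective _ Γ.rev_injective]
  have h3 := Set.ncard_add_ncard_compl O
  exact ⟨O, hO, by omega⟩

/-- The edge group is the free group on the edges. -/
lemma exists_edgeGroup_equiv (Γ : FinGraph) :
    ∃ O : Set Γ.D, 2 * O.ncard = Nat.card Γ.D ∧ Nonempty (Γ.EdgeGroup ≃* FreeGroup O) := by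
  classical
  obtain ⟨O, hO, hcard⟩ := Γ.exists_orientation
  refine ⟨O, hcard, ⟨MonoidHom.toMulEquiv
    (Γ.liftEdge (fun d => if h : d ∈ O then FreeGroup.of ⟨d, h⟩
      else (FreeGroup.of ⟨Γ.rev d, (hO d).2 h⟩)⁻¹) fun d => ?_)
    (FreeGroup.lift fun d => Γ.edge d.1) ?_ ?_⟩⟩
  · by_cases h : d ∈ O
    · have h' : Γ.rev d ∉ O := fun h' => (hO d).1 h' h
      simp [h, h']
    · have h' := (hO d).2 h
      simp [h, h']
  · refine PresentedGroup.ext fun d => ?_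
    refine (congrArg (FreeGroup.lift fun d : O => Γ.edge d.1) (Γ.liftEdge_edge _ _ d)).trans ?_
    by_cases h : d ∈ O
    · simp only [h, dif_pos, FreeGroup.lift_apply_of]; rfl
    · simp only [h, dif_neg, not_false_eq_true, map_inv, FreeGroup.lift_apply_of, edge_rev,
        inv_inv]; rfl
  · ext d
    simp

/-- With a single vertex every word in the edges is a closed path, so π₁ is the whole edge group,
which is free on half of the oriented edges. -/
lemma card_D_of_rose {Γ : FinGraph} (hV : Nat.card Γ.V = 1) {v : Γ.V} {n : ℕ}
    (e : Fr n ≃* Γ.pi1 v) : Nat.card Γ.D = 2 * n := by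
  have : Subsingleton Γ.V := (Nat.card_eq_one_iff_unique.1 hV).1
  have htop : Γ.pi1 v = ⊤ := by
    rw [eq_top_iff]
    intro x hx
    obtain ⟨y, rfl⟩ := PresentedGroup.mk_surjective _ x
    clear hx
    induction y using FreeGroup.induction_on with
    | C1 => exact one_mem _
    | of d =>
      have := Γ.edge_mem_pathClasses d
      rwa [Subsingleton.elim (Γ.src d) v, Subsingleton.elim (Γ.tgt d) v] at this
    | inv_of d h => rw [map_inv]; exact inv_mem h
    | mul x y hx hy => rw [map_mul]; exact mul_mem hx hy
  obtain ⟨O, hO, ⟨f⟩⟩ := Γ.exists_edgeGroup_equiv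
  have g : FreeGroup (Fin n) ≃* FreeGroup O :=
    e.trans ((MulEquiv.subgroupCongr htop).trans (Subgroup.topEquiv.trans f))
  have h1 := Nat.card_congr (Equiv.ofFreeGroupEquiv g)
  rw [Nat.card_fin, Nat.card_coe_set_eq] at h1
  omega

end FinGraph

/-! ### Edge classes over a rose, and the characterization of cactus graphs by their classes. -/

namespace MarkedGraph

variable {n : ℕ}

open FinGraph (CollapseMap)

lemma card_D_of_rose {R : MarkedGraph n} (hR : Nat.card R.graph.V = 1) :
    Nat.card R.graph.D = 2 * n := FinGraph.card_D_of_rose hR R.marking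

/-- On a rose, each edge is represented by an element of the free group. -/
lemma exists_marking_eq_edge {R : MarkedGraph n} (hR : Nat.card R.graph.V = 1)
    (e : R.graph.D) : ∃ x, (R.marking x : R.graph.EdgeGroup) = R.graph.edge e := by
  have : Subsingleton R.graph.V := (Nat.card_eq_one_iff_unique.1 hR).1
  have h := R.graph.edge_mem_pathClasses e
  rw [Subsingleton.elim (R.graph.src e) R.base, Subsingleton.elim (R.graph.tgt e) R.base] at h
  exact ⟨R.marking.symm ⟨_, h⟩, by simp⟩

-- The element of F_n represented by the loop `e`. These elements are dual to the classes of the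
-- edges of the rose.
open Classical in
lemma exists_dual {R : MarkedGraph n} (hR : Nat.card R.graph.V = 1) (e : R.graph.D) :
    ∃ x, ∀ d, (R.cls d x).toAdd = (if d = e then 1 else 0) -
      (if d = R.graph.rev e then 1 else 0) := by
  obtain ⟨x, hx⟩ := exists_marking_eq_edge hR e
  refine ⟨x, fun d => ?_⟩
  rw [cls_apply, hx, FinGraph.count_edge, toAdd_ofAdd]
  simp only [eq_comm]

lemma cls_injective {R : MarkedGraph n} (hR : Nat.card R.graph.V = 1) :
    Function.Injective R.cls := by
  classical
  intro d e h
  obtain ⟨x, hx⟩ := exists_dual hR e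
  have h1 := hx d
  rw [h, hx e] at h1
  by_contra hne
  simp only [if_true, (R.graph.rev_ne e).symm, if_false, hne] at h1
  split_ifs at h1 <;> omega

lemma ncard_range_cls {R : MarkedGraph n} (hR : Nat.card R.graph.V = 1) :
    (Set.range R.cls).ncard = 2 * n := by
  rw [← Set.image_univ, Set.ncard_image_of_injective _ (cls_injective hR), Set.ncard_univ,
    card_D_of_rose hR]

/-- If no edge has a class different from the classes of the edges of a rose obtained by
collapsing a maximal tree, the classes are a cactus labelling. -/
lemma IsCollapse.isCactusLabel {A R : MarkedGraph n} {q : CollapseMap A.graph R.graph}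
    (hq : IsCollapse A R q) (hR : Nat.card R.graph.V = 1)
    (hA : Set.range A.cls ⊆ Set.range R.cls) :
    A.graph.IsCactusLabel (fun c : Fr n →* Multiplicative ℤ => c⁻¹) n A.cls := by
  classical
  have hrange : Set.range A.cls = Set.range R.cls := hA.antisymm (by
    rintro _ ⟨e, rfl⟩
    exact ⟨q.lift e, hq.cls_lift e⟩)
  refine ⟨A.cls_rev, fun d h => ?_, hrange ▸ ncard_range_cls hR, fun v c => ?_, ?_, A.connected⟩
  · obtain ⟨e, he⟩ := hA ⟨d, rfl⟩
    rw [← he, ← R.cls_rev] at h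
    exact R.graph.rev_ne e (cls_injective hR h)
  · by_cases hc : c ∈ Set.range R.cls
    · obtain ⟨e, rfl⟩ := hc
      obtain ⟨x, hx⟩ := exists_dual hR e
      -- Evaluated on the dual element of `e`, an edge counts 1 if its class is that of `e`, -1 if
      -- it is the inverse, and 0 otherwise. Conservation at `v` is therefore the required balance.
      have h1 := (A.isFlow_cls x).sum_eq_zero v
      have h2 : ∀ d, (if A.graph.src d = v then (A.cls d x).toAdd else 0) =
          (if A.graph.src d = v ∧ A.cls d = R.cls e then 1 else 0) -
          (if A.graph.src d = v ∧ A.cls d = (R.cls e)⁻¹ then 1 else 0) := fun d => by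
        obtain ⟨d', hd'⟩ := hA ⟨d, rfl⟩
        by_cases hv : A.graph.src d = v
        · simp only [hv, if_true, true_and, ← hd', hx, ← R.cls_rev, (cls_injective hR).eq_iff]
        · simp [hv]
      simp only [h2, Finset.sum_sub_distrib, Finset.sum_boole, sub_eq_zero, Nat.cast_inj] at h1
      rw [Set.ncard_eq_toFinset_card', Set.ncard_eq_toFinset_card']
      convert h1 using 2 <;> ext d <;> simp
    · have hc' : c⁻¹ ∉ Set.range R.cls := by
        rintro ⟨e, he⟩
        exact hc ⟨R.graph.rev e, by rw [R.cls_rev, he, inv_inv]⟩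
      have : ∀ c, c ∉ Set.range R.cls → {d | A.graph.src d = v ∧ A.cls d = c} = ∅ :=
        fun c hc => Set.eq_empty_of_forall_notMem fun d hd => hc (hd.2 ▸ hA ⟨d, rfl⟩)
      rw [this c hc, this _ hc']
  -- The 2n oriented edges of the rose survive, and the collapsed forest has at most 2|V| - 2
  -- oriented edges.
  · have h1 := Set.ncard_add_ncard_compl (Set.range q.lift)
    have h2 : (Set.range q.lift).ncard = 2 * n := by
      rw [← Set.image_univ, Set.ncard_image_of_injective _ q.lift_injective, Set.ncard_univ,
        card_D_of_rose hR]
    have h3 : (Set.range q.lift)ᶜ.ncard + 2 ≤ 2 * Nat.card A.graph.V := by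
      by_cases hne : (Set.range q.lift)ᶜ.Nonempty
      · refine (q.forest.ncard_add_two_le hne).trans (Nat.mul_le_mul_left 2 ?_)
        rw [← Set.ncard_univ]
        exact Set.ncard_le_ncard (Set.subset_univ _) (Set.toFinite _)
      · rw [Set.not_nonempty_iff_eq_empty.1 hne, Set.ncard_empty]
        have : Nonempty A.graph.V := ⟨A.base⟩
        have := Nat.card_pos (α := A.graph.V)
        omega
    omega

/-- In the star of a rose, the cactus graphs are the graphs all of whose edges have the class of
an edge of the rose. -/
lemma IsCollapse.isCactus_iff {A R : MarkedGraph n} {q : CollapseMap A.graph R.graph}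
    (hq : IsCollapse A R q) (hR : Nat.card R.graph.V = 1) :
    A.graph.IsCactus n ↔ Set.range A.cls ⊆ Set.range R.cls := by
  constructor
  · rintro h _ ⟨d, rfl⟩
    obtain ⟨z, hz, hzd, H⟩ := h.hasCycles d
    -- A forest carries no nonzero flow, so the circle through `d` has an edge surviving in the
    -- rose, and the class of `d` agrees with its class up to sign.
    obtain ⟨e, hze, he⟩ : ∃ e, z e ≠ 0 ∧ e ∉ q.kernel := by
      by_contra! hsub
      exact hzd (hz.eq_zero q.forest hsub d)
    obtain ⟨e, rfl⟩ := q.exists_lift he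
    rcases H _ hze with hw | hw
    · refine ⟨e, ?_⟩
      rw [← hq.cls_lift]
      exact MonoidHom.ext fun x => Multiplicative.toAdd.injective (hw _ (A.isFlow_cls x))
    · refine ⟨R.graph.rev e, ?_⟩
      rw [R.cls_rev, ← hq.cls_lift, inv_eq_iff_eq_inv]
      exact MonoidHom.ext fun x => Multiplicative.toAdd.injective (hw _ (A.isFlow_cls x))
  · intro h
    exact (hq.isCactusLabel hR h).isCactus inv_involutive (Or.inl A.three_le_valence)

lemma IsCollapse.card_V_lt {A R : MarkedGraph n} {q : CollapseMap A.graph R.graph}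
    (hq : IsCollapse A R q) (hR : Nat.card R.graph.V = 1)
    (hA : Set.range A.cls ⊆ Set.range R.cls) : Nat.card A.graph.V < n :=
  (hq.isCactusLabel hR hA).card_V_lt inv_involutive A.three_le_valence

end MarkedGraph

/-! ### Topology of geometric realizations -/

namespace Realization

universe u

variable {ι : Type u} {K : AbstractSimplicialComplex ι}

lemma finite_coord_ne_zero (x : Realization K) : {i | x.coord i ≠ 0}.Finite := by
  obtain ⟨s, -, h, -⟩ := x.exists_face
  exact s.finite_toSet.subset fun i hi => by_contra fun his => hi (h i his)

/-- The set of vertices of the open simplex containing a point. -/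
noncomputable def support (x : Realization K) : Finset ι := x.finite_coord_ne_zero.toFinset

lemma mem_support {x : Realization K} {i : ι} : i ∈ x.support ↔ x.coord i ≠ 0 := by
  simp [support]

lemma coord_eq_zero {x : Realization K} {i : ι} (h : i ∉ x.support) : x.coord i = 0 :=
  not_not.1 fun h' => h (mem_support.2 h')

lemma coord_pos {x : Realization K} {i : ι} (h : i ∈ x.support) : 0 < x.coord i :=
  lt_of_le_of_ne (x.nonneg i) (mem_support.1 h).symm

lemma coord_pos_iff {x : Realization K} {i : ι} : 0 < x.coord i ↔ i ∈ x.support :=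
  ⟨fun h => mem_support.2 h.ne', coord_pos⟩

lemma support_subset_iff {x : Realization K} {s : Finset ι} :
    x.support ⊆ s ↔ x ∈ closedSimplex K s :=
  ⟨fun h _ hi => coord_eq_zero fun h' => hi (h h'),
    fun h i hi => by_contra fun his => mem_support.1 hi (h i his)⟩

lemma sum_coord {x : Realization K} {s : Finset ι} (h : x.support ⊆ s) :
    ∑ i ∈ s, x.coord i = 1 := by
  have key : ∀ s, x.support ⊆ s → ∑ i ∈ s, x.coord i = ∑ i ∈ x.support, x.coord i :=
    fun s hs => (Finset.sum_subset hs fun i _ hi => coord_eq_zero hi).symm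
  obtain ⟨t, -, h0, h1⟩ := x.exists_face
  rw [key s h, ← key t (support_subset_iff.2 h0), h1]

lemma support_nonempty (x : Realization K) : x.support.Nonempty := by
  rw [Finset.nonempty_iff_ne_empty]
  intro h
  have := sum_coord (x := x) le_rfl
  rw [h] at this
  simp at this

lemma face_of_subset {s t : Finset ι} (hs : s ∈ K.faces) (h : t ⊆ s) (ht : t.Nonempty) :
    t ∈ K.faces := (K.isRelLowerSet_faces hs).2 h ht

lemma support_mem_faces (x : Realization K) : x.support ∈ K.faces := by
  obtain ⟨t, ht, h0, -⟩ := x.exists_face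
  exact face_of_subset ht (support_subset_iff.2 h0) x.support_nonempty

lemma isClosed_iff {C : Set (Realization K)} : IsClosed C ↔ ∀ s ∈ K.faces,
    ∃ T : Set (ι → ℝ), IsClosed T ∧ ∀ x ∈ closedSimplex K s, x ∈ C ↔ x.coord ∈ T := by
  have : IsClosed C ↔ ∀ s : K.faces, IsClosed[TopologicalSpace.induced
      (fun x : closedSimplex K s.1 => x.1.coord) inferInstance]
      ((Subtype.val : closedSimplex K s.1 → Realization K) ⁻¹' C) := by
    rw [isClosed_iSup_iff]
    exact forall_congr' fun s => isClosed_coinduced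
  rw [this, Subtype.forall]
  refine forall₂_congr fun s hs => ?_
  rw [isClosed_induced_iff]
  refine exists_congr fun T => and_congr_right fun _ => ?_
  rw [Set.ext_iff, Subtype.forall]
  exact forall₂_congr fun x _ => Iff.comm

/-- Inside a finite union of simplices the weak topology is given by the coordinates: a closed set
pulls back to a finite union, over the faces in `W`, of sets defined by closed conditions on
coordinates. -/
lemma continuous_of_support_subset {Z : Type*} [TopologicalSpace Z] {g : Z → Realization K}
    (W : Finset ι) (hW : ∀ z, (g z).support ⊆ W) (hg : ∀ i, Continuous fun z => (g z).coord i) :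
    Continuous g := by
  classical
  refine continuous_iff_isClosed.2 fun C hC => ?_
  have hpi : Continuous fun z => (g z).coord := continuous_pi hg
  have : g ⁻¹' C = ⋃ t ∈ {t ∈ (W.powerset : Set (Finset ι)) | t ∈ K.faces},
      {z | g z ∈ C ∧ (g z).support ⊆ t} := by
    ext z
    simp only [Set.mem_preimage, Set.mem_iUnion, exists_prop]
    constructor
    · intro hz
      exact ⟨_, ⟨by simpa using hW z, (g z).support_mem_faces⟩, hz, le_rfl⟩
    · rintro ⟨t, -, hz, -⟩
      exact hz
  rw [this]
  refine Set.Finite.isClosed_biUnion ((Finset.finite_toSet _).subset fun _ h => h.1) ?_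
  rintro t ⟨-, ht⟩
  obtain ⟨T, hT, hCT⟩ := isClosed_iff.1 hC t ht
  have : {z | g z ∈ C ∧ (g z).support ⊆ t} =
      (⋂ i ∈ {i | i ∉ t}, {z | (g z).coord i = 0}) ∩ (fun z => (g z).coord) ⁻¹' T := by
    ext z
    simp only [Set.mem_inter_iff, Set.mem_iInter, Set.mem_preimage, support_subset_iff]
    constructor
    · rintro ⟨h1, h2⟩
      exact ⟨h2, (hCT _ h2).1 h1⟩
    · rintro ⟨h1, h2⟩
      exact ⟨(hCT _ h1).2 h2, h1⟩
  rw [this]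
  exact (isClosed_biInter fun i _ => isClosed_eq (hg i) continuous_const).inter
    (hT.preimage hpi)

lemma continuous_of_simplices {Y : Type*} [TopologicalSpace Y] {f : Realization K → Y}
    (h : ∀ s ∈ K.faces, ∃ F : (ι → ℝ) → Y, Continuous F ∧
      ∀ x ∈ closedSimplex K s, f x = F x.coord) : Continuous f := by
  refine continuous_iff_isClosed.2 fun C hC => isClosed_iff.2 fun s hs => ?_
  obtain ⟨F, hF, hf⟩ := h s hs
  exact ⟨F ⁻¹' C, hC.preimage hF, fun x hx => by rw [Set.mem_preimage, hf x hx]; rfl⟩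

lemma continuous_coord (i : ι) : Continuous fun x : Realization K => x.coord i :=
  continuous_of_simplices fun _ _ => ⟨fun w => w i, continuous_apply i, fun _ _ => rfl⟩

lemma isClosed_closedSimplex (s : Finset ι) : IsClosed (closedSimplex K s) := by
  have : closedSimplex K s = ⋂ i ∈ {i | i ∉ s}, {x : Realization K | x.coord i = 0} := by
    ext x
    simp [closedSimplex]
  rw [this]
  exact isClosed_biInter fun i _ => isClosed_eq (continuous_coord i) continuous_const

lemma isClosed_iff_inter_closedSimplex {C : Set (Realization K)} :
    IsClosed C ↔ ∀ s ∈ K.faces, IsClosed (C ∩ closedSimplex K s) := by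
  refine ⟨fun h s _ => h.inter (isClosed_closedSimplex s), fun h => isClosed_iff.2 ?_⟩
  intro s hs
  obtain ⟨T, hT, h'⟩ := isClosed_iff.1 (h s hs) s hs
  exact ⟨T, hT, fun x hx => by rw [← h' x hx]; simp [hx]⟩

end Realization

/-- `π` is the quotient map by an action of `G` on the realization of `K` which permutes the
vertices, preserves a rank and where the vertices of a face have different ranks. -/
structure IsRankedQuotient {ι : Type u} (K : AbstractSimplicialComplex ι) (G : Type*) [Group G]
    [MulAction G ι] (r : ι → ℕ) {Q : Type u} [TopologicalSpace Q] (π : Realization K → Q) :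
    Prop where
  quot : IsQuotientMap π
  eq_iff : ∀ x y, π x = π y ↔ ∃ g : G, ∀ i, y.coord (g • i) = x.coord i
  rank_smul : ∀ (g : G) i, r (g • i) = r i
  injOn : ∀ s ∈ K.faces, Set.InjOn r s

/-! ### Quotients of realizations by rank-preserving actions. -/

namespace IsRankedQuotient

open Realization

variable {ι : Type u} {K : AbstractSimplicialComplex ι} {G : Type*} [Group G] [MulAction G ι]
  {r : ι → ℕ} {Q : Type u} [TopologicalSpace Q] {π : Realization K → Q}

lemma support_eq {x y : Realization K} {g : G} (h : ∀ i, y.coord (g • i) = x.coord i) (i : ι) :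
    g • i ∈ y.support ↔ i ∈ x.support := by
  rw [mem_support, mem_support, h]

/-- The points of `Q` represented by points whose support is contained in `P`. -/
def piece (π : Realization K → Q) (P : Set ι) : Set Q := {z | ∃ x, π x = z ∧ ↑x.support ⊆ P}

variable (hπ : IsRankedQuotient K G r π)

include hπ

lemma support_subset {P : Set ι} (hP : ∀ (g : G), ∀ i ∈ P, g • i ∈ P) {x : Realization K}
    (h : π x ∈ piece π P) : ↑x.support ⊆ P := by
  obtain ⟨y, hy, hs⟩ := h
  obtain ⟨g, hg⟩ := (hπ.eq_iff y x).1 hy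
  intro i hi
  have h1 : g • g⁻¹ • i ∈ x.support := by rwa [smul_inv_smul]
  have := hP g _ (hs ((support_eq hg _).1 h1))
  rwa [smul_inv_smul] at this

/-- By invariance of `P` every representative of a point of the piece is supported in `P`. So within
a simplex only its finitely many faces with vertices in `P` matter. -/
lemma isClosed_of_simplices {P : Set ι} (hP : ∀ (g : G), ∀ i ∈ P, g • i ∈ P) {A : Set Q}
    (hA : A ⊆ piece π P) (h : ∀ s ∈ K.faces, ↑s ⊆ P → IsClosed (π ⁻¹' A ∩ closedSimplex K s)) :
    IsClosed A := by
  classical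
  rw [← hπ.quot.isClosed_preimage, isClosed_iff_inter_closedSimplex]
  intro s hs
  have : π ⁻¹' A ∩ closedSimplex K s =
      ⋃ t ∈ {t ∈ (s.powerset : Set (Finset ι)) | t ∈ K.faces ∧ ↑t ⊆ P},
        π ⁻¹' A ∩ closedSimplex K t := by
    ext x
    simp only [Set.mem_iUnion, exists_prop]
    constructor
    · rintro ⟨h1, h2⟩
      exact ⟨x.support, ⟨by simpa using support_subset_iff.2 h2, x.support_mem_faces,
        hπ.support_subset hP (hA h1)⟩, h1, support_subset_iff.1 le_rfl⟩
    · rintro ⟨t, ⟨ht, -⟩, h1, h2⟩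
      refine ⟨h1, support_subset_iff.1 ((support_subset_iff.2 h2).trans (by simpa using ht))⟩
  rw [this]
  refine Set.Finite.isClosed_biUnion ((Finset.finite_toSet _).subset fun _ h => h.1) ?_
  rintro t ⟨-, ht, htP⟩
  exact h t ht htP

lemma isClosed_piece {P : Set ι} (hP : ∀ (g : G), ∀ i ∈ P, g • i ∈ P) :
    IsClosed (piece π P) := by
  refine hπ.isClosed_of_simplices hP le_rfl fun s hs hsP => ?_
  have : π ⁻¹' piece π P ∩ closedSimplex K s = closedSimplex K s := by
    refine Set.inter_eq_right.2 fun x hx => ⟨x, rfl, ?_⟩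
    exact (Finset.coe_subset.2 (support_subset_iff.2 hx)).trans hsP
  rw [this]
  exact isClosed_closedSimplex s

lemma continuous_of_simplices {P : Set ι} (hP : ∀ (g : G), ∀ i ∈ P, g • i ∈ P) {Y : Type*}
    [TopologicalSpace Y] {f : piece π P → Y}
    (h : ∀ s ∈ K.faces, (hs : ↑s ⊆ P) → Continuous fun x : closedSimplex K s =>
      f ⟨π x, x, rfl, (Finset.coe_subset.2 (support_subset_iff.2 x.2)).trans hs⟩) :
    Continuous f := by
  refine continuous_iff_isClosed.2 fun C hC => ?_
  rw [(hπ.isClosed_piece hP).isClosedEmbedding_subtypeVal.isClosed_iff_image_isClosed]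
  refine hπ.isClosed_of_simplices hP (by rintro _ ⟨z, -, rfl⟩; exact z.2) fun s hs hsP => ?_
  have h1 := hC.preimage (h s hs hsP)
  rw [(isClosed_closedSimplex s).isClosedEmbedding_subtypeVal.isClosed_iff_image_isClosed] at h1
  convert h1 using 1
  ext x
  constructor
  · rintro ⟨⟨z, hz, hzx⟩, hx⟩
    refine ⟨⟨x, hx⟩, ?_, rfl⟩
    have : z = ⟨π x, x, rfl, (Finset.coe_subset.2 (support_subset_iff.2 hx)).trans hsP⟩ :=
      Subtype.ext hzx
    rw [this] at hz
    exact hz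
  · rintro ⟨y, hy, rfl⟩
    exact ⟨⟨_, hy, rfl⟩, y.2⟩

/-! ### Separating functions -/

/-- The sum of the coordinates of rank `k`. -/
lemma exists_rankCoord (k : ℕ) : ∃ f : Q → ℝ, Continuous f ∧
    ∀ x, f (π x) = ∑ i ∈ x.support, if r i = k then x.coord i else 0 := by
  classical
  set F : Realization K → ℝ := fun x => ∑ i ∈ x.support, if r i = k then x.coord i else 0
  have hF : Continuous F := Realization.continuous_of_simplices fun s _ =>
    ⟨fun w => ∑ i ∈ s, if r i = k then w i else 0, continuous_finsetSum _ fun i _ => by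
      split_ifs
      · exact continuous_apply i
      · exact continuous_const, fun x hx => by
      refine Finset.sum_subset (support_subset_iff.2 hx) fun i _ hi => ?_
      rw [coord_eq_zero hi, ite_self]⟩
  have hw : ∀ x y, π x = π y → F x = F y := fun x y h => by
    obtain ⟨g, hg⟩ := (hπ.eq_iff x y).1 h
    refine Finset.sum_bij (fun i _ => g • i) (fun i hi => (support_eq hg i).2 hi)
      (fun i _ j _ h => MulAction.injective g h) (fun j hj => ⟨g⁻¹ • j, ?_, smul_inv_smul g j⟩)
      fun i _ => by rw [hπ.rank_smul, hg]
    rwa [← support_eq hg, smul_inv_smul]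
  refine ⟨fun z => F (Function.surjInv hπ.quot.surjective z), ?_, fun x => ?_⟩
  · refine hπ.quot.continuous_iff.2 (hF.congr fun x => ?_)
    exact (hw _ _ (Function.surjInv_eq hπ.quot.surjective (π x))).symm
  · exact hw _ _ (Function.surjInv_eq hπ.quot.surjective (π x))

/-- The function detecting the orbit of a face. -/
lemma exists_faceFun (s : Finset ι) : ∃ f : Q → ℝ, Continuous f ∧ ∀ x, f (π x) ≠ 0 ↔
    ∃ t ⊆ x.support, ∃ g : G, ∀ i, g • i ∈ t ↔ i ∈ s := by
  classical
  -- A product of coordinates over `t` is positive exactly if `t` lies in the support. The sum is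
  -- over the translates of `s` in the support, and terms vanish continuously when vertices leave
  -- it.
  set F : Realization K → ℝ := fun x => ∑ t ∈ x.support.powerset,
    if ∃ g : G, ∀ i, g • i ∈ t ↔ i ∈ s then ∏ i ∈ t, x.coord i else 0
  have hF : Continuous F := Realization.continuous_of_simplices fun u _ =>
    ⟨fun w => ∑ t ∈ u.powerset, if ∃ g : G, ∀ i, g • i ∈ t ↔ i ∈ s then ∏ i ∈ t, w i else 0,
      continuous_finsetSum _ fun i _ => by
        split_ifs
        · exact continuous_finsetProd _ fun i _ => continuous_apply i
        · exact continuous_const, fun x hx => by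
      refine Finset.sum_subset (Finset.powerset_mono.2 (support_subset_iff.2 hx))
        fun t _ ht => ?_
      obtain ⟨i, hi, hi'⟩ := Finset.not_subset.1 fun h => ht (Finset.mem_powerset.2 h)
      rw [Finset.prod_eq_zero hi (coord_eq_zero hi'), ite_self]⟩
  have hw : ∀ x y, π x = π y → F x = F y := fun x y h => by
    obtain ⟨g, hg⟩ := (hπ.eq_iff x y).1 h
    refine Finset.sum_bij (fun t _ => t.image (g • ·)) (fun t ht => ?_)
      (fun t _ t' _ h => ?_) (fun t ht => ⟨t.image (g⁻¹ • ·), ?_, ?_⟩) fun t ht => ?_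
    · rw [Finset.mem_powerset] at ht ⊢
      intro j hj
      obtain ⟨i, hi, rfl⟩ := Finset.mem_image.1 hj
      exact (support_eq hg i).2 (ht hi)
    · exact Finset.image_injective (MulAction.injective g) h
    · rw [Finset.mem_powerset] at ht ⊢
      intro j hj
      obtain ⟨i, hi, rfl⟩ := Finset.mem_image.1 hj
      rw [← support_eq hg, smul_inv_smul]
      exact ht hi
    · rw [Finset.image_image]
      simp [Function.comp_def]
    · rw [Finset.prod_image fun i _ j _ h => MulAction.injective g h]
      simp only [hg]
      refine if_congr ⟨?_, ?_⟩ rfl rfl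
      · rintro ⟨a, ha⟩
        refine ⟨g * a, fun i => ?_⟩
        rw [mul_smul, ← ha]
        exact (MulAction.injective g).mem_finset_image
      · rintro ⟨a, ha⟩
        refine ⟨g⁻¹ * a, fun i => ?_⟩
        rw [← ha, mul_smul, ← (MulAction.injective g).mem_finset_image (s := t), smul_inv_smul]
  refine ⟨fun z => F (Function.surjInv hπ.quot.surjective z), ?_, fun x => ?_⟩
  · refine hπ.quot.continuous_iff.2 (hF.congr fun x => ?_)
    exact (hw _ _ (Function.surjInv_eq hπ.quot.surjective (π x))).symm
  · have h0 : F (Function.surjInv hπ.quot.surjective (π x)) = F x :=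
      hw _ _ (Function.surjInv_eq hπ.quot.surjective (π x))
    simp only [h0]
    have hnn : ∀ t ∈ x.support.powerset,
        0 ≤ if ∃ g : G, ∀ i, g • i ∈ t ↔ i ∈ s then ∏ i ∈ t, x.coord i else 0 := fun t _ => by
      split_ifs
      · exact Finset.prod_nonneg fun i _ => x.nonneg i
      · exact le_rfl
    rw [Ne, Finset.sum_eq_zero_iff_of_nonneg hnn]
    push Not
    refine exists_congr fun t => ?_
    rw [Finset.mem_powerset]
    refine and_congr_right fun ht => ?_
    constructor
    · intro h
      by_contra hn
      exact h (if_neg hn)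
    · intro h
      rw [if_pos h]
      exact (Finset.prod_pos fun i hi => coord_pos (ht hi)).ne'

lemma rankCoord_apply {k : ℕ} {f : Q → ℝ}
    (hf : ∀ x, f (π x) = ∑ i ∈ x.support, if r i = k then x.coord i else 0) {x : Realization K}
    {s : Finset ι} (hs : s ∈ K.faces) (hx : x.support ⊆ s) {i : ι} (hi : i ∈ s) (hk : r i = k) :
    f (π x) = x.coord i := by
  rw [hf, Finset.sum_subset hx fun j _ hj => by rw [coord_eq_zero hj, ite_self],
    Finset.sum_eq_single i, if_pos hk]
  · intro j hj hne
    rw [if_neg]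
    exact fun h => hne (hπ.injOn s hs hj hi (h.trans hk.symm))
  · exact fun h => (h hi).elim

/-- Points are separated by real functions. The face functions provide a translation of the support
of `x` into that of `y`; the rank coordinates then identify the coordinates, since a rank occurs at
most once in a face. -/
lemma t2Space : T2Space Q := by
  classical
  choose ψ hψ hψ' using hπ.exists_rankCoord
  choose φ hφ hφ' using hπ.exists_faceFun
  refine T2Space.of_injective_continuous
    (f := fun z => ((fun k => ψ k z), (fun s => φ s z))) ?_
    ((continuous_pi hψ).prodMk (continuous_pi hφ))
  intro z z' h
  obtain ⟨x, rfl⟩ := hπ.quot.surjective z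
  obtain ⟨y, rfl⟩ := hπ.quot.surjective z'
  obtain ⟨h1, h2⟩ := Prod.ext_iff.1 h
  have h1 : ∀ k, ψ k (π x) = ψ k (π y) := fun k => congrFun h1 k
  have h2 : ∀ s, φ s (π x) = φ s (π y) := fun k => congrFun h2 k
  obtain ⟨t, ht, g, hg⟩ : ∃ t ⊆ y.support, ∃ g : G, ∀ i, g • i ∈ t ↔ i ∈ x.support := by
    rw [← hφ', ← h2, hφ']
    exact ⟨x.support, le_rfl, 1, fun i => by rw [one_smul]⟩
  refine (hπ.eq_iff x y).2 ⟨g, fun i => ?_⟩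
  have hval : ∀ (x : Realization K) {i}, i ∈ x.support → ψ (r i) (π x) = x.coord i :=
    fun x i hi => hπ.rankCoord_apply (hψ' _) x.support_mem_faces le_rfl hi rfl
  by_cases hi : i ∈ x.support
  · rw [← hval x hi, h1, ← hval y (ht ((hg i).2 hi)), hπ.rank_smul]
  · rw [coord_eq_zero hi]
    refine coord_eq_zero fun hy => ?_
    have h3 : ψ (r (g • i)) (π x) ≠ 0 := by
      rw [h1, hval y hy]
      exact mem_support.1 hy
    rw [hψ'] at h3
    obtain ⟨j, hj, hj'⟩ := Finset.exists_ne_zero_of_sum_ne_zero h3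
    have hr : r (g • j) = r (g • i) := by
      rw [hπ.rank_smul]
      by_contra hne
      exact hj' (if_neg hne)
    have := hπ.injOn _ y.support_mem_faces (ht ((hg j).2 hj)) hy hr
    exact hi (MulAction.injective g this ▸ hj)

end IsRankedQuotient

/-! ### Deformations of order complexes -/

/-- `K` is the order complex of the relation `R` (with the rank `r`), and `f` is a monotone map on
the set of vertices `U` with `R i (f i)`, which retracts `U` to its subset `P`. -/
structure IsMonotoneRetraction {ι : Type u} (K : AbstractSimplicialComplex ι) (R : ι → ι → Prop)
    (r : ι → ℕ) (U P : Set ι) (f : ι → ι) : Prop where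
  mem_faces_iff : ∀ s, s ∈ K.faces ↔ s.Nonempty ∧ IsChain R (s : Set ι)
  refl : ∀ i, R i i
  trans : ∀ i j k, R i j → R j k → R i k
  eq_of_rank_le : ∀ i j, R i j → r i ≤ r j → i = j
  subset : P ⊆ U
  map_mem : ∀ i ∈ U, f i ∈ P
  map_eq : ∀ i ∈ P, f i = i
  rel_map : ∀ i ∈ U, R i (f i)
  mono : ∀ i ∈ U, ∀ j ∈ U, R i j → R (f i) (f j)

namespace Realization

variable {ι : Type u} {K : AbstractSimplicialComplex ι}

/-- The mass moved away from the vertex `i` up to time `t`, when the vertices of low rank move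
first. -/
noncomputable def moved (r : ι → ℕ) (x : Realization K) (t : ℝ) (i : ι) : ℝ :=
  -- Time is a budget of mass: the vertices of lower rank use it first, and `i` takes what is left,
  -- up to its own mass.
  min (x.coord i) (max 0 (t - ∑ l ∈ x.support, if r l < r i then x.coord l else 0))

variable {r : ι → ℕ} {x : Realization K} {t : ℝ}

lemma moved_eq {s : Finset ι} (hs : x.support ⊆ s) (i : ι) : x.moved r t i =
    min (x.coord i) (max 0 (t - ∑ l ∈ s, if r l < r i then x.coord l else 0)) := by
  rw [moved, Finset.sum_subset hs fun j _ hj => by rw [coord_eq_zero hj, ite_self]]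

lemma moved_nonneg (i : ι) : 0 ≤ x.moved r t i := le_min (x.nonneg i) (le_max_left _ _)

lemma moved_le (i : ι) : x.moved r t i ≤ x.coord i := min_le_left _ _

lemma moved_of_notMem {i : ι} (h : i ∉ x.support) : x.moved r t i = 0 :=
  le_antisymm ((moved_le i).trans (coord_eq_zero h).le) (moved_nonneg i)

lemma moved_zero (i : ι) : x.moved r 0 i = 0 := by
  have : ∑ l ∈ x.support, (if r l < r i then x.coord l else 0) ≥ 0 :=
    Finset.sum_nonneg fun l _ => by split_ifs; exacts [x.nonneg l, le_rfl]
  rw [moved, max_eq_left (by linarith), min_eq_right (x.nonneg i)]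

lemma sum_lt_add_le {i : ι} (hi : i ∈ x.support) (p : ι → Prop) [DecidablePred p] (hp : ¬ p i)
    (q : ι → Prop) [DecidablePred q] (hq : q i) (hpq : ∀ j, p j → q j) :
    (∑ l ∈ x.support, if p l then x.coord l else 0) + x.coord i ≤
      ∑ l ∈ x.support, if q l then x.coord l else 0 := by
  classical
  have h1 := Finset.sum_ite_eq' x.support i x.coord
  rw [if_pos hi] at h1
  rw [← h1, ← Finset.sum_add_distrib]
  refine Finset.sum_le_sum fun l _ => ?_
  by_cases hl : l = i
  · subst hl; simp [hp, hq]
  · by_cases hpl : p l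
    · simp [hl, hpl, hpq l hpl]
    · simp only [hl, hpl, if_false, add_zero]
      split_ifs; exacts [x.nonneg l, le_rfl]

lemma moved_one (i : ι) : x.moved r 1 i = x.coord i := by
  by_cases hi : i ∈ x.support
  · have h1 := sum_lt_add_le hi (fun l => r l < r i) (lt_irrefl _) (fun _ => True) trivial
      fun _ _ => trivial
    simp only [if_true, sum_coord (x := x) le_rfl] at h1
    rw [moved]
    refine min_eq_left (le_max_of_le_right ?_)
    linarith
  · rw [moved_of_notMem hi, coord_eq_zero hi]

/-- If mass has been moved from a vertex, all mass has been moved from the vertices of lower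
rank. -/
lemma moved_eq_coord {i l : ι} (hl : 0 < x.moved r t l) (hil : r i < r l) :
    x.moved r t i = x.coord i := by
  by_cases hi : i ∈ x.support
  · have h1 := sum_lt_add_le hi (fun j => r j < r i) (lt_irrefl _) (fun j => r j < r l) hil
      fun _ h => h.trans hil
    have h2 : 0 < t - ∑ j ∈ x.support, if r j < r l then x.coord j else 0 := by
      by_contra! h
      rw [moved, max_eq_left h] at hl
      exact absurd hl (not_lt.2 (min_le_right _ _))
    rw [moved]
    refine min_eq_left (le_max_of_le_right ?_)
    linarith
  · rw [moved_of_notMem hi, coord_eq_zero hi]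

end Realization

namespace IsMonotoneRetraction

open Realization

variable {ι : Type u} {K : AbstractSimplicialComplex ι} {R : ι → ι → Prop} {r : ι → ℕ}
  {U P : Set ι} {f : ι → ι}

open Classical in
/-- The set of vertices of the simplex reached at time `t`. -/
noncomputable def slideFace (r : ι → ℕ) (f : ι → ι) (x : Realization K) (t : ℝ) : Finset ι :=
  x.support.filter (fun i => x.moved r t i < x.coord i) ∪
    (x.support.filter fun i => 0 < x.moved r t i).image f

/-- This is where the order of moving matters. If mass remains at `i` while mass has left `j`, then
`j` has rank at most that of `i`, so `R i j`, and hence `R i (f j)`. In another order `i` and `f j`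
might be incomparable. -/
lemma slideFace_mem_faces (h : IsMonotoneRetraction K R r U P f) {x : Realization K}
    (hx : ↑x.support ⊆ U) (t : ℝ) : slideFace r f x t ∈ K.faces := by
  classical
  have hchain := ((h.mem_faces_iff _).1 x.support_mem_faces).2
  have key : ∀ i ∈ x.support, ∀ j ∈ x.support, x.moved r t i < x.coord i →
      0 < x.moved r t j → R i (f j) := fun i hi j hj h1 h2 => by
    have hij : r j ≤ r i := by
      by_contra! hlt
      exact h1.ne (moved_eq_coord h2 hlt)
    refine h.trans _ _ _ ?_ (h.rel_map j (hx hj))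
    by_cases he : i = j
    · rw [he]; exact h.refl j
    · rcases hchain hi hj he with h' | h'
      · exact h'
      · exact (he (h.eq_of_rank_le _ _ h' hij).symm).elim
  refine (h.mem_faces_iff _).2 ⟨?_, ?_⟩
  · obtain ⟨i, hi⟩ := x.support_nonempty
    rcases (moved_le (r := r) (x := x) (t := t) i).lt_or_eq with h' | h'
    · exact ⟨i, Finset.mem_union_left _ (Finset.mem_filter.2 ⟨hi, h'⟩)⟩
    · exact ⟨f i, Finset.mem_union_right _ (Finset.mem_image_of_mem _
        (Finset.mem_filter.2 ⟨hi, h' ▸ coord_pos hi⟩))⟩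
  · intro a ha b hb hne
    rw [Finset.mem_coe, slideFace, Finset.mem_union] at ha hb
    rcases ha with ha | ha <;> rcases hb with hb | hb
    · exact hchain (Finset.mem_filter.1 ha).1 (Finset.mem_filter.1 hb).1 hne
    · obtain ⟨j, hj, rfl⟩ := Finset.mem_image.1 hb
      rw [Finset.mem_filter] at ha hj
      exact Or.inl (key a ha.1 j hj.1 ha.2 hj.2)
    · obtain ⟨j, hj, rfl⟩ := Finset.mem_image.1 ha
      rw [Finset.mem_filter] at hb hj
      exact Or.inr (key b hb.1 j hj.1 hb.2 hj.2)
    · obtain ⟨i, hi, rfl⟩ := Finset.mem_image.1 ha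
      obtain ⟨j, hj, rfl⟩ := Finset.mem_image.1 hb
      rw [Finset.mem_filter] at hi hj
      have hij : i ≠ j := fun he => hne (by rw [he])
      exact (hchain hi.1 hj.1 hij).imp (h.mono i (hx hi.1) j (hx hj.1))
        (h.mono j (hx hj.1) i (hx hi.1))

open Classical in
/-- The point reached at time `t`, when the mass at each vertex `i` is moved to `f i`, with the
vertices of low rank moving first. -/
noncomputable def slide (h : IsMonotoneRetraction K R r U P f) (x : Realization K)
    (hx : ↑x.support ⊆ U) (t : ℝ) : Realization K where
  coord j := ∑ i ∈ x.support, ((if i = j then x.coord i - x.moved r t i else 0) +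
    (if f i = j then x.moved r t i else 0))
  nonneg j := Finset.sum_nonneg fun i _ => add_nonneg
    (by split_ifs; exacts [sub_nonneg.2 (moved_le i), le_rfl])
    (by split_ifs; exacts [moved_nonneg i, le_rfl])
  exists_face := by
    refine ⟨slideFace r f x t, slideFace_mem_faces h hx t, fun j hj => ?_, ?_⟩
    · refine Finset.sum_eq_zero fun i hi => ?_
      rw [slideFace, Finset.mem_union, not_or] at hj
      have h1 : (if i = j then x.coord i - x.moved r t i else 0) = 0 := by
        split_ifs with hij
        · subst hij
          have := not_lt.1 fun h' => hj.1 (Finset.mem_filter.2 ⟨hi, h'⟩)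
          linarith [moved_le (r := r) (x := x) (t := t) i]
        · rfl
      have h2 : (if f i = j then x.moved r t i else 0) = 0 := by
        split_ifs with hij
        · by_contra hne
          exact hj.2 (Finset.mem_image.2 ⟨i, Finset.mem_filter.2
            ⟨hi, lt_of_le_of_ne (moved_nonneg i) (Ne.symm hne)⟩, hij⟩)
        · rfl
      rw [h1, h2, add_zero]
    · rw [Finset.sum_comm, ← sum_coord (x := x) le_rfl]
      refine Finset.sum_congr rfl fun i hi => ?_
      rw [Finset.sum_add_distrib, Finset.sum_ite_eq, Finset.sum_ite_eq]
      have h1 : (if i ∈ slideFace r f x t then x.coord i - x.moved r t i else 0) =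
          x.coord i - x.moved r t i := by
        refine ite_eq_left_iff.2 fun h' => ?_
        have := not_lt.1 fun h'' => h' (Finset.mem_union_left _ (Finset.mem_filter.2 ⟨hi, h''⟩))
        linarith [moved_le (r := r) (x := x) (t := t) i]
      have h2 : (if f i ∈ slideFace r f x t then x.moved r t i else 0) = x.moved r t i := by
        refine ite_eq_left_iff.2 fun h' => ?_
        by_contra hne
        exact h' (Finset.mem_union_right _ (Finset.mem_image_of_mem _ (Finset.mem_filter.2
            ⟨hi, lt_of_le_of_ne (moved_nonneg i) hne⟩)))
      rw [h1, h2, sub_add_cancel]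

variable (h : IsMonotoneRetraction K R r U P f)

open Classical in
lemma slide_coord (x : Realization K) (hx : ↑x.support ⊆ U) (t : ℝ) {s : Finset ι}
    (hs : x.support ⊆ s) (j : ι) : (h.slide x hx t).coord j =
      ∑ i ∈ s, ((if i = j then x.coord i - x.moved r t i else 0) +
        (if f i = j then x.moved r t i else 0)) := by
  refine Finset.sum_subset hs fun i _ hi => ?_
  rw [moved_of_notMem hi, coord_eq_zero hi]
  simp

lemma support_slide (x : Realization K) (hx : ↑x.support ⊆ U) (t : ℝ) {j : ι}
    (hj : j ∈ (h.slide x hx t).support) :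
    (∃ i ∈ x.support, i = j ∧ x.moved r t i ≠ x.coord i) ∨ ∃ i ∈ x.support, f i = j := by
  classical
  rw [mem_support, h.slide_coord x hx t le_rfl] at hj
  obtain ⟨i, hi, hne⟩ := Finset.exists_ne_zero_of_sum_ne_zero hj
  by_cases h1 : f i = j
  · exact Or.inr ⟨i, hi, h1⟩
  · rw [if_neg h1, add_zero] at hne
    by_cases h2 : i = j
    · rw [if_pos h2] at hne
      exact Or.inl ⟨i, hi, h2, fun h3 => hne (by rw [h3, sub_self])⟩
    · exact (hne (if_neg h2)).elim

lemma support_slide_subset (x : Realization K) (hx : ↑x.support ⊆ U) (t : ℝ) :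
    ↑(h.slide x hx t).support ⊆ U := by
  intro j hj
  rcases h.support_slide x hx t hj with ⟨i, hi, rfl, -⟩ | ⟨i, hi, rfl⟩
  · exact hx hi
  · exact h.subset (h.map_mem i (hx hi))

lemma slide_zero (x : Realization K) (hx : ↑x.support ⊆ U) : h.slide x hx 0 = x := by
  classical
  ext j
  rw [h.slide_coord x hx 0 le_rfl]
  simp only [moved_zero, sub_zero, ite_self, add_zero]
  rw [Finset.sum_ite_eq']
  exact ite_eq_left_iff.2 fun hj => (coord_eq_zero hj).symm

lemma support_slide_one (x : Realization K) (hx : ↑x.support ⊆ U) :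
    ↑(h.slide x hx 1).support ⊆ P := by
  intro j hj
  rcases h.support_slide x hx 1 hj with ⟨i, hi, rfl, hne⟩ | ⟨i, hi, rfl⟩
  · exact (hne (moved_one i)).elim
  · exact h.map_mem i (hx hi)

lemma slide_eq_self (x : Realization K) (hx : ↑x.support ⊆ U) (hP : ↑x.support ⊆ P) (t : ℝ) :
    h.slide x hx t = x := by
  classical
  ext j
  rw [h.slide_coord x hx t le_rfl, Finset.sum_congr rfl (g := fun i =>
    if i = j then x.coord i else 0), Finset.sum_ite_eq']
  · exact ite_eq_left_iff.2 fun hj => (coord_eq_zero hj).symm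
  · intro i hi
    rw [h.map_eq i (hP hi)]
    split_ifs <;> simp

lemma continuous_slide {s : Finset ι} (hs : ↑s ⊆ U) :
    Continuous fun p : closedSimplex K s × ℝ =>
      h.slide p.1.1 ((Finset.coe_subset.2 (support_subset_iff.2 p.1.2)).trans hs) p.2 := by
  classical
  refine continuous_of_support_subset (s ∪ s.image f) (fun p j hj => ?_) fun j => ?_
  · have hps := support_subset_iff.2 p.1.2
    rcases h.support_slide _ _ _ hj with ⟨i, hi, rfl, -⟩ | ⟨i, hi, rfl⟩
    · exact Finset.mem_union_left _ (hps hi)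
    · exact Finset.mem_union_right _ (Finset.mem_image_of_mem _ (hps hi))
  · have hc : ∀ i, Continuous fun p : closedSimplex K s × ℝ => p.1.1.coord i := fun i =>
      (continuous_coord i).comp (continuous_subtype_val.comp continuous_fst)
    have hm : ∀ i, Continuous fun p : closedSimplex K s × ℝ => p.1.1.moved r p.2 i := fun i => by
      have : Continuous fun p : closedSimplex K s × ℝ => min (p.1.1.coord i) (max 0
          (p.2 - ∑ l ∈ s, if r l < r i then p.1.1.coord l else 0)) := by
        refine (hc i).min (continuous_const.max (continuous_snd.sub
          (continuous_finsetSum _ fun l _ => ?_)))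
        split_ifs
        · exact hc l
        · exact continuous_const
      exact this.congr fun p => (moved_eq (support_subset_iff.2 p.1.2) i).symm
    have : Continuous fun p : closedSimplex K s × ℝ => ∑ i ∈ s,
        ((if i = j then p.1.1.coord i - p.1.1.moved r p.2 i else 0) +
        (if f i = j then p.1.1.moved r p.2 i else 0)) := by
      refine continuous_finsetSum _ fun i _ => Continuous.add ?_ ?_
      · split_ifs
        · exact (hc i).sub (hm i)
        · exact continuous_const
      · split_ifs
        · exact hm i
        · exact continuous_const
    exact this.congr fun p => (h.slide_coord _ _ _ (support_subset_iff.2 p.1.2) j).symm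

end IsMonotoneRetraction

/-! ### Descent of the deformation to the quotient. -/

namespace IsRankedQuotient

open Realization

variable {ι : Type u} {K : AbstractSimplicialComplex ι} {G : Type*} [Group G] [MulAction G ι]
  {r : ι → ℕ} {Q : Type u} [TopologicalSpace Q] {π : Realization K → Q} {R : ι → ι → Prop}
  {U P : Set ι} {f : ι → ι}

lemma slide_eq_of_eq (hπ : IsRankedQuotient K G r π) (h : IsMonotoneRetraction K R r U P f)
    (hf : ∀ (g : G), ∀ i ∈ U, f (g • i) = g • f i) {x y : Realization K} (hx : ↑x.support ⊆ U)
    (hy : ↑y.support ⊆ U) (hxy : π x = π y) (t : ℝ) :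
    π (h.slide x hx t) = π (h.slide y hy t) := by
  classical
  obtain ⟨g, hg⟩ := (hπ.eq_iff x y).1 hxy
  have hsum : ∀ F : ι → ℝ, ∑ i ∈ y.support, F i = ∑ i ∈ x.support, F (g • i) := fun F => by
    refine (Finset.sum_bij (fun i _ => g • i) (fun i hi => (support_eq hg i).2 hi)
      (fun i _ j _ h => MulAction.injective g h) (fun j hj => ⟨g⁻¹ • j, ?_, smul_inv_smul g j⟩)
      fun i _ => rfl).symm
    rwa [← support_eq hg, smul_inv_smul]
  have hm : ∀ i, y.moved r t (g • i) = x.moved r t i := fun i => by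
    rw [moved, moved, hg, hsum]
    simp only [hπ.rank_smul, hg]
  refine (hπ.eq_iff _ _).2 ⟨g, fun j => ?_⟩
  rw [h.slide_coord _ _ _ le_rfl, h.slide_coord _ _ _ le_rfl, hsum]
  refine Finset.sum_congr rfl fun i hi => ?_
  rw [hf g i (hx hi)]
  simp only [hg, hm, (MulAction.injective g).eq_iff]

lemma apply_mem_piece {Y : Type u} {π : Realization K → Y} {x : Realization K} (hx : ↑x.support ⊆ U) : π x ∈ piece π U := ⟨x, rfl, hx⟩

theorem strongDeformationRetractsOnto (hπ : IsRankedQuotient K G r π)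
    (h : IsMonotoneRetraction K R r U P f) (hU : ∀ (g : G), ∀ i ∈ U, g • i ∈ U)
    (hf : ∀ (g : G), ∀ i ∈ U, f (g • i) = g • f i) :
    StrongDeformationRetractsOnto (piece π U) (piece π P) := by
  have hsub : piece π P ⊆ piece π U := fun z ⟨x, hx, hs⟩ => ⟨x, hx, hs.trans h.subset⟩
  -- Defined through chosen representatives; equivariance of `f` makes the choice irrelevant.
  obtain ⟨H, hH⟩ : ∃ H : piece π U → ℝ → piece π U, ∀ (x : Realization K)
      (hx : (x.support : Set ι) ⊆ U) t, H ⟨π x, apply_mem_piece hx⟩ t =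
        ⟨π (h.slide x hx t), apply_mem_piece (h.support_slide_subset _ _ t)⟩ :=
    ⟨fun z t => ⟨π (h.slide z.2.choose z.2.choose_spec.2 t),
      apply_mem_piece (h.support_slide_subset _ _ t)⟩, fun x hx t =>
      Subtype.ext (hπ.slide_eq_of_eq h hf _ _ (apply_mem_piece hx).choose_spec.1 t)⟩
  have hc : ∀ (s : Finset ι) (hs : ↑s ⊆ U), Continuous fun p : closedSimplex K s × ℝ =>
      H ⟨π p.1.1, apply_mem_piece ((Finset.coe_subset.2 (support_subset_iff.2 p.1.2)).trans hs)⟩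
        p.2 := fun s hs => by
    have := (hπ.quot.continuous.comp (h.continuous_slide hs)).subtype_mk fun p =>
      apply_mem_piece (h.support_slide_subset p.1.1
        ((Finset.coe_subset.2 (support_subset_iff.2 p.1.2)).trans hs) p.2)
    exact this.congr fun p => (hH _ _ _).symm
  have hct : ∀ z, Continuous (H z) := by
    rintro ⟨z, x, rfl, hx⟩
    exact (hc x.support hx).comp
      (Continuous.prodMk_right (⟨x, support_subset_iff.1 le_rfl⟩ : closedSimplex K x.support))
  -- Continuity on simplices only tests maps out of the piece, not out of its product with the time
  -- axis. Currying moves time into the target; uncurrying works because ℝ is locally compact.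
  have hcurry : Continuous fun z => (⟨H z, hct z⟩ : C(ℝ, piece π U)) := by
    refine hπ.continuous_of_simplices hU fun s _ hs => ?_
    exact (ContinuousMap.curry ⟨_, hc s hs⟩).continuous
  have hjoint : Continuous fun p : piece π U × ℝ => H p.1 p.2 :=
    (ContinuousMap.uncurry ⟨_, hcurry⟩).continuous
  have hunit : Continuous fun p : unitInterval × piece π U => H p.2 (p.1 : ℝ) :=
    hjoint.comp (g := fun p : piece π U × ℝ => H p.1 p.2)
      (f := fun p : unitInterval × piece π U => (p.2, (p.1 : ℝ)))
      (continuous_snd.prodMk (continuous_subtype_val.comp continuous_fst))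
  have hone : Continuous fun z => H z 1 :=
    hjoint.comp (g := fun p : piece π U × ℝ => H p.1 p.2) (f := fun z => (z, (1 : ℝ)))
      (Continuous.prodMk_left (1 : ℝ))
  refine ⟨hsub, ⟨fun z => H z 1, hone⟩, ?_, ⟨{
    toFun := fun p => H p.2 p.1
    continuous_toFun := hunit
    map_zero_left := ?_
    map_one_left := fun _ => rfl
    prop' := ?_ }⟩⟩
  · rintro ⟨z, x, rfl, hx⟩
    change (H ⟨π x, x, rfl, hx⟩ 1 : Q) ∈ piece π P
    rw [hH x hx]
    exact ⟨_, rfl, h.support_slide_one x hx⟩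
  · rintro ⟨z, x, rfl, hx⟩
    exact (hH x hx 0).trans (Subtype.ext (congrArg π (h.slide_zero x hx)))
  · rintro t ⟨z, hz⟩ ⟨x, hx, hxP⟩
    change π x = z at hx
    subst hx
    exact (hH x (hxP.trans h.subset) t).trans
      (Subtype.ext (congrArg π (h.slide_eq_self x _ hxP t)))

end IsRankedQuotient

/-- A strong deformation retraction is a homotopy equivalence. -/
lemma StrongDeformationRetractsOnto.homotopyEquiv {Y : Type*} [TopologicalSpace Y] {S A : Set Y}
    (h : StrongDeformationRetractsOnto S A) :
    Nonempty (ContinuousMap.HomotopyEquiv S A) := by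
  obtain ⟨hA, r, hr, ⟨H⟩⟩ := h
  refine ⟨⟨⟨fun y => ⟨r y, hr y⟩, by fun_prop⟩, ⟨Set.inclusion hA, continuous_inclusion hA⟩,
    ?_, ?_⟩⟩
  · exact ⟨H.toHomotopy.symm⟩
  · have : ∀ a : A, r (Set.inclusion hA a) = Set.inclusion hA a := fun a => by
      have := H.prop' 1 (Set.inclusion hA a) a.2
      simpa using this
    have e : ContinuousMap.comp ⟨fun y => (⟨r y, hr y⟩ : A), by fun_prop⟩
        ⟨Set.inclusion hA, continuous_inclusion hA⟩ = ContinuousMap.id A :=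
      ContinuousMap.ext fun a => Subtype.ext (congrArg Subtype.val (this a) :)
    rw [e]

/-! ### The cell structure of a quotient of an order complex -/

section StandardSimplex

variable {k : ℕ}

/-- The barycentric coordinates of a point of the corner simplex in `ℝᵏ`. -/
noncomputable def bary (w : Fin k → ℝ) : Fin (k + 1) → ℝ := Fin.cons (1 - ∑ j, w j) w

lemma sum_bary (w : Fin k → ℝ) : ∑ j, bary w j = 1 := by
  rw [Fin.sum_univ_succ]
  simp [bary]

lemma continuous_bary (j : Fin (k + 1)) : Continuous fun w : Fin k → ℝ => bary w j := by
  induction j using Fin.cases with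
  | zero => simp only [bary, Fin.cons_zero]; fun_prop
  | succ j => simp only [bary, Fin.cons_succ]; fun_prop

lemma bary_lineMap (w v : Fin k → ℝ) (t : ℝ) (j : Fin (k + 1)) :
    bary (fun i => (1 - t) * w i + t * v i) j = (1 - t) * bary w j + t * bary v j := by
  induction j using Fin.cases with
  | zero =>
    simp only [bary, Fin.cons_zero, Finset.sum_add_distrib, ← Finset.mul_sum]
    ring
  | succ j => simp [bary]

/-- The corner simplex in `ℝᵏ`. -/
def cornerSimplex (k : ℕ) : Set (Fin k → ℝ) := {w | ∀ j, 0 ≤ bary w j}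

lemma isClosed_cornerSimplex : IsClosed (cornerSimplex k) := by
  simp only [cornerSimplex, Set.ofPred_forall]
  exact isClosed_iInter fun j => isClosed_le continuous_const (continuous_bary j)

lemma convex_cornerSimplex : Convex ℝ (cornerSimplex k) := by
  intro w hw v hv a b ha hb hab j
  obtain rfl : a = 1 - b := by linarith
  have e : (1 - b) • w + b • v = fun i => (1 - b) * w i + b * v i := by ext; simp
  rw [e, bary_lineMap]
  exact add_nonneg (mul_nonneg ha (hw j)) (mul_nonneg hb (hv j))

lemma isBounded_cornerSimplex : Bornology.IsBounded (cornerSimplex k) := by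
  refine (Metric.isBounded_closedBall (x := (0 : Fin k → ℝ)) (r := 1)).subset fun w hw => ?_
  rw [mem_closedBall_zero_iff, pi_norm_le_iff_of_nonneg zero_le_one]
  intro j
  have h1 := hw j.succ
  have h2 := Finset.single_le_sum (fun i _ => hw i) (Finset.mem_univ j.succ)
  rw [sum_bary] at h2
  simp only [bary, Fin.cons_succ] at h1 h2
  rw [Real.norm_eq_abs, abs_of_nonneg h1]
  exact h2

lemma bary_center (j : Fin (k + 1)) : 0 < bary (fun _ : Fin k => (1 / (k + 1) : ℝ)) j := by
  have h : (0 : ℝ) < k + 1 := by positivity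
  induction j using Fin.cases with
  | zero =>
    simp only [bary, Fin.cons_zero, Finset.sum_const, Finset.card_univ, Fintype.card_fin,
      nsmul_eq_mul, sub_pos]
    rw [mul_one_div, div_lt_one h]
    linarith
  | succ j =>
    simp only [bary, Fin.cons_succ]
    positivity

lemma mem_interior_cornerSimplex {w : Fin k → ℝ} :
    w ∈ interior (cornerSimplex k) ↔ ∀ j, 0 < bary w j := by
  constructor
  · intro hw j
    -- For small negative `t` the point moves slightly away from the center; a coordinate that is
    -- not positive at `w` would become negative there.
    set F : ℝ → Fin k → ℝ := fun t i => (1 - t) * w i + t * (1 / (k + 1) : ℝ)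
    have hF : Continuous F := by fun_prop
    have hF0 : F 0 = w := by ext; simp [F]
    have h1 : ∀ᶠ t in 𝓝[<] (0 : ℝ), F t ∈ cornerSimplex k := by
      refine (hF.tendsto 0).mono_left nhdsWithin_le_nhds ?_
      rw [hF0]
      exact mem_interior_iff_mem_nhds.1 hw
    obtain ⟨t, ht, ht0⟩ := (h1.and self_mem_nhdsWithin).exists
    have h2 := ht j
    rw [bary_lineMap w (fun _ => (1 / (k + 1) : ℝ))] at h2
    have ht0 : t < 0 := ht0
    by_contra! h3
    have h4 := mul_neg_of_neg_of_pos ht0 (bary_center j)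
    have h5 := mul_nonpos_of_nonneg_of_nonpos (by linarith : 0 ≤ 1 - t) h3
    linarith
  · intro h
    refine mem_interior.2 ⟨{w | ∀ j, 0 < bary w j}, fun v hv j => (hv j).le, ?_, h⟩
    simp only [Set.ofPred_forall]
    exact isOpen_iInter_of_finite fun j => isOpen_lt continuous_const (continuous_bary j)

end StandardSimplex

namespace Realization

variable {ι : Type u} {K : AbstractSimplicialComplex ι} {k : ℕ}

open Classical in
/-- The points of a simplex, given by barycentric coordinates. -/
noncomputable def ofCoords (s : Finset ι) (hs : s ∈ K.faces) (e : Fin (k + 1) ≃ s)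
    (w : cornerSimplex k) : Realization K where
  coord i := if hi : i ∈ s then bary w.1 (e.symm ⟨i, hi⟩) else 0
  nonneg i := by split_ifs; exacts [w.2 _, le_rfl]
  exists_face := by
    refine ⟨s, hs, fun i hi => dif_neg hi, ?_⟩
    rw [← Finset.sum_coe_sort, ← e.sum_comp, ← sum_bary w.1]
    exact Finset.sum_congr rfl fun j _ => by simp

variable (s : Finset ι) (hs : s ∈ K.faces) (e : Fin (k + 1) ≃ s)

lemma ofCoords_coord (w : cornerSimplex k) (j : Fin (k + 1)) :
    (ofCoords s hs e w).coord (e j) = bary w.1 j := by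
  simp [ofCoords]

lemma ofCoords_coord_of_notMem (w : cornerSimplex k) {i : ι} (hi : i ∉ s) :
    (ofCoords s hs e w).coord i = 0 := dif_neg hi

lemma support_ofCoords_subset (w : cornerSimplex k) : (ofCoords s hs e w).support ⊆ s :=
  support_subset_iff.2 fun _ => ofCoords_coord_of_notMem s hs e w

lemma support_ofCoords_eq_iff (w : cornerSimplex k) :
    (ofCoords s hs e w).support = s ↔ w.1 ∈ interior (cornerSimplex k) := by
  rw [mem_interior_cornerSimplex]
  constructor
  · intro h j
    rw [← ofCoords_coord s hs e]
    exact coord_pos (h.symm ▸ (e j).2)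
  · refine fun h => (support_ofCoords_subset s hs e w).antisymm fun i hi => ?_
    rw [← coord_pos_iff]
    have := h (e.symm ⟨i, hi⟩)
    rwa [← ofCoords_coord s hs e, Equiv.apply_symm_apply] at this

lemma continuous_ofCoords : Continuous (ofCoords s hs e) := by
  refine continuous_of_support_subset s (support_ofCoords_subset s hs e) fun i => ?_
  by_cases hi : i ∈ s
  · simp only [ofCoords, hi, dite_true]
    exact (continuous_bary _).comp continuous_subtype_val
  · simp only [ofCoords, hi, dite_false]
    exact continuous_const

lemma exists_ofCoords {x : Realization K} (hx : x.support ⊆ s) :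
    ∃ w, ofCoords s hs e w = x := by
  have h1 : 1 - ∑ j : Fin k, x.coord (e j.succ) = x.coord (e 0) := by
    rw [← sum_coord hx, ← Finset.sum_coe_sort, ← e.sum_comp, Fin.sum_univ_succ]
    ring
  have h2 : ∀ j, bary (fun j : Fin k => x.coord (e j.succ)) j = x.coord (e j) := fun j => by
    induction j using Fin.cases with
    | zero => exact h1
    | succ j => rfl
  refine ⟨⟨fun j => x.coord (e j.succ), fun j => (h2 j).symm ▸ x.nonneg _⟩, ?_⟩
  ext i
  by_cases hi : i ∈ s
  · have := ofCoords_coord s hs e ⟨fun j => x.coord (e j.succ), fun j => (h2 j).symm ▸ x.nonneg _⟩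
      (e.symm ⟨i, hi⟩)
    rwa [h2, Equiv.apply_symm_apply] at this
  · rw [ofCoords_coord_of_notMem s hs e _ hi, coord_eq_zero fun h => hi (hx h)]

end Realization

namespace IsRankedQuotient

open Realization Metric

variable {ι : Type u} {K : AbstractSimplicialComplex ι} {G : Type*} [Group G] [MulAction G ι]
  {r : ι → ℕ} {Q : Type u} [TopologicalSpace Q] {π : Realization K → Q} {P : Set ι}

/-- The characteristic map of the cell given by a face. -/
lemma exists_charMap (hπ : IsRankedQuotient K G r π) {k : ℕ} {s : Finset ι} (hs : s ∈ K.faces)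
    (hsP : ↑s ⊆ P) (hk : s.card = k + 1) : ∃ φ : PartialEquiv (Fin k → ℝ) (piece π P),
      φ.source = ball 0 1 ∧ ContinuousOn φ (closedBall 0 1) ∧ ContinuousOn φ.symm φ.target ∧
      (∀ z, z ∈ φ '' closedBall 0 1 ↔ ∃ x, π x = z ∧ x.support ⊆ s) ∧
      (∀ z, z ∈ φ '' ball 0 1 ↔ ∃ x, π x = z ∧ x.support = s) ∧
      ∀ v ∈ sphere (0 : Fin k → ℝ) 1, ∃ x, π x = φ v ∧ x.support ⊂ s := by
  classical
  -- Cells are parametrized by balls, so the simplex is first straightened to the unit ball.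
  obtain ⟨h, hb, hcb, hsp⟩ := exists_homeomorph_image_interior_closure_frontier_eq_unitBall
    (convex_cornerSimplex (k := k))
    ⟨_, mem_interior_cornerSimplex.2 (bary_center (k := k))⟩ isBounded_cornerSimplex
  rw [isClosed_cornerSimplex.closure_eq] at hcb
  rw [isClosed_cornerSimplex.frontier_eq] at hsp
  set e : Fin (k + 1) ≃ s := (s.equivFinOfCardEq hk).symm
  have hPs : ∀ w, π (ofCoords s hs e w) ∈ piece π P := fun w =>
    apply_mem_piece ((Finset.coe_subset.2 (support_ofCoords_subset s hs e w)).trans hsP)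
  have hmem : ∀ v, v ∈ closedBall (0 : Fin k → ℝ) 1 ↔ h.symm v ∈ cornerSimplex k := fun v => by
    rw [← hcb, h.image_eq_preimage_symm]; rfl
  have hmem' : ∀ v, v ∈ ball (0 : Fin k → ℝ) 1 ↔ h.symm v ∈ interior (cornerSimplex k) :=
    fun v => by rw [← hb, h.image_eq_preimage_symm]; rfl
  set w₀ : cornerSimplex k := ⟨_, fun j => (bary_center (k := k) j).le⟩
  obtain ⟨χ, hχ⟩ : ∃ χ : (Fin k → ℝ) → piece π P, ∀ v (hv : h.symm v ∈ cornerSimplex k),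
      χ v = ⟨π (ofCoords s hs e ⟨_, hv⟩), hPs _⟩ :=
    ⟨fun v => ⟨π (ofCoords s hs e (if hv : h.symm v ∈ cornerSimplex k then ⟨_, hv⟩ else w₀)),
      hPs _⟩, fun v hv => Subtype.ext (by simp [hv])⟩
  choose ψ hψ hψ' using hπ.exists_rankCoord
  -- The rank coordinates are functions on the quotient and recover the barycentric coordinates,
  -- because the vertices of `s` have different ranks. They give a continuous inverse.
  set η : piece π P → Fin k → ℝ := fun z => h fun j => ψ (r (e j.succ)) z
  have hη : Continuous η := h.continuous.comp
    (continuous_pi fun j => (hψ _).comp continuous_subtype_val)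
  have hηχ : ∀ v ∈ closedBall (0 : Fin k → ℝ) 1, η (χ v) = v := fun v hv => by
    rw [hmem] at hv
    refine h.symm.injective ((h.symm_apply_apply _).trans (funext fun j => ?_))
    rw [hχ v hv]
    refine (hπ.rankCoord_apply (hψ' _) hs (support_ofCoords_subset s hs e _) (e j.succ).2
      rfl).trans ?_
    rw [ofCoords_coord]
    rfl
  have hχc : ContinuousOn χ (closedBall 0 1) := by
    rw [continuousOn_iff_continuous_domRestrict]
    have h1 : Continuous fun v : closedBall (0 : Fin k → ℝ) 1 =>
        (⟨h.symm v.1, (hmem _).1 v.2⟩ : cornerSimplex k) :=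
      (h.symm.continuous.comp continuous_subtype_val).subtype_mk _
    have h2 := (hπ.quot.continuous.comp ((continuous_ofCoords s hs e).comp h1)).subtype_mk
      fun _ => hPs _
    exact h2.congr fun v => (hχ v.1 _).symm
  have himage : ∀ z x, π x = (z : piece π P) → x.support ⊆ s →
      ∃ v, ∃ hv : h.symm v ∈ cornerSimplex k, χ v = z ∧ ofCoords s hs e ⟨_, hv⟩ = x := by
    intro z x hx hxs
    obtain ⟨w, rfl⟩ := exists_ofCoords s hs e hxs
    have hw : h.symm (h w) ∈ cornerSimplex k := by rw [h.symm_apply_apply]; exact w.2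
    have hw' : (⟨_, hw⟩ : cornerSimplex k) = w := Subtype.ext (h.symm_apply_apply _)
    exact ⟨h w, hw, by rw [hχ _ hw]; exact Subtype.ext ((congrArg (fun w => π (ofCoords s hs e w)) hw').trans hx), by rw [hw']⟩
  refine ⟨{ toFun := χ
            invFun := η
            source := ball 0 1
            target := χ '' ball 0 1
            map_source' := fun v hv => ⟨v, hv, rfl⟩
            map_target' := ?_
            left_inv' := fun v hv => hηχ v (ball_subset_closedBall hv)
            right_inv' := ?_ }, rfl, hχc, hη.continuousOn, fun z => ⟨?_, ?_⟩, fun z => ⟨?_, ?_⟩, ?_⟩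
  · rintro _ ⟨v, hv, rfl⟩
    rwa [hηχ v (ball_subset_closedBall hv)]
  · rintro _ ⟨v, hv, rfl⟩
    rw [hηχ v (ball_subset_closedBall hv)]
  · rintro ⟨v, hv, rfl⟩
    exact ⟨_, (congrArg Subtype.val (hχ v ((hmem v).1 hv))).symm, support_ofCoords_subset s hs e _⟩
  · rintro ⟨x, hx, hxs⟩
    obtain ⟨v, hv, rfl, -⟩ := himage z x hx hxs
    exact ⟨v, (hmem v).2 hv, rfl⟩
  · rintro ⟨v, hv, rfl⟩
    exact ⟨_, (congrArg Subtype.val (hχ v ((hmem v).1 (ball_subset_closedBall hv)))).symm,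
      (support_ofCoords_eq_iff s hs e _).2 ((hmem' v).1 hv)⟩
  · rintro ⟨x, hx, hxs⟩
    obtain ⟨v, hv, rfl, rfl⟩ := himage z x hx hxs.subset
    exact ⟨v, (hmem' v).2 ((support_ofCoords_eq_iff s hs e _).1 hxs), rfl⟩
  · intro v hv
    rw [← hsp, h.image_eq_preimage_symm] at hv
    refine ⟨_, (congrArg Subtype.val (hχ v hv.1)).symm,
      (support_ofCoords_subset s hs e _).ssubset_of_ne fun he => ?_⟩
    exact hv.2 ((support_ofCoords_eq_iff s hs e _).1 he)

/-- The faces of dimension `k` with vertices in `P`, up to the action of `G`. -/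
def faceSetoid (K : AbstractSimplicialComplex ι) (G : Type*) [Group G] [MulAction G ι]
    (P : Set ι) (k : ℕ) : Setoid {s : Finset ι // s ∈ K.faces ∧ ↑s ⊆ P ∧ s.card = k + 1} where
  r s t := ∃ g : G, ∀ i, g • i ∈ t.1 ↔ i ∈ s.1
  iseqv :=
    { refl := fun s => ⟨1, fun i => by rw [one_smul]⟩
      symm := fun ⟨g, hg⟩ => ⟨g⁻¹, fun i => by rw [← hg, smul_inv_smul]⟩
      trans := fun ⟨g, hg⟩ ⟨g', hg'⟩ => ⟨g' * g, fun i => by rw [mul_smul, hg', hg]⟩ }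

lemma exists_translate (hπ : IsRankedQuotient K G r π) {s t : Finset ι} (ht : t ∈ K.faces)
    {g : G} (hg : ∀ i, g • i ∈ t ↔ i ∈ s) {x : Realization K} (hx : x.support ⊆ s) :
    ∃ y, π y = π x ∧ y.support ⊆ t := by
  have h0 : ∀ i ∉ t, x.coord (g⁻¹ • i) = 0 := fun i hi => coord_eq_zero fun h' =>
    hi (by have := (hg _).2 (hx h'); rwa [smul_inv_smul] at this)
  have h1 : ∑ i ∈ t, x.coord (g⁻¹ • i) = 1 := by
    rw [← sum_coord hx]
    refine (Finset.sum_bij (fun i _ => g • i) (fun i hi => (hg i).2 hi)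
      (fun i _ j _ h => MulAction.injective g h) (fun j hj => ⟨g⁻¹ • j, ?_, smul_inv_smul g j⟩)
      fun i _ => by rw [inv_smul_smul]).symm
    rwa [← hg, smul_inv_smul]
  set y : Realization K := ⟨fun i => x.coord (g⁻¹ • i), fun i => x.nonneg _, t, ht, h0, h1⟩
  exact ⟨y, ((hπ.eq_iff x y).2 ⟨g, fun i => congrArg x.coord (inv_smul_smul g i)⟩).symm,
    support_subset_iff.2 h0⟩

lemma card_eq_of_smul {s t : Finset ι} {g : G} (hg : ∀ i, g • i ∈ t ↔ i ∈ s) :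
    s.card = t.card :=
  Finset.card_bij (fun i _ => g • i) (fun i hi => (hg i).2 hi)
    (fun _ _ _ _ h => MulAction.injective g h)
    fun j hj => ⟨g⁻¹ • j, by rwa [← hg, smul_inv_smul], smul_inv_smul g j⟩

/-- There is one cell for each orbit of faces. Since ranks are preserved, no face is folded, and its
simplex embeds in the quotient. -/
theorem isCWComplexOfDim (hπ : IsRankedQuotient K G r π) (hP : ∀ (g : G), ∀ i ∈ P, g • i ∈ P)
    {d : ℕ} (hd : ∃ s ∈ K.faces, ↑s ⊆ P ∧ s.card = d + 1)
    (hd' : ∀ s ∈ K.faces, ↑s ⊆ P → s.card ≤ d + 1) : IsCWComplexOfDim (piece π P) d := by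
  classical
  set cell : ℕ → Type u := fun k => Quotient (faceSetoid K G P k)
  have hchar := fun k (c : cell k) =>
    hπ.exists_charMap (P := P) c.out.2.1 c.out.2.2.1 c.out.2.2.2
  choose φ hsource hcont hsymm hclosed hopen hsphere using hchar
  have hrel : ∀ {k} (s : {s : Finset ι // s ∈ K.faces ∧ ↑s ⊆ P ∧ s.card = k + 1}),
      ∃ g : G, ∀ i, g • i ∈ (Quotient.mk _ s : cell k).out.1 ↔ i ∈ s.1 := fun s =>
    (faceSetoid K G P _).symm (Quotient.mk_out (s := faceSetoid K G P _) s)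
  have hmem : ∀ {k} (s : {s : Finset ι // s ∈ K.faces ∧ ↑s ⊆ P ∧ s.card = k + 1})
      (z : piece π P) (x : Realization K), π x = z → x.support ⊆ s.1 →
      z ∈ φ k (Quotient.mk _ s) '' closedBall 0 1 := by
    intro k s z x hx hxs
    obtain ⟨g, hg⟩ := hrel s
    obtain ⟨y, hy, hys⟩ := hπ.exists_translate (Quotient.mk _ s : cell k).out.2.1 hg hxs
    exact (hclosed k _ z).2 ⟨y, hy.trans hx, hys⟩
  have hcard : ∀ {s : Finset ι}, s ∈ K.faces → s.card = s.card - 1 + 1 := fun hs =>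
    (Nat.succ_pred_eq_of_pos (Finset.card_pos.2 (K.isRelLowerSet_faces hs).1)).symm
  have hcl := (hπ.isClosed_piece hP).isClosedEmbedding_subtypeVal
  refine ⟨{ cell := cell
            map := φ
            source_eq := hsource
            continuousOn := hcont
            continuousOn_symm := hsymm
            pairwiseDisjoint' := ?_
            mapsTo' := ?_
            closed' := ?_
            union' := ?_ }, ?_, ?_⟩
  · rintro ⟨k, c⟩ - ⟨k', c'⟩ - hne
    refine Set.disjoint_left.2 fun z hz hz' => hne ?_
    obtain ⟨x, hx, hxs⟩ := (hopen k c z).1 hz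
    obtain ⟨y, hy, hys⟩ := (hopen k' c' z).1 hz'
    obtain ⟨g, hg⟩ := (hπ.eq_iff x y).1 (hx.trans hy.symm)
    have hg' : ∀ i, g • i ∈ c'.out.1 ↔ i ∈ c.out.1 := fun i => by
      rw [← hxs, ← hys]; exact support_eq hg i
    have hk := card_eq_of_smul hg'
    rw [c.out.2.2.2, c'.out.2.2.2, add_left_inj] at hk
    subst hk
    rw [← Quotient.out_eq c, ← Quotient.out_eq c',
      Quotient.sound (s := faceSetoid K G P k) ⟨g, hg'⟩]
  · intro k c
    -- The boundary of a cell meets only the finitely many cells given by faces of the chosen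
    -- representative.
    refine ⟨fun m => c.out.1.powerset.attach.biUnion fun t =>
      if ht : t.1 ∈ K.faces ∧ t.1.card = m + 1 then
        {((Quotient.mk _ ⟨t.1, ht.1, (Finset.coe_subset.2 (Finset.mem_powerset.1 t.2)).trans c.out.2.2.1,
          ht.2⟩) : cell m)} else ∅, fun v hv => ?_⟩
    obtain ⟨x, hx, hxs⟩ := hsphere k c v hv
    have hlt := Finset.card_lt_card hxs
    have hc := hcard x.support_mem_faces
    rw [c.out.2.2.2, hc] at hlt
    simp only [Set.mem_iUnion]
    refine ⟨x.support.card - 1, by omega, (Quotient.mk _ ⟨x.support, x.support_mem_faces,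
      (Finset.coe_subset.2 hxs.subset).trans c.out.2.2.1, hc⟩), ?_, hmem _ _ x hx le_rfl⟩
    refine Finset.mem_biUnion.2 ⟨⟨x.support, Finset.mem_powerset.2 hxs.subset⟩,
      Finset.mem_attach _ _, ?_⟩
    rw [dif_pos ⟨x.support_mem_faces, hc⟩]
    exact Finset.mem_singleton_self _
  · intro A _ hA
    rw [hcl.isClosed_iff_image_isClosed]
    refine hπ.isClosed_of_simplices hP (by rintro _ ⟨z, -, rfl⟩; exact z.2) fun s hs hsP => ?_
    have h1 := (hcl.isClosed_iff_image_isClosed.1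
      (hA _ (Quotient.mk _ ⟨s, hs, hsP, hcard hs⟩))).preimage hπ.quot.continuous
    convert h1.inter (isClosed_closedSimplex s) using 1
    ext x
    refine and_congr_left fun hx => ⟨?_, ?_⟩
    · rintro ⟨z, hz, hzx⟩
      exact ⟨z, ⟨hz, hmem _ z x hzx.symm (support_subset_iff.2 hx)⟩, hzx⟩
    · rintro ⟨z, hz, hzx⟩
      exact ⟨z, hz.1, hzx⟩
  · refine Set.eq_univ_of_forall fun z => ?_
    obtain ⟨x, hx, hxP⟩ := z.2
    simp only [Set.mem_iUnion]
    exact ⟨_, (Quotient.mk _ ⟨x.support, x.support_mem_faces, hxP, hcard x.support_mem_faces⟩),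
      hmem _ z x hx le_rfl⟩
  · obtain ⟨s, hs⟩ := hd
    exact ⟨((Quotient.mk _ ⟨s, hs⟩) : cell d)⟩
  · intro k hk
    refine ⟨fun c : cell k => ?_⟩
    have := hd' _ c.out.2.1 c.out.2.2.1
    rw [c.out.2.2.2] at this
    omega

end IsRankedQuotient

/-! ### A cactus graph with the maximal number of vertices -/

namespace FinGraph

/-- The edges of a graph, as a product. -/
lemma exists_equiv_prod_bool (Γ : FinGraph) {X : Type} [Finite X]
    (hX : 2 * Nat.card X = Nat.card Γ.D) :
    ∃ f : Γ.D ≃ X × Bool, ∀ d, f (Γ.rev d) = ((f d).1, !(f d).2) := by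
  classical
  obtain ⟨O, hO, hcard⟩ := Γ.exists_orientation
  have hOX : Nat.card O = Nat.card X := by
    rw [Nat.card_coe_set_eq]
    omega
  obtain ⟨e⟩ := Finite.card_eq.1 hOX
  have hO' : ∀ d, d ∉ O → Γ.rev d ∈ O := fun d => (hO d).2
  refine ⟨{ toFun := fun d => if h : d ∈ O then (e ⟨d, h⟩, false) else (e ⟨_, hO' d h⟩, true)
            invFun := fun p => bif p.2 then Γ.rev (e.symm p.1) else e.symm p.1
            left_inv := fun d => ?_
            right_inv := ?_ }, fun d => ?_⟩
  · by_cases h : d ∈ O <;> simp [h]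
  · rintro ⟨x, b⟩
    have h1 : (e.symm x : Γ.D) ∈ O := (e.symm x).2
    have h2 : Γ.rev (e.symm x) ∉ O := fun h => (hO _).1 h h1
    cases b <;> simp [h2]
  · by_cases h : d ∈ O
    · have h2 : Γ.rev d ∉ O := fun h' => (hO _).1 h' h
      simp [h, h2]
    · simp [h, hO' d h]

/-- A circle with `k + 1` vertices `v` and the edges `inr v` from `v` to `v + 1`, with a loop
`inl v` glued to each vertex. -/
abbrev necklace (k : ℕ) : FinGraph where
  V := ZMod (k + 1)
  D := (ZMod (k + 1) ⊕ ZMod (k + 1)) × Bool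
  src d := Sum.elim id (fun v => bif d.2 then v + 1 else v) d.1
  rev d := (d.1, !d.2)
  rev_rev d := by simp
  rev_ne d h := by simpa using congrArg Prod.snd h

variable {k : ℕ}

lemma necklace_exists_walk (u : ZMod (k + 1)) (m : ℕ) : ∃ l, (necklace k).IsWalk u (u + m) l ∧
    ∀ d ∈ l, ∃ t < m, d = (Sum.inr (u + t), false) := by
  induction m with
  | zero => exact ⟨[], by simp [IsWalk], by simp⟩
  | succ m ih =>
    obtain ⟨l, hl, hs⟩ := ih
    refine ⟨l ++ [(Sum.inr (u + m), false)], hl.append ⟨rfl, ?_⟩, fun d hd => ?_⟩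
    · simp [IsWalk, tgt, add_assoc]
    · rcases List.mem_append.1 hd with h | h
      · obtain ⟨t, ht, rfl⟩ := hs d h
        exact ⟨t, by omega, rfl⟩
      · exact ⟨m, by omega, List.mem_singleton.1 h⟩

lemma necklace_isConnected (k : ℕ) : (necklace k).IsConnected := by
  have key : ∀ v : ZMod (k + 1), ∃ l, (necklace k).IsWalk 0 v l := fun v => by
    obtain ⟨l, hl, -⟩ := necklace_exists_walk (0 : ZMod (k + 1)) v.val
    rw [ZMod.natCast_zmod_val, zero_add] at hl
    exact ⟨l, hl⟩
  intro u v
  obtain ⟨l, hl⟩ := key u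
  obtain ⟨m, hm⟩ := key v
  exact ⟨_, hl.reverse.append hm⟩

/-- A loop has equal end points, and the ends of an edge of the circle are joined by the other `k`
edges. -/
lemma necklace_not_isSeparating (d : (necklace k).D) : ¬ (necklace k).IsSeparating d := by
  rw [IsSeparating, not_not]
  obtain ⟨v | v, b⟩ := d
  · exact ⟨[], rfl, by simp, by simp⟩
  · obtain ⟨l, hl, hs⟩ := necklace_exists_walk (v + 1) k
    have hv : v + 1 + (k : ZMod (k + 1)) = v := by
      have := ZMod.natCast_self (k + 1)
      push_cast at this
      rw [add_assoc, add_comm 1, this, add_zero]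
    rw [hv] at hl
    have hne : ∀ b, ((Sum.inr v, b) : (necklace k).D) ∉ l := fun b hb => by
      obtain ⟨t, ht, he⟩ := hs _ hb
      have h1 : ((t + 1 : ℕ) : ZMod (k + 1)) = 0 := by
        have h2 := Sum.inr_injective (congrArg Prod.fst he)
        push_cast
        linear_combination -h2
      rw [ZMod.natCast_eq_zero_iff] at h1
      exact absurd (Nat.le_of_dvd (by omega) h1) (by omega)
    cases b
    · refine ⟨_, hl.reverse, fun h => hne _ (mem_revWalk.1 h), fun h => hne _ (mem_revWalk.1 h)⟩
    · exact ⟨l, hl, hne _, hne _⟩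

lemma necklace_three_le_valence (v : (necklace k).V) : 3 ≤ (necklace k).valence v := by
  rw [CollapseMap.valence_eq]
  refine (Set.two_lt_ncard_iff (Set.toFinite _)).2 ⟨(Sum.inl v, false), (Sum.inl v, true),
    (Sum.inr v, false), rfl, rfl, rfl, ?_, ?_, ?_⟩ <;> simp

/-- Part of the circle in a necklace. -/
def necklaceArc (k j : ℕ) : Set (necklace k).D :=
  {d | ∃ v : ZMod (k + 1), ∃ b, v.val < j ∧ d = (Sum.inr v, b)}

lemma mem_necklaceArc {j : ℕ} {v : ZMod (k + 1)} {b : Bool} :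
    ((Sum.inr v, b) : (necklace k).D) ∈ necklaceArc k j ↔ v.val < j := by
  constructor
  · rintro ⟨w, b, hw, h⟩
    rwa [Sum.inr_injective (congrArg Prod.fst h)]
  · exact fun h => ⟨v, b, h, rfl⟩

lemma necklaceArc_mono {i j : ℕ} (h : i ≤ j) : necklaceArc k i ⊆ necklaceArc k j := by
  rintro _ ⟨v, b, hv, rfl⟩
  exact mem_necklaceArc.2 (hv.trans_le h)

lemma val_add_one_of_lt {v : ZMod (k + 1)} (h : v.val < k) : (v + 1).val = v.val + 1 := by
  rw [ZMod.val_add_of_lt]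
  · obtain rfl | hk := Nat.eq_zero_or_pos k
    · omega
    · have : Fact (1 < k + 1) := ⟨by omega⟩
      rw [ZMod.val_one]
  · have h1 : (1 : ZMod (k + 1)).val ≤ 1 := by
      rw [ZMod.val_one_eq_one_mod]
      exact Nat.mod_le _ _
    omega

/-- The arc omits the edge from `k` back to 0, so there is no wrapping around: along a reduced path
`val` is strictly monotone, and the path cannot close. -/
lemma necklaceArc_walk {l : List (necklace k).D} : ∀ {u w : ZMod (k + 1)} {v : ZMod (k + 1)}
    {b : Bool}, (necklace k).IsWalk u w ((Sum.inr v, b) :: l) →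
      (necklace k).Reduced ((Sum.inr v, b) :: l) →
      (∀ d ∈ (Sum.inr v, b) :: l, d ∈ necklaceArc k k) →
      bif b then w.val < u.val else u.val < w.val := by
  induction l with
  | nil =>
    rintro u w v b ⟨rfl, rfl⟩ - hT
    have hv := val_add_one_of_lt (mem_necklaceArc.1 (hT _ List.mem_cons_self))
    cases b <;> simp [tgt, hv]
  | cons d l ih =>
    rintro u w v b ⟨rfl, hl⟩ hr hT
    have hv := val_add_one_of_lt (mem_necklaceArc.1 (hT _ List.mem_cons_self))
    obtain ⟨v', b', hv', rfl⟩ := hT d (by simp)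
    have h1 := ih hl hr.tail fun e he => hT e (List.mem_cons_of_mem _ he)
    have h2 := (List.isChain_cons_cons.1 hr).1
    have h3 := hl.1
    cases b <;> cases b' <;> simp [tgt] at h1 h2 h3 ⊢
    · omega
    · exact (h2 h3).elim
    · exact (h2 h3).elim
    · omega

lemma isForest_necklaceArc {j : ℕ} (hj : j ≤ k) : (necklace k).IsForest (necklaceArc k j) := by
  have hrev : ∀ j, ∀ d ∈ necklaceArc k j, (necklace k).rev d ∈ necklaceArc k j := by
    rintro j _ ⟨v, b, hv, rfl⟩
    exact mem_necklaceArc.2 hv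
  refine IsForest.subset (F := necklaceArc k k) ⟨hrev k, fun v l hl hT hr => ?_⟩
    (necklaceArc_mono hj) (hrev j)
  cases l with
  | nil => rfl
  | cons d l =>
    obtain ⟨v', b, -, rfl⟩ := hT d List.mem_cons_self
    have := necklaceArc_walk hl hr hT
    cases b <;> simp at this

/-- The collapsing map from a necklace onto a rose. -/
lemma exists_collapseMap_necklace {Δ : FinGraph} (hV : Nat.card Δ.V = 1)
    (hD : Nat.card Δ.D = 2 * (k + 2)) :
    ∃ q : CollapseMap (necklace k) Δ, q.kernel = necklaceArc k k := by
  obtain ⟨f, hf⟩ := Δ.exists_equiv_prod_bool (X := Option (ZMod (k + 1))) (by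
    rw [hD, Finite.card_option, Nat.card_zmod])
  obtain ⟨hsub, ⟨x⟩⟩ := Nat.card_eq_one_iff_unique.1 hV
  -- The petals of the rose are the `k + 1` loops and, for `none`, the single uncollapsed edge of
  -- the circle, which starts at -1, the vertex with value `k`.
  set g : Option (ZMod (k + 1)) → ZMod (k + 1) ⊕ ZMod (k + 1) := fun o =>
    o.elim (Sum.inr (-1)) Sum.inl
  have hg : Function.Injective g := by
    rintro (_ | v) (_ | w) h <;> simp [g] at h ⊢
    exact h
  have hk : (Set.range fun e => ((g (f e).1, (f e).2) : (necklace k).D))ᶜ = necklaceArc k k := by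
    ext ⟨v | v, b⟩
    · refine iff_of_false (fun h => h ⟨f.symm (some v, b), by simp [g]⟩) ?_
      rintro ⟨w, b, -, h⟩
      simp at h
    · rw [mem_necklaceArc, Set.mem_compl_iff]
      constructor
      · intro h
        by_contra hv
        refine h ⟨f.symm (none, b), ?_⟩
        have h1 : v = -1 := ZMod.val_injective _ (by
          rw [ZMod.val_neg_one]
          have := v.val_lt
          omega)
        simp [g, h1]
      · rintro hv ⟨e, he⟩
        have h1 := congrArg Prod.fst he
        rcases h2 : (f e).1 with _ | w
        · simp only [g, h2, Option.elim_none, Sum.inr.injEq] at h1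
          rw [← h1, ZMod.val_neg_one] at hv
          exact lt_irrefl _ hv
        · simp [g, h2] at h1
  refine ⟨{ onV := fun _ => x
            lift := fun e => (g (f e).1, (f e).2)
            onV_surjective := fun y => ⟨0, Subsingleton.elim _ _⟩
            lift_injective := fun d e h => ?_
            src_lift := fun e => Subsingleton.elim _ _
            rev_lift := fun e => by rw [hf]
            forest := by rw [hk]; exact isForest_necklaceArc le_rfl
            onV_eq_iff := fun u v => iff_of_true rfl ?_ }, hk⟩
  · obtain ⟨h1, h2⟩ := Prod.ext_iff.1 h
    exact f.injective (Prod.ext (hg h1) h2)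
  · rw [hk]
    have key : ∀ v : ZMod (k + 1), ∃ l, (necklace k).IsWalk 0 v l ∧
        ∀ d ∈ l, d ∈ necklaceArc k k := fun v => by
      obtain ⟨l, hl, hs⟩ := necklace_exists_walk (0 : ZMod (k + 1)) v.val
      rw [ZMod.natCast_zmod_val, zero_add] at hl
      refine ⟨l, hl, fun d hd => ?_⟩
      obtain ⟨t, ht, rfl⟩ := hs d hd
      have hvk := v.val_lt
      rw [zero_add, mem_necklaceArc, ZMod.val_natCast_of_lt (by omega)]
      omega
    obtain ⟨l, hl, hs⟩ := key u
    obtain ⟨m, hm, hs'⟩ := key v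
    refine ⟨_, hl.reverse.append hm, fun d hd => (List.mem_append.1 hd).elim (fun h => ?_) (hs' d)⟩
    exact (isForest_necklaceArc le_rfl).rev_mem_iff.1 (hs _ (mem_revWalk.1 h))

/-- At each vertex the loop cancels, so the flow is constant along the circle. Hence all edges of
the circle share the class of the one that survives in the rose. -/
lemma IsFlow.necklace_eq {w : (necklace k).D → ℤ} (hw : (necklace k).IsFlow w)
    (v : ZMod (k + 1)) : w (Sum.inr v, false) = w (Sum.inr (-1), false) := by
  classical
  have hstep : ∀ v : ZMod (k + 1), w (Sum.inr (v + 1), false) = w (Sum.inr v, false) := fun v => by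
    have h1 := hw.sum_eq_zero (v + 1)
    have hS : ∀ {I : Fintype (necklace k).D} {f : (necklace k).D → ℤ}, (∀ d ∉
        ({(Sum.inl (v + 1), false), (Sum.inl (v + 1), true), (Sum.inr (v + 1), false),
          (Sum.inr v, true)} : Finset (necklace k).D), f d = 0) → _ = ∑ d, f d :=
      fun h => Finset.sum_subset (fun _ _ => Finset.mem_univ _) fun d _ => h d
    rw [← hS] at h1
    · have h2 := hw.rev (Sum.inl (v + 1), false)
      have h3 := hw.rev (Sum.inr v, false)
      simp at h1 h2 h3
      omega
    · rintro ⟨u | u, b⟩ hd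
      · refine if_neg fun (h : u = v + 1) => hd ?_
        cases b <;> simp [h]
      · refine if_neg fun h => hd ?_
        cases b
        · have h : u = v + 1 := h
          simp [h]
        · have h : u + 1 = v + 1 := h
          simp [add_right_cancel h]
  have key : ∀ m : ℕ, w (Sum.inr (-1 + m), false) = w (Sum.inr (-1), false) := fun m => by
    induction m with
    | zero => simp
    | succ m ih =>
      rw [← ih, ← hstep (-1 + m)]
      push_cast
      rw [add_assoc]
  have := key (v + 1).val
  rw [ZMod.natCast_zmod_val] at this
  rw [← this]
  congr 3
  ring

end FinGraph

/-! ### A maximal simplex of cactus graphs in the star of a rose. -/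

namespace MarkedGraph

open FinGraph

/-- An increasing sequence of forests gives a simplex. -/
lemma IsCollapse.exists_face {n k : ℕ} {A R : MarkedGraph n} {q : CollapseMap A.graph R.graph}
    (hq : IsCollapse A R q) {F : ℕ → Set A.graph.D} (hF : ∀ j, A.graph.IsForest (F j))
    (hmono : ∀ i j, i ≤ j → F i ⊆ F j) (hne : ∀ i j, i < j → j ≤ k → (F j \ F i).Nonempty)
    (hk : F k ⊆ q.kernel) : ∃ s ∈ (spineComplex n).faces, s.card = k + 1 ∧
      ∀ v ∈ s, (SpineVertex.mk A).Collapses v ∧ v.Collapses (SpineVertex.mk R) := by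
  classical
  set p := fun j => CollapseMap.ofCollapse A.graph (F j) (hF j)
  have hp : ∀ j, (p j).kernel = F j := fun j => CollapseMap.kernel_ofCollapse _ _ _
  have hA : ∀ j, IsCollapse A (A.push (p j)) (p j) := fun j => A.isCollapse_push _
  set v := fun j => SpineVertex.mk (A.push (p j))
  have hsub : ∀ i j, i ≤ j → (p i).kernel ⊆ (p j).kernel := fun i j h => by
    rw [hp, hp]; exact hmono i j h
  have hcol : ∀ i j, i ≤ j → (v i).Collapses (v j) := fun i j h =>
    SpineVertex.collapses_mk.2 ⟨_, (hA i).factor (hA j) (hsub i j h)⟩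
  have hrank : ∀ i j, i < j → j ≤ k → (v j).rank < (v i).rank := fun i j h hjk => by
    refine ((p i).factor (p j) (hsub i j h.le)).card_V_lt ?_
    obtain ⟨d, hd, hd'⟩ := hne i j h hjk
    rw [← hp] at hd hd'
    obtain ⟨e, rfl⟩ := (p i).exists_lift hd'
    exact ⟨e, (CollapseMap.mem_kernel_factor _ _ _ _).2 hd⟩
  refine ⟨(Finset.range (k + 1)).image v, ⟨by simp, ?_⟩, ?_, ?_⟩
  · rw [Finset.coe_image]
    rintro _ ⟨i, -, rfl⟩ _ ⟨j, -, rfl⟩ -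
    exact (le_total i j).imp (hcol i j) (hcol j i)
  · rw [Finset.card_image_of_injOn, Finset.card_range]
    intro i hi j hj h
    rw [Finset.mem_coe, Finset.mem_range] at hi hj
    rcases lt_trichotomy i j with h' | h' | h'
    · exact absurd (congrArg SpineVertex.rank h) (hrank i j h' (by omega)).ne'
    · exact h'
    · exact absurd (congrArg SpineVertex.rank h) (hrank j i h' (by omega)).ne
  · intro w hw
    obtain ⟨j, hj, rfl⟩ := Finset.mem_image.1 hw
    rw [Finset.mem_range] at hj
    refine ⟨SpineVertex.collapses_mk.2 ⟨_, hA j⟩,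
      SpineVertex.collapses_mk.2 ⟨_, (hA j).factor hq ?_⟩⟩
    exact (hp j).le.trans ((hmono j k (by omega)).trans hk)

/-- The star of a rose of rank `k + 2` contains a simplex with `k + 1` vertices all of which are
cactus graphs. -/
theorem exists_cactus_chain {k : ℕ} (R : MarkedGraph (k + 2))
    (hR : Nat.card R.graph.V = 1) : ∃ s ∈ (spineComplex (k + 2)).faces,
      (∀ v ∈ s, v.Collapses (SpineVertex.mk R) ∧ v.classes ⊆ (SpineVertex.mk R).classes) ∧
      s.card = k + 1 := by
  obtain ⟨q, hk⟩ := exists_collapseMap_necklace hR (card_D_of_rose hR)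
  set A := R.pull q (necklace_isConnected k) necklace_not_isSeparating necklace_three_le_valence
  have hq : IsCollapse A R q := R.isCollapse_pull _ _ _ _
  have hne : ∀ i j, i < j → j ≤ k →
      (necklaceArc k (min j k) \ necklaceArc k (min i k)).Nonempty := fun i j h hj => by
    have hi : (i : ZMod (k + 1)).val = i := ZMod.val_natCast_of_lt (by omega)
    refine ⟨(Sum.inr (i : ZMod (k + 1)), false), mem_necklaceArc.2 ?_, fun h' => ?_⟩
    · rwa [hi, min_eq_left hj]
    · have := mem_necklaceArc.1 h'
      rw [hi, min_eq_left (by omega)] at this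
      exact lt_irrefl i this
  -- The index is capped at `k`, since longer arcs are the full circle, which is not a forest.
  obtain ⟨s, hs, hcard, hsv⟩ := hq.exists_face (k := k) (F := fun j => necklaceArc k (min j k))
    (fun j => isForest_necklaceArc (min_le_right j k))
    (fun i j h => necklaceArc_mono (min_le_min_right k h)) hne
    ((necklaceArc_mono (min_le_right k k)).trans hk.ge)
  have hc : ∀ d : (necklace k).D, A.cls d ∈ Set.range R.cls := by
    have hlift : ∀ d ∉ q.kernel, A.cls d ∈ Set.range R.cls := fun d hd => by
      obtain ⟨e, rfl⟩ := q.exists_lift hd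
      exact ⟨e, (hq.cls_lift e).symm⟩
    have hcircle : ∀ v, A.cls ((Sum.inr v, false) : (necklace k).D) ∈ Set.range R.cls := by
      intro v
      have h1 : A.cls ((Sum.inr v, false) : (necklace k).D) =
          A.cls ((Sum.inr (-1), false) : (necklace k).D) :=
        MonoidHom.ext fun x => Multiplicative.toAdd.injective
          (IsFlow.necklace_eq (A.isFlow_cls x) v)
      rw [h1]
      refine hlift _ ?_
      rw [hk, mem_necklaceArc, ZMod.val_neg_one]
      exact lt_irrefl k
    rintro ⟨v | v, b⟩
    · refine hlift _ ?_
      rw [hk]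
      rintro ⟨w, b, -, h⟩
      simp at h
    · cases b
      · exact hcircle v
      · obtain ⟨e, he⟩ := hcircle v
        refine ⟨R.graph.rev e, ?_⟩
        rw [R.cls_rev, he]
        exact (A.cls_rev ((Sum.inr v, false) : (necklace k).D)).symm
  refine ⟨s, hs, fun v hv => ⟨(hsv v hv).2,
    (SpineVertex.classes_subset (hsv v hv).1).trans ?_⟩, hcard⟩
  rw [SpineVertex.classes_mk, SpineVertex.classes_mk]
  rintro _ ⟨d, rfl⟩
  exact hc d

end MarkedGraph

/-! ### Stars of roses in the quotient by the Torelli group -/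

namespace SpineVertex

variable {n : ℕ}

lemma one_le_rank (v : SpineVertex n) : 1 ≤ v.rank := by
  obtain ⟨A, rfl⟩ := exists_rep v
  have : Nonempty A.graph.V := ⟨A.base⟩
  exact Nat.card_pos (α := A.graph.V)

lemma isRose_iff {v : SpineVertex n} : v.IsRose ↔ v.rank = 1 := by
  constructor
  · rintro ⟨A, rfl, h⟩
    exact h
  · intro h
    obtain ⟨A, rfl⟩ := exists_rep v
    exact ⟨A, rfl, h⟩

/-- In the star of a rose, the cactus graphs are those without further classes of edges. -/
lemma isCactus_iff {A : MarkedGraph n} {σ : SpineVertex n} (hσ : σ.IsRose)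
    (h : (mk A).Collapses σ) : A.graph.IsCactus n ↔ (mk A).classes ⊆ σ.classes := by
  obtain ⟨R, rfl, hR⟩ := hσ
  obtain ⟨q, hq⟩ := collapses_mk.1 h
  rw [hq.isCactus_iff hR, classes_mk, classes_mk]

lemma rank_lt {v σ : SpineVertex n} (hσ : σ.IsRose) (h : v.Collapses σ)
    (hc : v.classes ⊆ σ.classes) : v.rank < n := by
  obtain ⟨A, rfl⟩ := exists_rep v
  obtain ⟨R, rfl, hR⟩ := hσ
  obtain ⟨q, hq⟩ := collapses_mk.1 h
  rw [classes_mk, classes_mk] at hc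
  exact hq.card_V_lt hR hc

end SpineVertex

section SpineFaces

variable {n : ℕ}

lemma spineComplex_injOn_rank {s : Finset (SpineVertex n)} (hs : s ∈ (spineComplex n).faces) :
    Set.InjOn SpineVertex.rank (s : Set (SpineVertex n)) := by
  intro i hi j hj h
  by_contra hne
  rcases hs.2 hi hj hne with h' | h'
  · exact hne (h'.eq_of_rank_le h.le)
  · exact hne (h'.eq_of_rank_le h.ge).symm

lemma spineComplex_collapses {s : Finset (SpineVertex n)} (hs : s ∈ (spineComplex n).faces)
    {v w : SpineVertex n} (hv : v ∈ s) (hw : w ∈ s) (h : w.rank ≤ v.rank) : v.Collapses w := by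
  by_cases hvw : v = w
  · exact hvw ▸ .refl v
  · refine (hs.2 hv hw hvw).resolve_right fun h' => hvw ?_
    exact (h'.eq_of_rank_le h).symm

end SpineFaces

namespace TorelliQuotient

open Realization IsRankedQuotient

variable {n : ℕ}

lemma smul_coord (g : (torelli n).op) (x : Spine n) (v : SpineVertex n) :
    (g • x).coord (g • v) = x.coord v :=
  congrArg x.coord (inv_smul_smul g.1 v)

lemma isRankedQuotient_proj (n : ℕ) :
    IsRankedQuotient (spineComplex n) (torelli n).op SpineVertex.rank (proj (n := n)) where
  quot := isQuotientMap_quotient_mk'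
  eq_iff x y := by
    have : proj x = proj y ↔ x ∈ MulAction.orbit (torelli n).op y :=
      Quotient.eq.trans MulAction.orbitRel_apply
    rw [this]
    constructor
    · rintro ⟨g, rfl⟩
      refine ⟨g⁻¹, fun i => ?_⟩
      rw [← smul_coord g y, smul_inv_smul]
    · rintro ⟨g, hg⟩
      refine ⟨g⁻¹, ?_⟩
      ext i
      change (g⁻¹ • y).coord i = x.coord i
      rw [← hg, ← smul_coord g⁻¹ y, inv_smul_smul]
  rank_smul g v := SpineVertex.rank_smul g.1 v
  injOn _ hs := spineComplex_injOn_rank hs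

lemma eq_of_coord_eq_one {x : Spine n} {v w : SpineVertex n} (hv : x.coord v = 1)
    (hw : x.coord w ≠ 0) : v = w := by
  classical
  by_contra hne
  have h1 : ({v, w} : Finset _) ⊆ x.support := by
    intro i hi
    rw [Finset.mem_insert, Finset.mem_singleton] at hi
    rw [mem_support]
    rcases hi with rfl | rfl
    · rw [hv]; exact one_ne_zero
    · exact hw
  have h2 := Finset.sum_le_sum_of_subset_of_nonneg h1 fun i _ _ => x.nonneg i
  rw [sum_coord le_rfl, Finset.sum_pair hne, hv] at h2
  exact hw (le_antisymm (by linarith) (x.nonneg w))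

lemma IsRepresentedBy.exists_smul_eq {ρ : TorelliQuotient n} {σ τ : SpineVertex n}
    (hσ : ρ.IsRepresentedBy σ) (hτ : ρ.IsRepresentedBy τ) : ∃ g : (torelli n).op, g • σ = τ := by
  obtain ⟨x, hx, rfl⟩ := hσ
  obtain ⟨y, hy, hyx⟩ := hτ
  obtain ⟨g, hg⟩ := ((isRankedQuotient_proj n).eq_iff x y).1 hyx.symm
  exact ⟨g, (eq_of_coord_eq_one hy (by rw [hg, hx]; exact one_ne_zero)).symm⟩

lemma IsRepresentedBy.smul {ρ : TorelliQuotient n} {σ : SpineVertex n}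
    (hσ : ρ.IsRepresentedBy σ) (g : (torelli n).op) : ρ.IsRepresentedBy (g • σ) := by
  obtain ⟨x, hx, rfl⟩ := hσ
  refine ⟨g • x, by rw [smul_coord, hx], ?_⟩
  exact ((isRankedQuotient_proj n).eq_iff _ _).2 ⟨g⁻¹, fun i => by
    rw [← smul_coord g x, smul_inv_smul]⟩

/-- The marked roses representing `ρ`. -/
def roses (ρ : TorelliQuotient n) : Set (SpineVertex n) :=
  {σ | σ.IsRose ∧ ρ.IsRepresentedBy σ}

/-- The vertices in the stars of the marked roses representing `ρ`. -/
def starVertices (ρ : TorelliQuotient n) : Set (SpineVertex n) :=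
  {v | ∃ σ ∈ ρ.roses, v.Collapses σ}

/-- The cactus graphs in the stars of the marked roses representing `ρ`. -/
def cactusVertices (ρ : TorelliQuotient n) : Set (SpineVertex n) :=
  {v | ∃ σ ∈ ρ.roses, v.Collapses σ ∧ v.classes ⊆ σ.classes}

variable {ρ : TorelliQuotient n}

lemma smul_mem_roses (g : (torelli n).op) {σ : SpineVertex n} (h : σ ∈ ρ.roses) :
    g • σ ∈ ρ.roses := by
  refine ⟨SpineVertex.isRose_iff.2 ?_, h.2.smul g⟩
  rw [(isRankedQuotient_proj n).rank_smul]
  exact SpineVertex.isRose_iff.1 h.1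

lemma smul_mem_starVertices (g : (torelli n).op) {v : SpineVertex n} (h : v ∈ ρ.starVertices) :
    g • v ∈ ρ.starVertices := by
  obtain ⟨σ, hσ, h⟩ := h
  exact ⟨g • σ, smul_mem_roses g hσ, h.smul g.1⟩

lemma smul_mem_cactusVertices (g : (torelli n).op) {v : SpineVertex n}
    (h : v ∈ ρ.cactusVertices) : g • v ∈ ρ.cactusVertices := by
  obtain ⟨σ, hσ, h, hc⟩ := h
  refine ⟨g • σ, smul_mem_roses g hσ, h.smul g.1, ?_⟩
  rwa [SpineVertex.classes_smul, SpineVertex.classes_smul]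

/-- The marked roses over `ρ` form one Torelli orbit. Thus the set of classes to be kept depends
only on `ρ`. -/
lemma classes_eq {σ τ : SpineVertex n} (hσ : σ ∈ ρ.roses) (hτ : τ ∈ ρ.roses) :
    σ.classes = τ.classes := by
  obtain ⟨g, rfl⟩ := hσ.2.exists_smul_eq hτ.2
  exact (SpineVertex.classes_smul g σ).symm

lemma cactusVertices_subset : ρ.cactusVertices ⊆ ρ.starVertices :=
  fun _ ⟨σ, hσ, h, _⟩ => ⟨σ, hσ, h⟩

lemma star_eq (ρ : TorelliQuotient n) : ρ.star = piece proj ρ.starVertices := by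
  classical
  refine Set.Subset.antisymm ?_ ?_
  · intro y hy
    simp only [star, Set.mem_iUnion] at hy
    obtain ⟨σ, hσ, x, hx, rfl⟩ := hy
    simp only [Realization.star, Set.mem_iUnion] at hx
    obtain ⟨s, ⟨hs, hσs⟩, hx⟩ := hx
    refine apply_mem_piece fun i hi => ⟨σ, hσ, ?_⟩
    refine spineComplex_collapses hs (support_subset_iff.2 hx hi) hσs ?_
    rw [SpineVertex.isRose_iff.1 hσ.1]
    exact i.one_le_rank
  · rintro y ⟨x, rfl, hx⟩
    -- All vertices of the support collapse to the one of least rank, hence to the same rose `σ`,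
    -- which can be adjoined to the simplex.
    obtain ⟨m, hm, hmin⟩ := x.support.exists_min_image SpineVertex.rank x.support_nonempty
    obtain ⟨σ, hσ, hmσ⟩ := hx hm
    have hcol : ∀ i ∈ x.support, i.Collapses σ := fun i hi =>
      (spineComplex_collapses x.support_mem_faces hi hm (hmin i hi)).trans hmσ
    simp only [star, Set.mem_iUnion]
    refine ⟨σ, hσ, x, ?_, rfl⟩
    simp only [Realization.star, Set.mem_iUnion]
    refine ⟨insert σ x.support, ⟨⟨Finset.insert_nonempty _ _, ?_⟩, Finset.mem_insert_self _ _⟩,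
      support_subset_iff.1 (Finset.subset_insert _ _)⟩
    rw [Finset.coe_insert]
    exact x.support_mem_faces.2.insert fun i hi _ => Or.inr (hcol i hi)

/-- The underlying graph belongs to the vertex of largest rank, and collapsing only removes classes.
So if that vertex has no classes beyond those of the rose, neither has any other vertex of the
support. -/
lemma cactusSpace_eq (ρ : TorelliQuotient n) : ρ.cactusSpace = piece proj ρ.cactusVertices := by
  refine Set.Subset.antisymm ?_ ?_
  · rintro y ⟨hy, x, ⟨A, hA, hcol, hcac⟩, rfl⟩
    rw [star_eq] at hy
    have hx := (isRankedQuotient_proj n).support_subset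
      (fun g i hi => smul_mem_starVertices g hi) hy
    obtain ⟨σ, hσ, hAσ⟩ := hx (coord_pos_iff.1 hA)
    rw [SpineVertex.isCactus_iff hσ.1 hAσ] at hcac
    refine apply_mem_piece fun τ hτ => ?_
    obtain ⟨σ', hσ', hτσ'⟩ := hx hτ
    refine ⟨σ', hσ', hτσ', ?_⟩
    rw [classes_eq hσ' hσ]
    exact (SpineVertex.classes_subset (hcol τ (coord_pos hτ))).trans hcac
  · rintro y ⟨x, rfl, hx⟩
    obtain ⟨m, hm, hmax⟩ := x.support.exists_max_image SpineVertex.rank x.support_nonempty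
    obtain ⟨A, rfl⟩ := SpineVertex.exists_rep m
    obtain ⟨σ, hσ, hmσ, hc⟩ := hx hm
    refine ⟨?_, x, ⟨A, coord_pos hm, fun τ hτ => ?_, ?_⟩, rfl⟩
    · rw [star_eq]
      exact apply_mem_piece (hx.trans cactusVertices_subset)
    · have hτ' := coord_pos_iff.1 hτ
      exact spineComplex_collapses x.support_mem_faces hm hτ' (hmax τ hτ')
    · exact (SpineVertex.isCactus_iff hσ.1 hmσ).2 hc

/-- The map collapses every edge whose class is not that of an edge of a rose over `ρ`. If there is
no such rose, the star has no vertices and any map will do. -/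
lemma exists_isMonotoneRetraction (ρ : TorelliQuotient n) : ∃ f,
    IsMonotoneRetraction (spineComplex n) SpineVertex.Collapses SpineVertex.rank
      ρ.starVertices ρ.cactusVertices f ∧
    ∀ (g : (torelli n).op), ∀ v ∈ ρ.starVertices, f (g • v) = g • f v := by
  classical
  by_cases hne : ρ.roses.Nonempty
  swap
  · have h1 : ∀ v, v ∉ ρ.starVertices := fun v ⟨σ, hσ, _⟩ => hne ⟨σ, hσ⟩
    exact ⟨id, ⟨fun _ => Iff.rfl, .refl, fun _ _ _ => .trans,
      fun _ _ => SpineVertex.Collapses.eq_of_rank_le, cactusVertices_subset, fun i hi => (h1 i hi).elim,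
      fun _ _ => rfl, fun i hi => (h1 i hi).elim, fun i hi => (h1 i hi).elim⟩,
      fun _ _ _ => rfl⟩
  obtain ⟨σ₀, hσ₀⟩ := hne
  have hex : ∀ v ∈ ρ.starVertices, ∃ w ∈ ρ.cactusVertices, SpineVertex.IsRetract σ₀.classes v w := by
    rintro v ⟨σ, hσ, h⟩
    obtain ⟨w, hw, hwσ⟩ := SpineVertex.exists_isRetract h (classes_eq hσ hσ₀)
    refine ⟨w, ⟨σ, hσ, hwσ, ?_⟩, hw⟩
    rw [classes_eq hσ hσ₀]
    exact hw.classes_subset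
  have : Nonempty (SpineVertex n) := ⟨σ₀⟩
  choose! f hfP hf using hex
  refine ⟨f, ⟨fun _ => Iff.rfl, .refl, fun _ _ _ => .trans,
    fun _ _ => SpineVertex.Collapses.eq_of_rank_le, cactusVertices_subset, hfP, fun i hi => ?_,
    fun i hi => (hf i hi).collapses, fun i hi j hj h => (hf i hi).mono (hf j hj) h⟩,
    fun g v hv => (hf _ (smul_mem_starVertices g hv)).unique ((hf v hv).smul g)⟩
  refine (hf i (cactusVertices_subset hi)).unique (SpineVertex.isRetract_self ?_)
  obtain ⟨σ, hσ, -, hc⟩ := hi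
  rwa [classes_eq hσ₀ hσ]

/-- The vertices of a simplex of cactus graphs have different ranks between 1 and `k + 1`; the
collapses of a necklace realize all of these ranks. -/
lemma isCWComplexOfDim {k : ℕ} {ρ : TorelliQuotient (k + 2)} (hρ : ρ.IsRose) :
    IsCWComplexOfDim (piece proj ρ.cactusVertices) k := by
  refine (isRankedQuotient_proj (k + 2)).isCWComplexOfDim
    (fun g i hi => smul_mem_cactusVertices g hi) ?_ fun s hs hsP => ?_
  · obtain ⟨σ, hσ, hρσ⟩ := hρ
    obtain ⟨R, rfl, hR⟩ := hσ
    obtain ⟨s, hs, hsv, hk⟩ := R.exists_cactus_chain hR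
    exact ⟨s, hs, fun v hv => ⟨_, ⟨⟨R, rfl, hR⟩, hρσ⟩, hsv v hv⟩, hk⟩
  · have h1 := Finset.card_le_card_of_injOn (t := Finset.Ico 1 (k + 2)) SpineVertex.rank
      (fun v hv => ?_) (spineComplex_injOn_rank hs)
    · simpa using h1
    · obtain ⟨σ, hσ, h, hc⟩ := hsP hv
      exact Finset.mem_coe.2 (Finset.mem_Ico.2 ⟨v.one_le_rank, SpineVertex.rank_lt hσ.1 h hc⟩)

end TorelliQuotient

theorem mainTheorem6 (n : ℕ) (ρ : TorelliQuotient n) (hρ : ρ.IsRose) :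
    StrongDeformationRetractsOnto ρ.star ρ.cactusSpace ∧
    (2 ≤ n → ∃ (Z : Type 1) (_ : TopologicalSpace Z), T2Space Z ∧ IsCWComplexOfDim Z (n - 2) ∧
      Nonempty (ContinuousMap.HomotopyEquiv ρ.star Z)) := by
  have hπ := TorelliQuotient.isRankedQuotient_proj n
  obtain ⟨f, hf, hfg⟩ := ρ.exists_isMonotoneRetraction
  have hsdr : StrongDeformationRetractsOnto ρ.star ρ.cactusSpace := by
    rw [TorelliQuotient.star_eq, TorelliQuotient.cactusSpace_eq]
    exact hπ.strongDeformationRetractsOnto hf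
      (fun g i hi => TorelliQuotient.smul_mem_starVertices g hi) hfg
  refine ⟨hsdr, fun hn => ⟨ρ.cactusSpace, inferInstance, ?_, ?_, hsdr.homotopyEquiv⟩⟩
  · have := hπ.t2Space
    infer_instance
  · obtain ⟨k, rfl⟩ := Nat.exists_eq_add_of_le' hn
    rw [TorelliQuotient.cactusSpace_eq]
    exact TorelliQuotient.isCWComplexOfDim hρ
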